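/- Let $k$ be a field and let $R=k[x,y]$, with the standard grading and the lexicographic term order induced by $x>y$. Let $L\subset R$ be a lex-segment ideal with $\dim_k R/L<\infty$, i.e. a monomial ideal which, with every monomial it contains, also contains all lexicographically larger monomials of the same degree. Let $I\subset R$ be a homogeneous ideal with the same Hilbert function as $L$, let $\beta_{i,j}(I)=\dim_k \operatorname{Tor}_i^R(I,k)_j$ be its graded Betti numbers, and put $\beta=(\beta_{0,j}(I))_{j\ge 0}$. Let $K$ be any infinite extension field of $k$ (for example $K=k$ if $k$ is infinite, or an algebraic closure of $k$). Consider, over $K$, the variety $V(L)$ of all homogeneous ideals $J\subset K[x,y]$ whose initial ideal is $LK[x,y]$. It is embedded in an affine space $\mathbf A^N(K)$, with its Zariski topology, by the coefficients $\lambda(m,m')$ of the reduced Gröbner basis $$f_m=m-\sum_{m'}\lambda(m,m')\,m'$$ of $J$, where $m$ runs over the minimal monomial generators of $L$ and $m'$ over the monomials outside $L$ with $\deg m'=\deg m$ and $m'<m$. Let $$V(L,\beta)=\{J\in V(L):\ \beta_{0,j}(J)=\beta_{0,j}(I)\ \text{for all } j\},\qquad V(L,\ge\beta)=\{J\in V(L):\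 \beta_{0,j}(J)\ge \beta_{0,j}(I)\ \text{for all } j\}.$$ Then $V(L,\ge\beta)$ is irreducible, it is the closure of $V(L,\beta)$, and its codimension in $V(L)$ (the height of its ideal in the coordinate ring of $V(L)$) is $$\sum_j \beta_{1,j}(I)\,\beta_{0,j}(I).$$ -/

import Mathlib

open scoped MonomialOrder

noncomputable section

namespace GroebnerCell

open MvPolynomial

/-! ### Ideals of `F[x,y]`, with `x = X 0`, `y = X 1` and the lexicographic order `x > y` -/

section Ideals

variable {F : Type*} [Field F]

attribute [local instance] MvPolynomial.gradedAlgebra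

/-- `I` is a homogeneous ideal for the standard grading of `F[x,y]`. -/
def IsHomogeneousIdeal (I : Ideal (MvPolynomial (Fin 2) F)) : Prop :=
  I.IsHomogeneous (homogeneousSubmodule (Fin 2) F)

/-- The initial ideal `Lt(I)`, generated by the leading terms of the elements of `I`. -/
def leadingIdeal (I : Ideal (MvPolynomial (Fin 2) F)) : Ideal (MvPolynomial (Fin 2) F) :=
  Ideal.span ((MonomialOrder.lex (σ := Fin 2)).leadingTerm '' (I : Set (MvPolynomial (Fin 2) F)))

/-- The degree `j` part of the shifted ideal `I(-d)`: it is `I_{j-d}`, and `0` if `j < d`. -/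
def shiftedPart (I : Ideal (MvPolynomial (Fin 2) F)) (d j : ℕ) :
    Submodule F (MvPolynomial (Fin 2) F) :=
  if d ≤ j then I.restrictScalars F ⊓ homogeneousSubmodule (Fin 2) F (j - d) else ⊥

/-- The Hilbert function `j ↦ dim I_j` of the ideal `I`. -/
def hilbertFunction (I : Ideal (MvPolynomial (Fin 2) F)) (j : ℕ) : ℕ :=
  Module.finrank F (shiftedPart I 0 j)

/-- The Koszul map `R² → R`, `(a, b) ↦ x a + y b`. -/
def koszulOne : (MvPolynomial (Fin 2) F × MvPolynomial (Fin 2) F) →ₗ[F] MvPolynomial (Fin 2) F :=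
  (LinearMap.mulLeft F (X 0)).coprod (LinearMap.mulLeft F (X 1))

/-- The Koszul map `R → R²`, `c ↦ (-y c, x c)`. -/
def koszulTwo : MvPolynomial (Fin 2) F →ₗ[F] (MvPolynomial (Fin 2) F × MvPolynomial (Fin 2) F) :=
  (LinearMap.mulLeft F (-X 1)).prod (LinearMap.mulLeft F (X 0))

/-- The graded Betti number `β_{i,j}(I) = dim_F Tor_i(I, F)_j` of a homogeneous ideal `I` of
`R = F[x,y]`: the dimension of the degree `j` part of the `i`-th homology of
`I ⊗ Koszul(x, y) : 0 → I(-2) → I(-1)² → I → 0`. In particular `β_{0,j}(I)` is the dimension of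
`I_j / (x I_{j-1} + y I_{j-1})`, the number of minimal generators of degree `j`. -/
def bettiNumber (I : Ideal (MvPolynomial (Fin 2) F)) (i j : ℕ) : ℕ :=
  match i with
  | 0 => Module.finrank F (shiftedPart I 0 j ⧸
      (((shiftedPart I 1 j).prod (shiftedPart I 1 j)).map koszulOne).submoduleOf
        (shiftedPart I 0 j))
  | 1 => Module.finrank F
      (((shiftedPart I 1 j).prod (shiftedPart I 1 j) ⊓ LinearMap.ker koszulOne : Submodule F _) ⧸
        ((shiftedPart I 2 j).map koszulTwo).submoduleOf
          ((shiftedPart I 1 j).prod (shiftedPart I 1 j) ⊓ LinearMap.ker koszulOne))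
  | 2 => Module.finrank F (shiftedPart I 2 j ⊓ LinearMap.ker koszulTwo : Submodule F _)
  | _ => 0

/-- A lex-segment ideal: a monomial ideal which, in each degree, with a monomial contains all the
lexicographically larger monomials of the same degree. -/
def IsLexSegment (L : Ideal (MvPolynomial (Fin 2) F)) : Prop :=
  (∃ A : Set (Fin 2 →₀ ℕ), L = Ideal.span ((fun a => monomial a (1 : F)) '' A)) ∧
    ∀ a b : Fin 2 →₀ ℕ, a.degree = b.degree → a ≺[MonomialOrder.lex] b →
      monomial a (1 : F) ∈ L → monomial b (1 : F) ∈ L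

end Ideals

/-! ### The cell `V(E)` and its Betti strata -/

section Cells

variable {F : Type*} [Field F]

/-- `V(E)`: the homogeneous ideals with initial ideal `E`. -/
def cell (E : Ideal (MvPolynomial (Fin 2) F)) : Set (Ideal (MvPolynomial (Fin 2) F)) :=
  {I | leadingIdeal I = E ∧ IsHomogeneousIdeal I}

/-- `V(E, β)`. -/
def bettiStratum (E : Ideal (MvPolynomial (Fin 2) F)) (β : ℕ → ℕ) :
    Set (Ideal (MvPolynomial (Fin 2) F)) :=
  {I | I ∈ cell E ∧ ∀ j, bettiNumber I 0 j = β j}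

/-- `V(E, ≥ β)`. -/
def bettiStratumGE (E : Ideal (MvPolynomial (Fin 2) F)) (β : ℕ → ℕ) :
    Set (Ideal (MvPolynomial (Fin 2) F)) :=
  {I | I ∈ cell E ∧ ∀ j, β j ≤ bettiNumber I 0 j}

/-- `x^a` is a minimal monomial generator of the monomial ideal `E`. -/
def IsMinGen (E : Ideal (MvPolynomial (Fin 2) F)) (a : Fin 2 →₀ ℕ) : Prop :=
  Minimal (fun b => monomial b (1 : F) ∈ E) a

/-- The monomials `x^b` that may occur in the tail of the element of a homogeneous reduced
Gröbner basis whose leading monomial is `x^a`. -/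
def IsTail (E : Ideal (MvPolynomial (Fin 2) F)) (a b : Fin 2 →₀ ℕ) : Prop :=
  monomial b (1 : F) ∉ E ∧ b.degree = a.degree ∧ b ≺[MonomialOrder.lex] a

/-- The index set of the coordinates `λ(a, b)` of the affine space containing `V(E)`. -/
def CoordIndex (E : Ideal (MvPolynomial (Fin 2) F)) : Type :=
  {q : (Fin 2 →₀ ℕ) × (Fin 2 →₀ ℕ) // IsMinGen E q.1 ∧ IsTail E q.1 q.2}

/-- The Zariski topology on `F^σ`: the closed sets are the zero sets of ideals of polynomials. -/
@[reducible]
def zariskiTopology (σ : Type) (F : Type*) [Field F] : TopologicalSpace (σ → F) :=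
  TopologicalSpace.ofClosed
    {Z | ∃ J : Ideal (MvPolynomial σ F), Z = zeroLocus F J}
    ⟨⊤, zeroLocus_top.symm⟩
    (by
      intro A hA
      refine ⟨sSup {J | zeroLocus F J ∈ A}, Set.Subset.antisymm ?_ ?_⟩
      · refine le_zeroLocus_iff_le_vanishingIdeal.2 (sSup_le fun J hJ => ?_)
        exact le_zeroLocus_iff_le_vanishingIdeal.1 (Set.sInter_subset_of_mem hJ)
      · refine Set.subset_sInter fun Z hZ => ?_
        obtain ⟨J, rfl⟩ := hA hZ
        exact zeroLocus_anti_mono (le_sSup hZ))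
    (by
      rintro _ ⟨J₁, rfl⟩ _ ⟨J₂, rfl⟩
      refine ⟨J₁ * J₂, Set.Subset.antisymm (Set.union_subset ?_ ?_) fun x h => ?_⟩
      · exact zeroLocus_anti_mono Ideal.mul_le_left
      · exact zeroLocus_anti_mono Ideal.mul_le_right
      · by_contra hc
        simp only [Set.mem_union, mem_zeroLocus_iff, not_or, not_forall] at hc
        obtain ⟨⟨p, hp, hp0⟩, q, hq, hq0⟩ := hc
        have hpq := h _ (Ideal.mul_mem_mul hp hq)
        rw [map_mul] at hpq
        exact (mul_ne_zero hp0 hq0) hpq)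

/-- Affine space `F^σ`, equipped with the Zariski topology. -/
def AffSpace (σ : Type) (F : Type*) : Type _ := σ → F

instance (σ : Type) : TopologicalSpace (AffSpace σ F) := zariskiTopology σ F

/-- The ideal of an algebraic set. -/
def idealOf {σ : Type} (Z : Set (AffSpace σ F)) : Ideal (MvPolynomial σ F) :=
  vanishingIdeal F (show Set (σ → F) from Z)

/-- The codimension of an algebraic subset `Z` of an affine algebraic set `V`: the height of the
ideal of `Z` in the coordinate ring of `V`. -/
def codim {σ : Type} (V Z : Set (AffSpace σ F)) : ℕ∞ :=
  ((idealOf Z).map (Ideal.Quotient.mk (idealOf V))).height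

open Classical in
/-- The polynomial `f_a = x^a - ∑ λ(a,b) x^b`. -/
def cellGen (E : Ideal (MvPolynomial (Fin 2) F)) (l : AffSpace (CoordIndex E) F)
    (a : Fin 2 →₀ ℕ) : MvPolynomial (Fin 2) F :=
  monomial a 1 - ∑ b ∈ Finset.finsuppAntidiag Finset.univ a.degree,
    if h : IsMinGen E a ∧ IsTail E a b then monomial b (l ⟨(a, b), h⟩) else 0

/-- The ideal generated by the polynomials `f_a`, for `x^a` a minimal generator of `E`. -/
def cellIdeal (E : Ideal (MvPolynomial (Fin 2) F)) (l : AffSpace (CoordIndex E) F) :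
    Ideal (MvPolynomial (Fin 2) F) :=
  Ideal.span (cellGen E l '' {a | IsMinGen E a})

/-- A set `S` of ideals in `V(E)`, regarded as a subset of affine space: the points `λ` for which
the `f_a` generate an ideal in `S`. On `V(E)` the point `λ` consists of the coefficients of the
reduced Gröbner basis of the ideal (see `bijOn_cell`). -/
def points (E : Ideal (MvPolynomial (Fin 2) F)) (S : Set (Ideal (MvPolynomial (Fin 2) F))) :
    Set (AffSpace (CoordIndex E) F) :=
  {l | cellIdeal E l ∈ S}

section Points

variable {E I : Ideal (MvPolynomial (Fin 2) F)} {a b : Fin 2 →₀ ℕ}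

lemma coeff_cellGen_of_tail (l : AffSpace (CoordIndex E) F) (h : IsMinGen E a ∧ IsTail E a b) :
    coeff b (cellGen E l a) = - l ⟨(a, b), h⟩ := by
  classical
  have hab : a ≠ b := by
    rintro rfl
    exact h.2.1 h.1.1
  rw [cellGen, coeff_sub, coeff_monomial, if_neg hab, zero_sub, coeff_sum, Finset.sum_eq_single b]
  · rw [dif_pos h, coeff_monomial, if_pos rfl]
  · intro c _ hcb
    split_ifs
    · rw [coeff_monomial, if_neg hcb]
    · exact coeff_zero _
  · intro hb
    refine absurd ?_ hb
    rw [Finset.mem_finsuppAntidiag]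
    refine ⟨?_, Finset.subset_univ _⟩
    rw [← h.2.2.1, Finsupp.degree_eq_sum]

lemma coeff_cellGen_of_not_tail (l : AffSpace (CoordIndex E) F)
    (h : ¬ (IsMinGen E a ∧ IsTail E a b)) :
    coeff b (cellGen E l a) = coeff b (monomial a (1 : F)) := by
  classical
  rw [cellGen, coeff_sub, coeff_sum, Finset.sum_eq_zero, sub_zero]
  intro c _
  split_ifs with hc
  · rw [coeff_monomial, if_neg]
    rintro rfl
    exact h hc
  · exact coeff_zero _

lemma monomial_degree_mem_leadingIdeal {f : MvPolynomial (Fin 2) F} (hf : f ∈ I) (h0 : f ≠ 0) :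
    monomial (MonomialOrder.lex.degree f) (1 : F) ∈ leadingIdeal I := by
  rw [leadingIdeal, MonomialOrder.span_leadingTerm_eq_span_monomial']
  exact Ideal.subset_span ⟨f, ⟨hf, h0⟩, rfl⟩

lemma exists_remainder (I : Ideal (MvPolynomial (Fin 2) F)) (f : MvPolynomial (Fin 2) F) :
    ∃ r, f - r ∈ I ∧ MonomialOrder.lex.degree r ≼[MonomialOrder.lex] MonomialOrder.lex.degree f ∧
      ∀ b ∈ r.support, monomial b (1 : F) ∉ leadingIdeal I := by
  obtain ⟨g, r, hf, hd, hr⟩ := MonomialOrder.lex.div_set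
    (B := (I : Set (MvPolynomial (Fin 2) F)) \ {0})
    (fun b hb => (MonomialOrder.leadingCoeff_ne_zero_iff.2 hb.2).isUnit) f
  have hmem : f - r ∈ I := by
    rw [hf, add_sub_cancel_right, Finsupp.linearCombination_apply]
    exact Ideal.sum_mem _ fun b _ => Ideal.mul_mem_left _ _ b.2.1
  refine ⟨r, hmem, ?_, ?_⟩
  · have h1 : r = f - Finsupp.linearCombination _
        (fun b : ↥((I : Set (MvPolynomial (Fin 2) F)) \ {0}) => (b : MvPolynomial (Fin 2) F)) g :=
      eq_sub_of_add_eq' hf.symm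
    rw [h1]
    refine MonomialOrder.degree_sub_le.trans (sup_le le_rfl ?_)
    rw [Finsupp.linearCombination_apply, Finsupp.sum]
    refine MonomialOrder.degree_sum_le.trans (Finset.sup_le fun b _ => ?_)
    rw [smul_eq_mul, mul_comm]
    exact hd b
  · intro b hb hbI
    rw [leadingIdeal, MonomialOrder.span_leadingTerm_eq_span_monomial'] at hbI
    have h2 : (fun p : MvPolynomial (Fin 2) F => monomial (MonomialOrder.lex.degree p) (1 : F)) ''
        ((I : Set (MvPolynomial (Fin 2) F)) \ {0}) = (fun s => monomial s (1 : F)) ''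
          (MonomialOrder.lex.degree '' ((I : Set (MvPolynomial (Fin 2) F)) \ {0})) := by
      rw [Set.image_image]
    rw [h2, mem_ideal_span_monomial_image] at hbI
    obtain ⟨_, ⟨p, hp, rfl⟩, hpb⟩ := hbI b (by
      classical
      rw [support_monomial, if_neg one_ne_zero]; exact Finset.mem_singleton_self b)
    exact hr b hb p hp hpb

lemma homogeneousComponent_mem (hI : IsHomogeneousIdeal I) {f : MvPolynomial (Fin 2) F}
    (hf : f ∈ I) (d : ℕ) : homogeneousComponent d f ∈ I := by
  have := hI d hf
  rwa [← decomposition.decompose'_apply]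

/-- A point of `V(E)` in affine space is the same as an ideal in `V(E)`. -/
theorem bijOn_cell (E : Ideal (MvPolynomial (Fin 2) F)) :
    Set.BijOn (cellIdeal E) (points E (cell E)) (cell E) := by
  refine ⟨fun l hl => hl, ?_, ?_⟩
  · rintro l ⟨hl, -⟩ l' ⟨hl', -⟩ he
    funext ⟨⟨a, b⟩, hab⟩
    by_contra hne
    -- the difference of the two generators lies in the ideal and is supported outside `E`
    have hmem : cellGen E l a - cellGen E l' a ∈ cellIdeal E l := by
      refine sub_mem (Ideal.subset_span ⟨a, hab.1, rfl⟩) ?_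
      rw [he]
      exact Ideal.subset_span ⟨a, hab.1, rfl⟩
    have hg : cellGen E l a - cellGen E l' a ≠ 0 := by
      intro h0
      have := congrArg (coeff b) h0
      rw [coeff_sub, coeff_cellGen_of_tail l hab, coeff_cellGen_of_tail l' hab, coeff_zero] at this
      exact hne (neg_injective (sub_eq_zero.1 this))
    have hs := MonomialOrder.degree_mem_support (m := MonomialOrder.lex) hg
    have hE := monomial_degree_mem_leadingIdeal hmem hg
    rw [hl] at hE
    rw [mem_support_iff, coeff_sub] at hs
    refine hs ?_
    set c := MonomialOrder.lex.degree (cellGen E l a - cellGen E l' a) with hc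
    have hnt : ¬ (IsMinGen E a ∧ IsTail E a c) := fun h => h.2.1 hE
    rw [coeff_cellGen_of_not_tail l hnt, coeff_cellGen_of_not_tail l' hnt, sub_self]
  · rintro I ⟨hI, hh⟩
    have key : ∀ a, IsMinGen E a → ∃ r : MvPolynomial (Fin 2) F,
        monomial a 1 - r ∈ I ∧ ∀ b ∈ r.support, IsTail E a b := by
      intro a ha
      have haE : monomial a (1 : F) ∈ leadingIdeal I := hI ▸ ha.1
      obtain ⟨r, hrI, hrd, hrs⟩ := exists_remainder I (monomial a (1 : F))
      refine ⟨homogeneousComponent a.degree r, ?_, ?_⟩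
      · have := homogeneousComponent_mem hh hrI a.degree
        rwa [map_sub, homogeneousComponent_of_mem (isHomogeneous_monomial (n := a.degree) 1 rfl),
          if_pos rfl] at this
      · intro b hb
        rw [mem_support_iff, coeff_homogeneousComponent] at hb
        have hd : b.degree = a.degree := by
          by_contra h; exact hb (if_neg h)
        rw [if_pos hd] at hb
        have hbE : monomial b (1 : F) ∉ E := hI ▸ hrs b (mem_support_iff.2 hb)
        refine ⟨hbE, hd, lt_of_le_of_ne ?_ ?_⟩
        · refine (MonomialOrder.le_degree (mem_support_iff.2 hb)).trans (hrd.trans ?_)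
          classical
          rw [MonomialOrder.degree_monomial, if_neg one_ne_zero]
        · intro h
          rw [(MonomialOrder.lex.toSyn).injective h] at hbE
          exact hbE ha.1
    choose! r hrI hrs using key
    let l : AffSpace (CoordIndex E) F := fun q => coeff q.1.2 (r q.1.1)
    have hgen : ∀ a, IsMinGen E a → cellGen E l a = monomial a 1 - r a := by
      intro a ha
      have : ∀ b, coeff b (cellGen E l a - monomial a 1) = coeff b (- r a) := by
        intro b
        rw [coeff_sub, coeff_neg]
        by_cases hb : IsTail E a b
        · rw [coeff_cellGen_of_tail l ⟨ha, hb⟩, coeff_monomial, if_neg, sub_zero]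
          rintro rfl
          exact hb.1 ha.1
        · rw [coeff_cellGen_of_not_tail l (fun h => hb h.2), coeff_monomial, sub_self, eq_comm,
            neg_eq_zero, ← notMem_support_iff]
          exact fun h => hb (hrs a ha b h)
      have := ext _ _ this
      rw [sub_eq_iff_eq_add] at this
      rw [this]; ring
    have hle : cellIdeal E l ≤ I := by
      refine Ideal.span_le.2 ?_
      rintro _ ⟨a, ha, rfl⟩
      rw [SetLike.mem_coe, hgen a ha]
      exact hrI a ha
    have hEle : ∀ c, monomial c (1 : F) ∈ E → monomial c (1 : F) ∈ leadingIdeal (cellIdeal E l) := by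
      intro c hc
      obtain ⟨a, hac, ha⟩ := exists_minimal_le_of_wellFoundedLT
        (fun b => monomial b (1 : F) ∈ E) c hc
      have hne : cellGen E l a ≠ 0 := by
        intro h
        have := coeff_cellGen_of_not_tail l (E := E) (a := a) (b := a) (fun h => h.2.1 ha.1)
        rw [h, coeff_zero, coeff_monomial, if_pos rfl] at this
        exact zero_ne_one this
      have hdeg : MonomialOrder.lex.degree (cellGen E l a) = a := by
        apply MonomialOrder.lex.toSyn.injective
        apply le_antisymm
        · rw [MonomialOrder.degree_le_iff]
          intro b hb
          by_cases hbt : IsTail E a b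
          · exact hbt.2.2.le
          · rw [mem_support_iff, coeff_cellGen_of_not_tail l (fun h => hbt h.2),
              coeff_monomial] at hb
            have : a = b := by by_contra h; exact hb (if_neg h)
            rw [this]
        · apply MonomialOrder.le_degree
          rw [mem_support_iff, coeff_cellGen_of_not_tail l (fun h => h.2.1 ha.1), coeff_monomial,
            if_pos rfl]
          exact one_ne_zero
      have hm := monomial_degree_mem_leadingIdeal
        (I := cellIdeal E l) (Ideal.subset_span ⟨a, ha, rfl⟩) hne
      rw [hdeg] at hm
      have : monomial c (1 : F) = monomial (c - a) 1 * monomial a 1 := by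
        rw [monomial_mul, one_mul, tsub_add_cancel_of_le hac]
      rw [this]
      exact Ideal.mul_mem_left _ _ hm
    have heq : cellIdeal E l = I := by
      refine le_antisymm hle fun f hf => ?_
      obtain ⟨s, hsI, -, hss⟩ := exists_remainder (cellIdeal E l) f
      by_cases hs0 : s = 0
      · rwa [hs0, sub_zero] at hsI
      · exfalso
        have hsI' : s ∈ I := by
          have := sub_mem hf (hle hsI)
          rwa [sub_sub_cancel] at this
        have h1 := monomial_degree_mem_leadingIdeal hsI' hs0
        rw [hI] at h1
        exact hss _ (MonomialOrder.degree_mem_support hs0) (hEle _ h1)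
    refine ⟨l, ?_, heq⟩
    change cellIdeal E l ∈ cell E
    rw [heq]
    exact ⟨hI, hh⟩

end Points

end Cells

end GroebnerCell

end

/-! A lex-segment ideal of finite colength is a staircase: `x^p y^q` lies in it iff `q ≥ μ(p)`,
where `μ` strictly decreases until it is `0`, at `p = w`. So there is one minimal generator for
every `p ≤ w`, and the degrees `d_p = p + μ(p)` decrease weakly up to `p = w`. Setting `y = 1` turns
a reduced Gröbner basis into monic polynomials `G_p` of degree `p`. By the Buchberger criterion such
a family comes from a point of the cell exactly when for all `p < w` there is a syzygy `X G_p -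
G_{p+1} = ∑ c_{pq} G_q`, the sum being over `q ≤ p` with `d_q = d_p` or `d_q = d_p + 1`.

The coefficients `c_{pq}` with `d_q > d_{p+1}` can be prescribed arbitrarily; the others are forced
by reducedness. Hence the cell is isomorphic to an affine space (`range_chart`, `chartInv_chart`,
`isRegular_chart`, `isRegular_chartInv`). In the homogeneous syzygy `G_q` carries a power of `y`,
which is constant precisely when `d_q = d_p + 1`. These constants form, for every degree `j`, a
matrix `A_j` with rows `d_p + 1 = j` and columns `d_q = j`, and all of its entries are free
parameters. The number of minimal generators of degree `j` is that of the monomial ideal minus the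
rank of `A_j` (`bettiNumber_add_rank`).

So the strata are products of generic determinantal loci, times an affine space. The locus of rank
at most `r` is irreducible, as the image of an affine space under multiplication of matrices; the
points of rank exactly `r` are dense in it; and for an `m × n` matrix its codimension is `(m - r)(n
- r)` (`height_idealOf_rankLocus`, `closure_rank_eq`). The difference `β_{1,j} - β_{0,j}` depends
only on the Hilbert function, so `m - r = β_{1,j}`, and `n - r = β_{0,j}` except for `j = w`, where
there are no rows and `β_{1,j} = 0`. The ideal `I` itself enters only through its Hilbert function
and Betti numbers, which is why the base field may be enlarged. -/

noncomputable section

namespace GroebnerCell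

open MvPolynomial

/-! ### Polynomial maps and codimension in affine space. -/

section Zariski

variable {F : Type*} [Field F] {σ τ υ : Type}

/-- Evaluation of polynomials at a point of affine space. -/
def evalAt (x : AffSpace σ F) : MvPolynomial σ F →ₐ[F] F :=
  aeval (show σ → F from x)

@[simp] lemma evalAt_X (x : AffSpace σ F) (s : σ) : evalAt x (X s) = x s :=
  aeval_X (show σ → F from x) s

lemma evalAt_bind₁ (x : AffSpace σ F) (Φ : τ → MvPolynomial σ F) (p : MvPolynomial τ F) :
    evalAt x (bind₁ Φ p) = evalAt (fun t => evalAt x (Φ t)) p :=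
  aeval_bind₁ _ _ _

lemma eq_of_evalAt [Infinite F] {p q : MvPolynomial σ F}
    (h : ∀ x : AffSpace σ F, evalAt x p = evalAt x q) : p = q :=
  MvPolynomial.funext fun x => by
    have : aeval (S₁ := F) x p = aeval x q := h x
    simpa [aeval_eq_eval] using this

lemma mem_idealOf {Z : Set (AffSpace σ F)} {p : MvPolynomial σ F} :
    p ∈ idealOf Z ↔ ∀ x ∈ Z, evalAt x p = 0 :=
  Iff.rfl

lemma isClosed_iff_exists_ideal {Z : Set (AffSpace σ F)} :
    IsClosed Z ↔ ∃ J : Ideal (MvPolynomial σ F), Z = {x | ∀ p ∈ J, evalAt x p = 0} := by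
  rw [← isOpen_compl_iff]
  change Zᶜᶜ ∈ {Z | ∃ J : Ideal (MvPolynomial σ F), Z = zeroLocus F J} ↔ _
  rw [compl_compl]
  rfl

lemma isClosed_setOf_evalAt (S : Set (MvPolynomial σ F)) :
    IsClosed {x : AffSpace σ F | ∀ p ∈ S, evalAt x p = 0} := by
  refine isClosed_iff_exists_ideal.2 ⟨Ideal.span S, Set.ext fun x => ?_⟩
  change _ ↔ Ideal.span S ≤ RingHom.ker (evalAt x)
  rw [Ideal.span_le]
  rfl

/-- The algebra of polynomial functions on affine space. -/
def polyFun (σ : Type) (F : Type*) [Field F] : Subalgebra F (AffSpace σ F → F) :=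
  (AlgHom.pi fun x : AffSpace σ F => evalAt x).range

lemma mem_polyFun {f : AffSpace σ F → F} :
    f ∈ polyFun σ F ↔ ∃ P : MvPolynomial σ F, ∀ x : AffSpace σ F, f x = evalAt x P :=
  ⟨fun ⟨P, hP⟩ => ⟨P, fun x => (congrFun hP x).symm⟩, fun ⟨P, hP⟩ => ⟨P, funext fun x => (hP x).symm⟩⟩

lemma coord_mem_polyFun (s : σ) : (fun x : AffSpace σ F => x s) ∈ polyFun σ F :=
  mem_polyFun.2 ⟨X s, fun x => by simp⟩

lemma const_mem_polyFun (c : F) : (fun _ : AffSpace σ F => c) ∈ polyFun σ F :=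
  mem_polyFun.2 ⟨C c, fun x => ((evalAt x).commutes c).symm⟩

lemma isClosed_eq_zero {f : AffSpace σ F → F} (hf : f ∈ polyFun σ F) :
    IsClosed {x : AffSpace σ F | f x = 0} := by
  obtain ⟨P, hP⟩ := mem_polyFun.1 hf
  simpa [hP] using isClosed_setOf_evalAt {P}

/-- A map between affine spaces that is given by polynomials. -/
def IsRegular (φ : AffSpace σ F → AffSpace τ F) : Prop :=
  ∀ t, (fun x => φ x t) ∈ polyFun σ F

lemma IsRegular.exists_poly {φ : AffSpace σ F → AffSpace τ F} (h : IsRegular φ) :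
    ∃ Φ : τ → MvPolynomial σ F, ∀ (x : AffSpace σ F) (p : MvPolynomial τ F),
      evalAt x (bind₁ Φ p) = evalAt (φ x) p := by
  choose Φ hΦ using fun t => mem_polyFun.1 (h t)
  refine ⟨Φ, fun x p => ?_⟩
  rw [evalAt_bind₁]
  congr 2
  exact _root_.funext fun t => (hΦ t x).symm

lemma IsRegular.comp_mem {φ : AffSpace σ F → AffSpace τ F} (h : IsRegular φ)
    {f : AffSpace τ F → F} (hf : f ∈ polyFun τ F) : (fun x => f (φ x)) ∈ polyFun σ F := by
  obtain ⟨P, hP⟩ := mem_polyFun.1 hf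
  obtain ⟨Φ, hΦ⟩ := h.exists_poly
  exact mem_polyFun.2 ⟨bind₁ Φ P, fun x => (hP _).trans (hΦ x P).symm⟩

lemma IsRegular.continuous {φ : AffSpace σ F → AffSpace τ F} (h : IsRegular φ) :
    Continuous φ := by
  refine continuous_iff_isClosed.2 fun Z hZ => ?_
  obtain ⟨J, rfl⟩ := isClosed_iff_exists_ideal.1 hZ
  obtain ⟨Φ, hΦ⟩ := h.exists_poly
  have := isClosed_setOf_evalAt (bind₁ Φ '' (J : Set (MvPolynomial τ F)))
  simpa [hΦ] using this

/-- If two proper closed sets covered the space, the product of two nonzero equations would vanish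
everywhere, hence be zero because the field is infinite; but the polynomial ring is a domain. -/
lemma isIrreducible_univ [Infinite F] : IsIrreducible (Set.univ : Set (AffSpace σ F)) := by
  refine ⟨⟨(fun _ => 0 : σ → F), trivial⟩, ?_⟩
  rw [isPreirreducible_iff_isClosed_union_isClosed]
  intro Z₁ Z₂ h₁ h₂ h
  obtain ⟨J₁, rfl⟩ := isClosed_iff_exists_ideal.1 h₁
  obtain ⟨J₂, rfl⟩ := isClosed_iff_exists_ideal.1 h₂
  by_contra! hc
  obtain ⟨⟨x, -, hx⟩, ⟨y, -, hy⟩⟩ := And.intro (Set.not_subset.1 hc.1) (Set.not_subset.1 hc.2)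
  rw [Set.mem_ofPred_eq] at hx hy
  push Not at hx hy
  obtain ⟨p, hp, hpx⟩ := hx
  obtain ⟨q, hq, hqy⟩ := hy
  have h0 : p * q = 0 := by
    refine eq_of_evalAt fun z => ?_
    rw [map_zero, map_mul]
    rcases h (Set.mem_univ z) with hz | hz
    · rw [hz p hp, zero_mul]
    · rw [hz q hq, mul_zero]
  rcases mul_eq_zero.1 h0 with h0 | h0
  · exact hpx (by rw [h0, map_zero])
  · exact hqy (by rw [h0, map_zero])

/-- The isomorphism `A ⧸ ker f ≃ B` matches the two ideals. It moves a height from the coordinate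
ring of a variety to a polynomial ring. -/
lemma height_map_quotient_comap {A B : Type*} [CommRing A] [CommRing B] [Algebra F A]
    [Algebra F B] {f : A →ₐ[F] B} (hf : Function.Surjective f) {I : Ideal A}
    (hI : I = RingHom.ker f) (J : Ideal B) :
    ((J.comap f).map (Ideal.Quotient.mk I)).height = J.height := by
  subst hI
  let e := Ideal.quotientKerAlgEquivOfSurjective hf
  have hc : J.comap f = (J.comap e.toRingEquiv).comap (Ideal.Quotient.mk (RingHom.ker f)) := by
    ext a
    rfl
  rw [hc, Ideal.map_comap_of_surjective _ Ideal.Quotient.mk_surjective]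
  exact RingEquiv.height_comap e.toRingEquiv _

/-- The codimension of a closed subset of an isomorphic image of affine space. -/
lemma codim_image [Infinite F] {φ : AffSpace τ F → AffSpace σ F} {ψ : AffSpace σ F → AffSpace τ F}
    (hφ : IsRegular φ) (hψ : IsRegular ψ) (h : ∀ x, ψ (φ x) = x) (D : Set (AffSpace τ F)) :
    codim (Set.range φ) (φ '' D) = (idealOf D).height := by
  obtain ⟨Φ, hΦ⟩ := hφ.exists_poly
  obtain ⟨Ψ, hΨ⟩ := hψ.exists_poly
  -- The retraction `ψ` shows that pullback along `φ` is onto: `p` is the pullback of its own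
  -- pullback along `ψ`.
  have hsurj : Function.Surjective (bind₁ Φ) := by
    intro p
    refine ⟨bind₁ Ψ p, eq_of_evalAt fun x => ?_⟩
    rw [hΦ, hΨ, h]
  have hker : idealOf (Set.range φ) = RingHom.ker (bind₁ Φ) := by
    ext p
    rw [mem_idealOf, RingHom.mem_ker]
    constructor
    · intro hp
      refine eq_of_evalAt fun x => ?_
      rw [hΦ, hp _ ⟨x, rfl⟩, map_zero]
    · rintro hp _ ⟨x, rfl⟩
      rw [← hΦ, hp, map_zero]
  have hcomap : idealOf (φ '' D) = (idealOf D).comap (bind₁ Φ) := by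
    ext p
    rw [Ideal.mem_comap, mem_idealOf, mem_idealOf]
    simp [hΦ]
  rw [codim, hcomap]
  exact height_map_quotient_comap hsurj hker _

end Zariski

/-! ### Heights of kernels of evaluation maps. -/

section Height

variable {F : Type*} [Field F] {κ : Type*}

/-- The ideal of a rational point of affine space has height equal to the dimension. -/
lemma height_ker_aeval_point [Finite κ] (q : κ → F) :
    (RingHom.ker (aeval q : MvPolynomial κ F →ₐ[F] F)).height = (Nat.card κ : ℕ∞) := by
  classical
  have := Fintype.ofFinite κ
  have hp : (RingHom.ker (aeval q : MvPolynomial κ F →ₐ[F] F)).IsPrime := RingHom.ker_isPrime _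
  apply le_antisymm
  · have h1 := Ideal.height_le_ringKrullDim_of_isPrime
      (I := RingHom.ker (aeval q : MvPolynomial κ F →ₐ[F] F))
    rw [MvPolynomial.ringKrullDim_of_isNoetherianRing, ringKrullDim_eq_zero_of_field,
      zero_add] at h1
    exact_mod_cast h1
  -- `θ s` fixes the coordinates in `s` at their values in `q`. Adding the elements of `κ` to `s`
  -- one by one gives a chain of primes, strictly increasing because `X c - C (q c)` is new at the
  -- step that adds `c`.
  · let θ (s : Finset κ) : MvPolynomial κ F →ₐ[F] MvPolynomial κ F :=
      aeval fun c => if c ∈ s then C (q c) else X c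
    have hpr (s : Finset κ) : (RingHom.ker (θ s)).IsPrime := RingHom.ker_isPrime _
    have hlt (s : Finset κ) (c : κ) (hc : c ∉ s) :
        RingHom.ker (θ s) < RingHom.ker (θ (insert c s)) := by
      have hcomp : θ (insert c s) = (aeval fun d => if d = c then C (q c) else X d).comp (θ s) := by
        ext1 d
        by_cases hd : d ∈ s
        · have : d ≠ c := fun h => hc (h ▸ hd)
          simp [θ, hd]
        · by_cases hdc : d = c
          · subst hdc; simp [θ, hd]
          · simp [θ, hd, hdc]
      refine lt_of_le_of_ne (fun p hp => ?_) fun he => ?_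
      · rw [RingHom.mem_ker] at hp ⊢
        rw [hcomp, AlgHom.comp_apply, hp, map_zero]
      · have h1 : (X c - C (q c) : MvPolynomial κ F) ∈ RingHom.ker (θ (insert c s)) := by
          simp [RingHom.mem_ker, θ]
        rw [← he, RingHom.mem_ker] at h1
        have h2 : (X c : MvPolynomial κ F) = C (q c) := by
          simpa [θ, hc, sub_eq_zero] using h1
        -- Any value other than `q c` separates `X c` from the constant `q c`.
        have h3 := congrArg (aeval fun _ => q c + 1) h2
        simp at h3
    have hge (s : Finset κ) : (s.card : ℕ∞) ≤ (RingHom.ker (θ s)).height := by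
      induction s using Finset.induction_on with
      | empty => simp
      | insert c s hc ih =>
        rw [Finset.card_insert_of_notMem hc]
        push_cast
        exact (add_le_add_left ih 1).trans (Ideal.height_add_one_le_of_lt_of_isPrime (hlt s c hc))
    have hu : RingHom.ker (θ Finset.univ) = RingHom.ker (aeval q : MvPolynomial κ F →ₐ[F] F) := by
      have : θ Finset.univ = (Algebra.ofId F (MvPolynomial κ F)).comp (aeval q) := by
        ext1 d
        simp [θ, Algebra.ofId_apply]
      ext p
      rw [RingHom.mem_ker, RingHom.mem_ker, this, AlgHom.comp_apply, Algebra.ofId_apply]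
      simp
    have := hge Finset.univ
    rwa [hu, Finset.card_univ, ← Nat.card_eq_fintype_card] at this

-- Inverting the nonzero constants turns `MvPolynomial κ S` into `MvPolynomial κ Q`. The kernel is
-- the contraction of the ideal of the rational point `q`, and contraction from a localization
-- preserves height.
attribute [local instance] MvPolynomial.algebraMvPolynomial in
lemma height_ker_eval₂Hom_fractionRing {S Q : Type*} [CommRing S] [IsDomain S] [Field Q]
    [Algebra S Q] [IsFractionRing S Q] [Finite κ] (q : κ → Q) :
    (RingHom.ker (eval₂Hom (algebraMap S Q) q)).height = (Nat.card κ : ℕ∞) := by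
  have h := IsLocalization.height_under (R := MvPolynomial κ S)
    ((nonZeroDivisors S).map (C (σ := κ))) (A := MvPolynomial κ Q)
    (RingHom.ker (aeval q : MvPolynomial κ Q →ₐ[Q] Q))
  rw [height_ker_aeval_point] at h
  rw [← h]
  congr 1
  ext p
  rw [RingHom.mem_ker, Ideal.under, Ideal.mem_comap, RingHom.mem_ker, MvPolynomial.algebraMap_def,
    aeval_def, eval₂_map]
  rfl

/-- If some of the variables are sent to algebraically independent elements and the others to
arbitrary elements of the field they generate, the kernel has height the number of the others. -/
lemma height_ker_aeval_of_isFractionRing {M : Type*} [Finite M] (c : M → Prop)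
    {Q : Type*} [Field Q] [Algebra (MvPolynomial {m // ¬ c m} F) Q]
    [IsFractionRing (MvPolynomial {m // ¬ c m} F) Q] [Algebra F Q]
    [IsScalarTower F (MvPolynomial {m // ¬ c m} F) Q] (w : M → Q)
    (hw : ∀ m (hm : ¬ c m), w m = algebraMap (MvPolynomial {m // ¬ c m} F) Q (X ⟨m, hm⟩)) :
    (RingHom.ker (aeval w : MvPolynomial M F →ₐ[F] Q)).height = (Nat.card {m // c m} : ℕ∞) := by
  classical
  -- The polynomials are regarded as polynomials in the variables of `c` over the ring in the
  -- remaining ones, where the evaluation has the form of `height_ker_eval₂Hom_fractionRing`.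
  let e : MvPolynomial M F ≃ₐ[F] MvPolynomial {m // c m} (MvPolynomial {m // ¬ c m} F) :=
    (renameEquiv F (Equiv.sumCompl c).symm).trans (sumAlgEquiv F _ _)
  let ev := eval₂Hom (algebraMap (MvPolynomial {m // ¬ c m} F) Q) fun m : {m // c m} => w m
  have hfac : (aeval w : MvPolynomial M F →ₐ[F] Q).toRingHom = ev.comp e.toRingEquiv := by
    refine MvPolynomial.ringHom_ext (fun a => ?_) fun m => ?_
    · have h1 : e (C a) = C (C a) := e.commutes a
      have h2 : ev (e (C a)) = algebraMap F Q a := by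
        rw [h1, IsScalarTower.algebraMap_apply F (MvPolynomial {m // ¬ c m} F) Q]
        exact eval₂_C _ _ _
      exact (aeval_C w a).trans h2.symm
    · refine (aeval_X w m).trans (Eq.symm ?_)
      change ev (e (X m)) = w m
      by_cases hm : c m
      · have h1 : e (X m) = X ⟨m, hm⟩ := by
          simp [e, Equiv.sumCompl_symm_apply_of_pos hm]
        rw [h1]
        exact eval₂_X _ _ _
      · have h1 : e (X m) = C (X ⟨m, hm⟩) := by
          simp [e, Equiv.sumCompl_symm_apply_of_neg hm]
        rw [h1, hw m hm]
        exact eval₂_C _ _ _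
  have h1 : RingHom.ker (aeval w : MvPolynomial M F →ₐ[F] Q) =
      (RingHom.ker ev).comap e.toRingEquiv := by
    ext p
    rw [RingHom.mem_ker, Ideal.mem_comap, RingHom.mem_ker]
    exact Eq.congr_left (congrArg (fun f => f p) hfac)
  rw [h1]
  exact (RingEquiv.height_comap e.toRingEquiv _).trans (height_ker_eval₂Hom_fractionRing _)

end Height

end GroebnerCell

namespace GroebnerCell

open MvPolynomial

/-! ### Rank factorizations and nonvanishing determinants. -/

section Rank

variable {F : Type*} [Field F] {m n : Type*} [Fintype n]

/-- The column space embeds into `F^r` by some `f` with a left inverse `g`; then `A` factors as `g`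
after `f ∘ A`. -/
lemma exists_eq_mul_of_rank_le (A : Matrix m n F) {r : ℕ} (h : A.rank ≤ r) :
    ∃ (X : Matrix m (Fin r) F) (Y : Matrix (Fin r) n F), A = X * Y := by
  classical
  obtain ⟨f, hf⟩ : ∃ f : LinearMap.range A.mulVecLin →ₗ[F] (Fin r → F), Function.Injective f :=
    ⟨(Module.finBasis F _).constr F (Pi.basisFun F (Fin r) ∘ Fin.castLE h),
      (Module.finBasis F _).injective_constr_of_linearIndependent
        ((Pi.basisFun F (Fin r)).linearIndependent.comp _ (Fin.castLE_injective h))⟩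
  obtain ⟨g, hg⟩ := LinearMap.exists_leftInverse_of_injective f (LinearMap.ker_eq_bot.2 hf)
  refine ⟨LinearMap.toMatrix' ((LinearMap.range A.mulVecLin).subtype ∘ₗ g),
    LinearMap.toMatrix' (f ∘ₗ A.mulVecLin.rangeRestrict), ?_⟩
  rw [← LinearMap.toMatrix'_comp]
  have : ((LinearMap.range A.mulVecLin).subtype ∘ₗ g) ∘ₗ f ∘ₗ A.mulVecLin.rangeRestrict =
      A.mulVecLin := by
    refine LinearMap.ext fun x => ?_
    have := LinearMap.congr_fun hg (A.mulVecLin.rangeRestrict x)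
    simp only [LinearMap.comp_apply, LinearMap.id_apply] at this ⊢
    rw [this]
    rfl
  rw [this, ← Matrix.toLin'_apply', LinearMap.toMatrix'_toLin']

/-- The columns of `Q` are `r` vectors with independent images under `A`, and `P` is a left inverse
of `A * Q`. With `le_rank_of_det_ne_zero` this expresses a rank bound by polynomial equations. -/
lemma exists_det_ne_zero_of_le_rank [Fintype m] (A : Matrix m n F) {r : ℕ} (h : r ≤ A.rank) :
    ∃ (P : Matrix (Fin r) m F) (Q : Matrix n (Fin r) F), (P * A * Q).det ≠ 0 := by
  classical
  obtain ⟨v, hv⟩ : ∃ v : Fin r → LinearMap.range A.mulVecLin, LinearIndependent F v :=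
    exists_linearIndependent_of_le_finrank h
  choose w hw using fun i => (v i).2
  have hv' : LinearIndependent F fun i => A.mulVecLin (w i) := by
    simp_rw [hw]
    exact hv.map' _ (Submodule.ker_subtype _)
  let Q : Matrix n (Fin r) F := Matrix.of fun j i => w i j
  have hQ (i : Fin r) : (A * Q).mulVec (Pi.single i 1) = A.mulVecLin (w i) := by
    rw [← Matrix.mulVec_mulVec, Matrix.mulVec_single_one]
    rfl
  have hinj : LinearMap.ker (A * Q).mulVecLin = ⊥ := by
    rw [Matrix.ker_mulVecLin_eq_bot_iff]
    intro c hc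
    have h1 : ∑ i, c i • A.mulVecLin (w i) = 0 := by
      rw [← hc]
      conv_rhs => rw [← Matrix.mulVecLin_apply, LinearMap.pi_apply_eq_sum_univ (A * Q).mulVecLin c]
      refine Finset.sum_congr rfl fun i _ => ?_
      rw [← hQ i, Matrix.mulVecLin_apply]
      congr 2
      ext j
      simp [Pi.single_apply, eq_comm]
    exact _root_.funext (Fintype.linearIndependent_iff.1 hv' c h1)
  obtain ⟨g, hg⟩ := LinearMap.exists_leftInverse_of_injective _ hinj
  refine ⟨LinearMap.toMatrix' g, Q, ?_⟩
  rw [Matrix.mul_assoc]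
  have : LinearMap.toMatrix' g * (A * Q) = 1 := by
    have h2 := congrArg LinearMap.toMatrix' hg
    rw [LinearMap.toMatrix'_comp, ← Matrix.toLin'_apply', LinearMap.toMatrix'_toLin',
      LinearMap.toMatrix'_id] at h2
    exact h2
  rw [this, Matrix.det_one]
  exact one_ne_zero

lemma le_rank_of_det_ne_zero [Fintype m] (A : Matrix m n F) {r : ℕ} {P : Matrix (Fin r) m F}
    {Q : Matrix n (Fin r) F} (h : (P * A * Q).det ≠ 0) : r ≤ A.rank := by
  have := Matrix.rank_of_det_ne_zero h
  rw [Fintype.card_fin] at this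
  exact this.symm.le.trans ((Matrix.rank_mul_le_left _ _).trans (Matrix.rank_mul_le_right _ _))

lemma le_rank_of_det_submatrix_ne_zero (A : Matrix m n F) {r : ℕ} {u : Fin r → m} {v : Fin r → n}
    (h : (A.submatrix u v).det ≠ 0) : r ≤ A.rank := by
  have := Matrix.rank_of_det_ne_zero h
  rw [Fintype.card_fin] at this
  exact this.symm.le.trans (Matrix.rank_submatrix_le A u v)

end Rank

end GroebnerCell

namespace GroebnerCell

open MvPolynomial

/-! ### Products of determinantal loci, as images of affine spaces. -/

section RankLocus

variable {M ι : Type} {R C : ι → Type}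

/-- The `j`-th matrix formed by the coordinates of `a`. -/
def blockMatrix (e : (Σ j, R j × C j) → M) {T : Type*} (a : M → T) (j : ι) : Matrix (R j) (C j) T :=
  Matrix.of fun p q => a (e ⟨j, p, q⟩)

/-- The points for which the `j`-th matrix has rank at most `r j`, for all `j`. -/
def rankLocus (F : Type*) [Field F] [∀ j, Fintype (C j)] (e : (Σ j, R j × C j) → M) (r : ι → ℕ) :
    Set (AffSpace M F) :=
  {a | ∀ j, (blockMatrix e a j).rank ≤ r j}

/-- The index set of the entries of factorizations of the matrices, and of all coordinates. -/
abbrev FactorIndex (M : Type) {ι : Type} (R C : ι → Type) (r : ι → ℕ) : Type :=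
  (Σ j, R j × Fin (r j)) ⊕ (Σ j, Fin (r j) × C j) ⊕ M

/-- The tuple whose `j`-th matrix is the product of two given matrices. -/
def factorMap (e : (Σ j, R j × C j) → M) (r : ι → ℕ) {T : Type*} [CommRing T]
    (z : FactorIndex M R C r → T) : M → T :=
  Function.extend e
    (fun s => ∑ k, z (.inl ⟨s.1, s.2.1, k⟩) * z (.inr (.inl ⟨s.1, k, s.2.2⟩)))
    (fun m => z (.inr (.inr m)))

variable {e : (Σ j, R j × C j) → M} {r : ι → ℕ}

lemma factorMap_apply (he : Function.Injective e) {T : Type*} [CommRing T]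
    (z : FactorIndex M R C r → T) (j : ι) (p : R j) (q : C j) :
    factorMap e r z (e ⟨j, p, q⟩) =
      ∑ k, z (.inl ⟨j, p, k⟩) * z (.inr (.inl ⟨j, k, q⟩)) :=
  he.extend_apply _ _ _

lemma blockMatrix_factorMap (he : Function.Injective e) {T : Type*} [CommRing T]
    (z : FactorIndex M R C r → T) (j : ι) :
    blockMatrix e (factorMap e r z) j =
      Matrix.of (fun p k => z (.inl ⟨j, p, k⟩)) * Matrix.of (fun k q => z (.inr (.inl ⟨j, k, q⟩))) :=
  Matrix.ext fun p q => factorMap_apply he z j p q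

lemma map_factorMap (he : Function.Injective e) {T T' : Type*} [CommRing T] [CommRing T']
    (f : T →+* T') (z : FactorIndex M R C r → T) (m : M) :
    f (factorMap e r z m) = factorMap e r (fun i => f (z i)) m := by
  by_cases hm : ∃ s, e s = m
  · obtain ⟨⟨j, p, q⟩, rfl⟩ := hm
    rw [factorMap_apply he, factorMap_apply he]
    simp
  · rw [factorMap, factorMap, Function.extend_apply' _ _ _ hm, Function.extend_apply' _ _ _ hm]

/-- A tuple whose `j`-th matrix is a product `X j * Y j` lies in the image of `factorMap`. -/
lemma exists_factorMap_eq (he : Function.Injective e) {T : Type*} [CommRing T] (a : M → T)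
    (X : ∀ j, Matrix (R j) (Fin (r j)) T) (Y : ∀ j, Matrix (Fin (r j)) (C j) T)
    (h : ∀ j, blockMatrix e a j = X j * Y j) : ∃ z, factorMap e r z = a := by
  refine ⟨Sum.elim (fun s => X s.1 s.2.1 s.2.2) (Sum.elim (fun s => Y s.1 s.2.1 s.2.2) a), ?_⟩
  funext m
  by_cases hm : ∃ s, e s = m
  · obtain ⟨⟨j, p, q⟩, rfl⟩ := hm
    rw [factorMap_apply he]
    exact (congrFun (congrFun (h j) p) q).symm
  · rw [factorMap, Function.extend_apply' _ _ _ hm]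
    rfl

variable {F : Type*} [Field F]

lemma isRegular_factorMap (he : Function.Injective e) :
    IsRegular (F := F) (σ := FactorIndex M R C r) (τ := M) (factorMap e r) := by
  intro m
  by_cases hm : ∃ s, e s = m
  · obtain ⟨⟨j, p, q⟩, rfl⟩ := hm
    have := sum_mem (S := polyFun (FactorIndex M R C r) F) (t := Finset.univ) fun k _ =>
      mul_mem (coord_mem_polyFun (F := F) (Sum.inl ⟨j, p, k⟩ : FactorIndex M R C r))
        (coord_mem_polyFun (Sum.inr (Sum.inl ⟨j, k, q⟩) : FactorIndex M R C r))
    refine (congrArg (· ∈ polyFun (FactorIndex M R C r) F) (_root_.funext fun x => ?_)).mpr this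
    rw [Finset.sum_apply]
    exact factorMap_apply he _ j p q
  · simp_rw [factorMap, Function.extend_apply' _ _ _ hm]
    exact coord_mem_polyFun _

variable [∀ j, Fintype (C j)]

/-- Rank at most `r` means factoring through an `r`-dimensional space. Irreducibility of the locus
follows, and so do identities over arbitrary algebras. -/
lemma range_factorMap (he : Function.Injective e) :
    Set.range (factorMap e r : (FactorIndex M R C r → F) → (M → F)) = rankLocus F e r := by
  ext a
  constructor
  · rintro ⟨z, rfl⟩ j
    rw [blockMatrix_factorMap he]
    exact (Matrix.rank_mul_le_left _ _).trans ((Matrix.rank_le_card_width _).trans (by simp))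
  · intro h
    choose X Y hXY using fun j => exists_eq_mul_of_rank_le _ (h j)
    exact exists_factorMap_eq he a X Y hXY

lemma isIrreducible_rankLocus [Infinite F] (he : Function.Injective e) :
    IsIrreducible (rankLocus F e r) := by
  rw [← range_factorMap he, ← Set.image_univ]
  exact isIrreducible_univ.image _ (isRegular_factorMap he).continuous.continuousOn

/-- If `f` vanishes on the rank locus, it vanishes on every tuple of products over every
algebra. -/
lemma aeval_factorMap_eq_zero [Infinite F] (he : Function.Injective e) {f : MvPolynomial M F}
    (hf : f ∈ idealOf (rankLocus F e r)) {T : Type*} [CommRing T] [Algebra F T]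
    (z : FactorIndex M R C r → T) : aeval (factorMap e r z) f = 0 := by
  -- The pullback of `f` vanishes at all points over an infinite field, so it is the zero
  -- polynomial, and this identity can be specialized to any algebra.
  have h0 : bind₁ (factorMap e r (X (R := F))) f = 0 := by
    refine eq_of_evalAt fun x => ?_
    rw [evalAt_bind₁, map_zero]
    refine hf _ ?_
    rw [← range_factorMap he]
    refine ⟨x, funext fun m => ?_⟩
    have := map_factorMap he (evalAt x : _ →+* F) (X (R := F) : FactorIndex M R C r → _) m
    refine Eq.trans ?_ this.symm
    congr 1
    exact funext fun i => (evalAt_X x i).symm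
  have h1 := congrArg (aeval z) h0
  rw [map_zero, aeval_bind₁] at h1
  rw [← h1]
  congr 2
  funext m
  have := map_factorMap he (aeval (R := F) z : _ →+* T) (X (R := F) : FactorIndex M R C r → _) m
  refine Eq.trans ?_ this.symm
  congr 1
  exact funext fun i => (aeval_X z i).symm

variable [∀ j, Fintype (R j)]

/-- The equations are `det (P * A_j * Q) = 0` for all constant `P` and `Q` with `r j + 1` rows,
respectively columns; they replace the minors of size `r j + 1`. -/
lemma isClosed_rankLocus : IsClosed (rankLocus F e r) := by
  have h : rankLocus F e r = ⋂ (j : ι) (P : Matrix (Fin (r j + 1)) (R j) F)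
      (Q : Matrix (C j) (Fin (r j + 1)) F), {a | (P * blockMatrix e a j * Q).det = 0} := by
    ext a
    simp only [Set.mem_iInter]
    constructor
    · intro h j P Q
      by_contra hd
      exact absurd (h j) (not_le.2 (le_rank_of_det_ne_zero _ hd))
    · intro h j
      by_contra hd
      obtain ⟨P, Q, hPQ⟩ := exists_det_ne_zero_of_le_rank _ (Nat.succ_le_of_lt (not_le.1 hd))
      exact hPQ (h j P Q)
  rw [h]
  refine isClosed_iInter fun j => isClosed_iInter fun P => isClosed_iInter fun Q => ?_
  refine isClosed_eq_zero (f := fun a : AffSpace M F => (P * blockMatrix e a j * Q).det)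
    (mem_polyFun.2 ⟨Matrix.det (P.map (algebraMap F (MvPolynomial M F)) *
      blockMatrix e (X : M → MvPolynomial M F) j * Q.map (algebraMap F (MvPolynomial M F))),
      fun a => ?_⟩)
  have h1 : (P.map (algebraMap F (MvPolynomial M F))).map (evalAt a) = P :=
    Matrix.ext fun _ _ => (evalAt a).commutes _
  have h2 : (Q.map (algebraMap F (MvPolynomial M F))).map (evalAt a) = Q :=
    Matrix.ext fun _ _ => (evalAt a).commutes _
  have h3 : (blockMatrix e (X : M → MvPolynomial M F) j).map (evalAt a) = blockMatrix e a j :=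
    Matrix.ext fun _ _ => evalAt_X a _
  rw [AlgHom.map_det, AlgHom.mapMatrix_apply, Matrix.map_mul, Matrix.map_mul, h1, h2, h3]

end RankLocus

/-! ### Matrices determined by the rows and columns of an invertible minor. -/

section Minors

variable {M ι : Type} {R C : ι → Type} {e : (Σ j, R j × C j) → M} {r : ι → ℕ}
  (u : ∀ j, Fin (r j) → R j) (v : ∀ j, Fin (r j) → C j)

/-- The chosen square submatrix of the `j`-th matrix. -/
def minorMatrix (e : (Σ j, R j × C j) → M) {T : Type*} (b : M → T) (j : ι) :
    Matrix (Fin (r j)) (Fin (r j)) T :=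
  (blockMatrix e b j).submatrix (u j) (v j)

/-- The tuple of matrices of rank `r j` with given entries in the chosen rows and columns. -/
def completion (e : (Σ j, R j × C j) → M) {T : Type*} [CommRing T] (b : M → T) : M → T :=
  Function.extend e
    (fun s => ((blockMatrix e b s.1).submatrix id (v s.1) * (minorMatrix u v e b s.1)⁻¹ *
      (blockMatrix e b s.1).submatrix (u s.1) id) s.2.1 s.2.2) b

variable {u v}

lemma blockMatrix_completion (he : Function.Injective e) {T : Type*} [CommRing T] (b : M → T)
    (j : ι) : blockMatrix e (completion u v e b) j =
      (blockMatrix e b j).submatrix id (v j) * (minorMatrix u v e b j)⁻¹ *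
        (blockMatrix e b j).submatrix (u j) id :=
  Matrix.ext fun p q => show completion u v e b (e ⟨j, p, q⟩) = _ by
    rw [completion, he.extend_apply]

lemma completion_apply_of_forall_ne {T : Type*} [CommRing T] (b : M → T) {m : M}
    (hm : ¬ ∃ s, e s = m) : completion u v e b m = b m :=
  Function.extend_apply' _ _ _ hm

/-- The positions that lie outside of all chosen rows and columns. -/
def IsFreePos (e : (Σ j, R j × C j) → M) (u : ∀ j, Fin (r j) → R j) (v : ∀ j, Fin (r j) → C j)
    (m : M) : Prop :=
  ∃ s, e s = m ∧ s.2.1 ∉ Set.range (u s.1) ∧ s.2.2 ∉ Set.range (v s.1)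

/-- Restricted to the chosen columns or rows, one factor of the product becomes the minor, which
cancels against its inverse. -/
lemma completion_apply_of_not_isFreePos (he : Function.Injective e) {T : Type*} [CommRing T]
    {b : M → T} (hb : ∀ j, IsUnit (minorMatrix u v e b j).det) {m : M}
    (hm : ¬ IsFreePos e u v m) : completion u v e b m = b m := by
  by_cases hs : ∃ s, e s = m
  · obtain ⟨⟨j, p, q⟩, rfl⟩ := hs
    have h1 := congrFun (congrFun (blockMatrix_completion (u := u) (v := v) he b j) p) q
    change completion u v e b (e ⟨j, p, q⟩) = _ at h1
    rw [h1]
    have hpq : p ∈ Set.range (u j) ∨ q ∈ Set.range (v j) := by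
      by_contra! h
      exact hm ⟨_, rfl, h⟩
    rcases hpq with ⟨i, rfl⟩ | ⟨i, rfl⟩
    · have h2 : ((blockMatrix e b j).submatrix id (v j) * (minorMatrix u v e b j)⁻¹).submatrix
          (u j) id = 1 := by
        rw [← Matrix.mul_nonsing_inv _ (hb j)]
        rfl
      change (((blockMatrix e b j).submatrix id (v j) * (minorMatrix u v e b j)⁻¹).submatrix
          (u j) id * (blockMatrix e b j).submatrix (u j) id) i q = _
      rw [h2, Matrix.one_mul]
      rfl
    · have h2 : (minorMatrix u v e b j)⁻¹ * ((blockMatrix e b j).submatrix (u j) id).submatrix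
          id (v j) = 1 := by
        rw [← Matrix.nonsing_inv_mul _ (hb j)]
        rfl
      rw [Matrix.mul_assoc]
      change ((blockMatrix e b j).submatrix id (v j) * ((minorMatrix u v e b j)⁻¹ *
        ((blockMatrix e b j).submatrix (u j) id).submatrix id (v j))) p i = _
      rw [h2, Matrix.mul_one]
      rfl
  · exact completion_apply_of_forall_ne b hs

lemma blockMatrix_map {T T' : Type*} (f : T → T') (b : M → T) (j : ι) :
    blockMatrix e (fun m => f (b m)) j = (blockMatrix e b j).map f := rfl

lemma map_completion (he : Function.Injective e) {T T' : Type*} [CommRing T] [CommRing T']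
    (f : T →+* T') {b : M → T} (hb : ∀ j, IsUnit (minorMatrix u v e b j).det) (m : M) :
    f (completion u v e b m) = completion u v e (fun m => f (b m)) m := by
  by_cases hs : ∃ s, e s = m
  · obtain ⟨⟨j, p, q⟩, rfl⟩ := hs
    have h1 := congrFun (congrFun (blockMatrix_completion (u := u) (v := v) he b j) p) q
    have h2 := congrFun (congrFun (blockMatrix_completion (u := u) (v := v) he
      (fun m => f (b m)) j) p) q
    change completion u v e b (e ⟨j, p, q⟩) = _ at h1
    change completion u v e (fun m => f (b m)) (e ⟨j, p, q⟩) = _ at h2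
    have h3 : (minorMatrix u v e (fun m => f (b m)) j)⁻¹ = (minorMatrix u v e b j)⁻¹.map f := by
      refine Matrix.inv_eq_left_inv ?_
      change _ * (minorMatrix u v e b j).map f = 1
      rw [← Matrix.map_mul, Matrix.nonsing_inv_mul _ (hb j)]
      simp
    rw [h1, h2, h3, blockMatrix_map]
    change _ = (((blockMatrix e b j).submatrix id (v j)).map f * (minorMatrix u v e b j)⁻¹.map f *
      ((blockMatrix e b j).submatrix (u j) id).map f) p q
    rw [← Matrix.map_mul, ← Matrix.map_mul]
    rfl
  · rw [completion_apply_of_forall_ne _ hs, completion_apply_of_forall_ne _ hs]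

/-- The formula reads only entries in a chosen row or column, and coordinates that belong to no
matrix. The values at free positions are therefore irrelevant. -/
lemma completion_congr {T : Type*} [CommRing T] {b b' : M → T}
    (h : ∀ m, ¬ IsFreePos e u v m → b m = b' m) (he : Function.Injective e) (m : M) :
    completion u v e b m = completion u v e b' m := by
  have hnot (j : ι) (p : R j) (q : C j) (hpq : p ∈ Set.range (u j) ∨ q ∈ Set.range (v j)) :
      ¬ IsFreePos e u v (e ⟨j, p, q⟩) := by
    rintro ⟨s, hs, h1, h2⟩
    obtain rfl := he hs
    exact hpq.elim h1 h2
  by_cases hs : ∃ s, e s = m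
  · obtain ⟨⟨j, p, q⟩, rfl⟩ := hs
    have h1 : (blockMatrix e b j).submatrix id (v j) = (blockMatrix e b' j).submatrix id (v j) :=
      Matrix.ext fun p i => h _ (hnot j p _ (.inr ⟨i, rfl⟩))
    have h2 : (blockMatrix e b j).submatrix (u j) id = (blockMatrix e b' j).submatrix (u j) id :=
      Matrix.ext fun i q => h _ (hnot j _ q (.inl ⟨i, rfl⟩))
    have h3 : minorMatrix u v e b j = minorMatrix u v e b' j :=
      Matrix.ext fun i k => h _ (hnot j _ _ (.inl ⟨i, rfl⟩))
    rw [completion, completion, he.extend_apply, he.extend_apply, h1, h2, h3]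
  · rw [completion_apply_of_forall_ne _ hs, completion_apply_of_forall_ne _ hs]
    refine h m ?_
    rintro ⟨s, h', -⟩
    exact hs ⟨s, h'⟩

variable {F : Type*} [Field F] [∀ j, Fintype (C j)]

/-- If `A = X * Y` with inner dimension `r`, the minor is the product of the square blocks `X_u` and
`Y_v`, both invertible, and `X Y_v (X_u Y_v)⁻¹ X_u Y` collapses to `X Y`. -/
lemma completion_eq_self (he : Function.Injective e) {a : AffSpace M F} (ha : a ∈ rankLocus F e r)
    (hd : ∀ j, (minorMatrix u v e a j).det ≠ 0) : completion u v e (T := F) a = a := by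
  rw [← range_factorMap he] at ha
  obtain ⟨z, rfl⟩ := ha
  funext m
  by_cases hs : ∃ s, e s = m
  · obtain ⟨⟨j, p, q⟩, rfl⟩ := hs
    have h1 := blockMatrix_completion (u := u) (v := v) he (factorMap e r z) j
    have h2 := blockMatrix_factorMap he z j
    set A := blockMatrix e (factorMap e r z) j
    set X : Matrix (R j) (Fin (r j)) F := Matrix.of (fun p k => z (.inl ⟨j, p, k⟩))
    set Y : Matrix (Fin (r j)) (C j) F := Matrix.of (fun k q => z (.inr (.inl ⟨j, k, q⟩)))
    have h3 : minorMatrix u v e (factorMap e r z) j = X.submatrix (u j) id * Y.submatrix id (v j) := by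
      change A.submatrix _ _ = _
      rw [h2]
      rfl
    have h4 : A.submatrix id (v j) = X * Y.submatrix id (v j) := by rw [h2]; rfl
    have h5 : A.submatrix (u j) id = X.submatrix (u j) id * Y := by rw [h2]; rfl
    have hdj := hd j
    rw [h3, Matrix.det_mul] at hdj
    have hX : IsUnit (X.submatrix (u j) id).det := (left_ne_zero_of_mul hdj).isUnit
    have hY : IsUnit (Y.submatrix id (v j)).det := (right_ne_zero_of_mul hdj).isUnit
    refine congrFun (congrFun (?_ : blockMatrix e (completion u v e (factorMap e r z)) j = A) p) q
    rw [h1, h3, h4, h5, Matrix.mul_inv_rev]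
    calc X * Y.submatrix id (v j) * ((Y.submatrix id (v j))⁻¹ * (X.submatrix (u j) id)⁻¹) *
          (X.submatrix (u j) id * Y)
        = X * (Y.submatrix id (v j) * (Y.submatrix id (v j))⁻¹) * ((X.submatrix (u j) id)⁻¹ *
          X.submatrix (u j) id) * Y := by simp only [Matrix.mul_assoc]
      _ = A := by rw [Matrix.mul_nonsing_inv _ hY, Matrix.nonsing_inv_mul _ hX, h2]; simp
  · exact completion_apply_of_forall_ne _ hs

end Minors

end GroebnerCell

namespace GroebnerCell

open MvPolynomial

/-! ### The height of the ideal of a determinantal locus. -/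

section RankLocusHeight

variable {M ι : Type} {R C : ι → Type} {e : (Σ j, R j × C j) → M} {r : ι → ℕ}
  {u : ∀ j, Fin (r j) → R j} {v : ∀ j, Fin (r j) → C j}
  {F : Type*} [Field F]

/-- The determinant of the chosen square submatrix of the `j`-th generic matrix. -/
def minorPoly (F : Type*) [Field F] (e : (Σ j, R j × C j) → M) (u : ∀ j, Fin (r j) → R j)
    (v : ∀ j, Fin (r j) → C j) (j : ι) : MvPolynomial M F :=
  (minorMatrix u v e (X : M → MvPolynomial M F) j).det

lemma map_det_minorMatrix {T T' : Type*} [CommRing T] [CommRing T'] (f : T →+* T') (b : M → T)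
    (j : ι) :
    f (minorMatrix u v e b j).det = (minorMatrix u v e (fun m => f (b m)) j).det :=
  RingHom.map_det f _

lemma evalAt_minorPoly (a : AffSpace M F) (j : ι) :
    evalAt a (minorPoly F e u v j) = (minorMatrix u v e a j).det := by
  have h : minorMatrix u v e (fun m => evalAt a (X m)) j = minorMatrix u v e a j :=
    Matrix.ext fun _ _ => evalAt_X a _
  rw [← h]
  exact map_det_minorMatrix (evalAt a : MvPolynomial M F →+* F) X j

lemma minorMatrix_congr (he : Function.Injective e) {T : Type*} {b b' : M → T}
    (h : ∀ m, ¬ IsFreePos e u v m → b m = b' m) (j : ι) :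
    minorMatrix u v e b j = minorMatrix u v e b' j := by
  refine Matrix.ext fun i k => h _ ?_
  rintro ⟨s, hs, h1, -⟩
  obtain rfl := he hs
  exact h1 ⟨i, rfl⟩

lemma exists_mem_rankLocus_minor_ne_zero [∀ j, Fintype (C j)] (he : Function.Injective e)
    (hu : ∀ j, Function.Injective (u j)) (hv : ∀ j, Function.Injective (v j)) :
    ∃ a ∈ rankLocus F e r, ∀ j, (minorMatrix u v e a j).det ≠ 0 := by
  classical
  -- The two 0-1 factors are chosen so that the selected rows of the first and the selected columns
  -- of the second form identity matrices.
  let z : FactorIndex M R C r → F := Sum.elim (fun s => if s.2.1 = u s.1 s.2.2 then 1 else 0)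
    (Sum.elim (fun s => if s.2.2 = v s.1 s.2.1 then 1 else 0) 0)
  refine ⟨factorMap e r z, ?_, fun j => ?_⟩
  · rw [← range_factorMap he]
    exact ⟨z, rfl⟩
  · have h : minorMatrix u v e (factorMap e r z) j =
        (Matrix.of fun i k => z (.inl ⟨j, u j i, k⟩)) *
          Matrix.of fun k i => z (.inr (.inl ⟨j, k, v j i⟩)) := by
      rw [minorMatrix, blockMatrix_factorMap he]
      rfl
    have h1 : (Matrix.of fun i k => z (.inl ⟨j, u j i, k⟩)) = (1 : Matrix (Fin (r j)) _ F) := by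
      ext i k
      simp [z, Matrix.one_apply, (hu j).eq_iff]
    have h2 : (Matrix.of fun k i => z (.inr (.inl ⟨j, k, v j i⟩))) =
        (1 : Matrix (Fin (r j)) _ F) := by
      ext i k
      simp [z, Matrix.one_apply, (hv j).eq_iff, eq_comm]
    rw [h, h1, h2]
    simp

/-- A nonempty open subset of an irreducible set is dense in it. -/
lemma rankLocus_subset_closure [Infinite F] [Fintype ι] [∀ j, Fintype (C j)]
    (he : Function.Injective e)
    (hu : ∀ j, Function.Injective (u j)) (hv : ∀ j, Function.Injective (v j)) :
    rankLocus F e r ⊆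
      closure {a | a ∈ rankLocus F e r ∧ ∀ j, (minorMatrix u v e a j).det ≠ 0} := by
  have hopen : IsOpen {a : AffSpace M F | ∀ j, (minorMatrix u v e a j).det ≠ 0} := by
    rw [Set.ofPred_forall]
    refine isOpen_iInter_of_finite fun j => ?_
    have := isClosed_eq_zero (mem_polyFun.2 ⟨minorPoly F e u v j, fun _ => rfl⟩)
    simp_rw [evalAt_minorPoly] at this
    exact this.isOpen_compl
  exact subset_closure_inter_of_isPreirreducible_of_isOpen
    (isIrreducible_rankLocus he).isPreirreducible hopen
    (exists_mem_rankLocus_minor_ne_zero he hu hv)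

lemma card_isFreePos [Fintype ι] [∀ j, Fintype (R j)] [∀ j, Fintype (C j)]
    (he : Function.Injective e)
    (hu : ∀ j, Function.Injective (u j)) (hv : ∀ j, Function.Injective (v j)) :
    Nat.card {m // IsFreePos e u v m} =
      ∑ j, (Fintype.card (R j) - r j) * (Fintype.card (C j) - r j) := by
  classical
  let f : (Σ j, {p // p ∉ Set.range (u j)} × {q // q ∉ Set.range (v j)}) →
      {m // IsFreePos e u v m} :=
    fun s => ⟨e ⟨s.1, s.2.1, s.2.2⟩, _, rfl, s.2.1.2, s.2.2.2⟩
  have hf : Function.Bijective f := by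
    constructor
    · rintro ⟨j, p, q⟩ ⟨j', p', q'⟩ h
      have := he (congrArg Subtype.val h)
      obtain ⟨rfl, h2⟩ := Sigma.mk.inj this
      have h3 := Prod.mk.inj (eq_of_heq h2)
      exact Sigma.ext rfl (heq_of_eq (Prod.ext (Subtype.ext h3.1) (Subtype.ext h3.2)))
    · rintro ⟨_, ⟨j, p, q⟩, rfl, hp, hq⟩
      exact ⟨⟨j, ⟨p, hp⟩, ⟨q, hq⟩⟩, rfl⟩
  rw [← Nat.card_congr (Equiv.ofBijective f hf), Nat.card_eq_fintype_card, Fintype.card_sigma]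
  refine Finset.sum_congr rfl fun j _ => ?_
  have h1 := Fintype.card_subtype_compl fun p => p ∈ Set.range (u j)
  have h2 := Fintype.card_subtype_compl fun q => q ∈ Set.range (v j)
  rw [Fintype.card_prod, h1, h2]
  congr 2
  · exact (Set.card_range_of_injective (hu j)).trans (Fintype.card_fin _)
  · exact (Set.card_range_of_injective (hv j)).trans (Fintype.card_fin _)

variable [Infinite F] [Finite M] [Fintype ι] [∀ j, Fintype (C j)]

/-- Where the chosen minors do not vanish, the locus is a graph: the coordinates at non-free
positions are independent, and those at free positions are rational functions of them. So the ideal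
is the kernel of evaluation at the generic point `w`, of height the number of dependent coordinates.
-/
lemma height_idealOf_rankLocus_eq_card (he : Function.Injective e)
    (hu : ∀ j, Function.Injective (u j)) (hv : ∀ j, Function.Injective (v j)) :
    (idealOf (rankLocus F e r)).height = (Nat.card {m // IsFreePos e u v m} : ℕ∞) := by
  classical
  let S := MvPolynomial {m // ¬ IsFreePos e u v m} F
  let b : M → S := fun m => if hm : ¬ IsFreePos e u v m then X ⟨m, hm⟩ else 0
  have hb (m : M) (hm : ¬ IsFreePos e u v m) : b m = X ⟨m, hm⟩ := dif_pos hm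
  let Δ : S := ∏ j, (minorMatrix u v e b j).det
  -- evaluation at a point
  let ev (a : AffSpace M F) : S →ₐ[F] F := aeval fun m => a m
  have hev (a : AffSpace M F) (m : M) (hm : ¬ IsFreePos e u v m) : ev a (b m) = a m := by
    rw [hb m hm]
    exact aeval_X _ _
  have hevdet (a : AffSpace M F) (j : ι) :
      ev a (minorMatrix u v e b j).det = (minorMatrix u v e a j).det :=
    (map_det_minorMatrix (ev a : S →+* F) b j).trans
      (congrArg Matrix.det (minorMatrix_congr he (hev a) j))
  have hevΔ (a : AffSpace M F) (ha : ∀ j, (minorMatrix u v e a j).det ≠ 0) : ev a Δ ≠ 0 := by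
    rw [map_prod, Finset.prod_ne_zero_iff]
    intro j _
    rw [hevdet]
    exact ha j
  have hΔ : Δ ≠ 0 := by
    obtain ⟨a, -, ha⟩ := exists_mem_rankLocus_minor_ne_zero (F := F) he hu hv
    intro h
    exact hevΔ a ha (by rw [h, map_zero])
  let T := Localization.Away Δ
  let bT : M → T := fun m => algebraMap S T (b m)
  have hunit (j : ι) : IsUnit (minorMatrix u v e bT j).det := by
    have h1 : IsUnit (algebraMap S T Δ) := IsLocalization.Away.algebraMap_isUnit Δ
    refine isUnit_of_dvd_unit ?_ h1
    rw [← map_det_minorMatrix (algebraMap S T) b j]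
    exact map_dvd _ (Finset.dvd_prod_of_mem _ (Finset.mem_univ j))
  let w : M → T := completion u v e bT
  have hw (m : M) (hm : ¬ IsFreePos e u v m) : w m = bT m :=
    completion_apply_of_not_isFreePos he hunit hm
  have hI : idealOf (rankLocus F e r) = RingHom.ker (aeval w : MvPolynomial M F →ₐ[F] T) := by
    apply le_antisymm
    -- The generic point is a tuple of products of matrices over `T`, and `f` vanishes on all of
    -- these.
    · intro f hf
      obtain ⟨z, hz⟩ := exists_factorMap_eq he (r := r) w
        (fun j => (blockMatrix e bT j).submatrix id (v j) * (minorMatrix u v e bT j)⁻¹)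
        (fun j => (blockMatrix e bT j).submatrix (u j) id) (blockMatrix_completion he bT)
      rw [RingHom.mem_ker, ← hz]
      exact aeval_factorMap_eq_zero he hf z
    -- It suffices to treat the dense set where the minors are nonzero. Each point `a` of it is the
    -- image of `w` under a homomorphism `ε : T → F`.
    · intro f hf
      have hcl : IsClosed {a : AffSpace M F | evalAt a f = 0} :=
        isClosed_eq_zero (mem_polyFun.2 ⟨f, fun _ => rfl⟩)
      refine (rankLocus_subset_closure he hu hv).trans (hcl.closure_subset_iff.2 ?_)
      rintro a ⟨ha, hd⟩
      let ε : T →+* F := IsLocalization.Away.lift Δ (g := (ev a : S →+* F)) (hevΔ a hd).isUnit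
      have hε (s : S) : ε (algebraMap S T s) = ev a s := IsLocalization.Away.lift_eq Δ _ s
      have hεw (m : M) : ε (w m) = a m := by
        rw [map_completion he ε hunit]
        rw [completion_congr (b' := a) (fun m hm => (hε _).trans (hev a m hm)) he]
        exact congrFun (completion_eq_self he ha hd) m
      have h1 : ε.comp (aeval w : MvPolynomial M F →ₐ[F] T).toRingHom = (evalAt a : _ →+* F) := by
        refine MvPolynomial.ringHom_ext (fun c => ?_) fun m => ?_
        · have h2 : (aeval w : MvPolynomial M F →ₐ[F] T) (MvPolynomial.C c) = algebraMap S T (MvPolynomial.C c) :=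
            (aeval_C w c).trans (IsScalarTower.algebraMap_apply F S T c)
          refine (congrArg ε h2).trans ((hε _).trans ?_)
          exact ((ev a).commutes c).trans ((evalAt a).commutes c).symm
        · exact (congrArg ε (aeval_X w m)).trans ((hεw m).trans (evalAt_X a m).symm)
      have h3 := congrArg (fun g => g f) h1
      refine h3.symm.trans ((congrArg ε hf).trans (map_zero ε))
  -- `T` embeds into the fraction field `Q`, so passing to `Q` does not change the kernel.
  let Q := FractionRing S
  have hpow : Submonoid.powers Δ ≤ nonZeroDivisors S :=
    powers_le_nonZeroDivisors_of_noZeroDivisors hΔ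
  let l : T →+* Q := IsLocalization.Away.lift Δ (g := algebraMap S Q)
    (((map_ne_zero_iff _ (IsFractionRing.injective S Q)).2 hΔ).isUnit)
  have hl (s : S) : l (algebraMap S T s) = algebraMap S Q s := IsLocalization.Away.lift_eq Δ _ s
  have hlinj : Function.Injective l := by
    refine (IsLocalization.lift_injective_iff _).2 fun x y => ?_
    rw [(IsLocalization.injective T hpow).eq_iff, (IsFractionRing.injective S Q).eq_iff]
  have hker : RingHom.ker (aeval w : MvPolynomial M F →ₐ[F] T) =
      RingHom.ker (aeval (fun m => l (w m)) : MvPolynomial M F →ₐ[F] Q) := by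
    have h1 : l.comp (aeval w : MvPolynomial M F →ₐ[F] T).toRingHom =
        (aeval (fun m => l (w m)) : MvPolynomial M F →ₐ[F] Q).toRingHom := by
      refine MvPolynomial.ringHom_ext (fun c => ?_) fun m => ?_
      · have h2 : (aeval w : MvPolynomial M F →ₐ[F] T) (MvPolynomial.C c) = algebraMap S T (MvPolynomial.C c) :=
          (aeval_C w c).trans (IsScalarTower.algebraMap_apply F S T c)
        refine (congrArg l h2).trans ((hl _).trans ?_)
        exact ((aeval_C _ c).trans (IsScalarTower.algebraMap_apply F S Q c)).symm
      · exact (congrArg l (aeval_X w m)).trans (aeval_X (fun m => l (w m)) m).symm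
    ext f
    have h3 := congrArg (fun g => g f) h1
    rw [RingHom.mem_ker, RingHom.mem_ker, ← map_eq_zero_iff l hlinj]
    exact Eq.congr_left h3
  rw [hI, hker]
  exact height_ker_aeval_of_isFractionRing (fun m => IsFreePos e u v m) _ fun m hm => by
    rw [hw m hm, hl, hb m hm]

end RankLocusHeight

section RankLocusMain

variable {M ι : Type} {R C : ι → Type} {e : (Σ j, R j × C j) → M} {r : ι → ℕ}
  {F : Type*} [Field F] [Infinite F] [Fintype ι] [∀ j, Fintype (R j)]
  [∀ j, Fintype (C j)]

lemma exists_injective_of_le_card {α : Type} [Fintype α] {n : ℕ} (h : n ≤ Fintype.card α) :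
    ∃ f : Fin n → α, Function.Injective f :=
  ⟨(Fintype.equivFin α).symm ∘ Fin.castLE h,
    (Fintype.equivFin α).symm.injective.comp (Fin.castLE_injective h)⟩

theorem height_idealOf_rankLocus [Finite M] (he : Function.Injective e)
    (hR : ∀ j, r j ≤ Fintype.card (R j)) (hC : ∀ j, r j ≤ Fintype.card (C j)) :
    (idealOf (rankLocus F e r)).height =
      ((∑ j, (Fintype.card (R j) - r j) * (Fintype.card (C j) - r j) : ℕ) : ℕ∞) := by
  choose u hu using fun j => exists_injective_of_le_card (hR j)
  choose v hv using fun j => exists_injective_of_le_card (hC j)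
  rw [height_idealOf_rankLocus_eq_card he hu hv, card_isFreePos he hu hv]

/-- On the dense part with nonvanishing minors of size `r j` the ranks cannot drop below `r j`. -/
theorem closure_rank_eq (he : Function.Injective e)
    (hR : ∀ j, r j ≤ Fintype.card (R j)) (hC : ∀ j, r j ≤ Fintype.card (C j)) :
    closure {a : AffSpace M F | ∀ j, (blockMatrix e a j).rank = r j} = rankLocus F e r := by
  choose u hu using fun j => exists_injective_of_le_card (hR j)
  choose v hv using fun j => exists_injective_of_le_card (hC j)
  refine Set.Subset.antisymm (isClosed_rankLocus.closure_subset_iff.2 fun a ha j => (ha j).le) ?_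
  refine (rankLocus_subset_closure he hu hv).trans (closure_mono ?_)
  rintro a ⟨ha, hd⟩ j
  exact le_antisymm (ha j) (le_rank_of_det_submatrix_ne_zero _ (hd j))

end RankLocusMain

end GroebnerCell

namespace GroebnerCell

open MvPolynomial

/-! ### Forms of degree `d` in two variables as polynomials of degree at most `d`. -/

section Dehomogenization

variable {F : Type*} [Field F]

/-- The exponent vector of `x^p y^q`. -/
def expo (p q : ℕ) : Fin 2 →₀ ℕ := Finsupp.single 0 p + Finsupp.single 1 q

@[simp] lemma expo_zero (p q : ℕ) : expo p q 0 = p := by simp [expo]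

@[simp] lemma expo_one (p q : ℕ) : expo p q 1 = q := by simp [expo]

lemma degree_eq_add (a : Fin 2 →₀ ℕ) : a.degree = a 0 + a 1 := by
  rw [Finsupp.degree_eq_sum, Fin.sum_univ_two]

@[simp] lemma degree_expo (p q : ℕ) : (expo p q).degree = p + q := by
  simp [degree_eq_add]

lemma ext_two {a b : Fin 2 →₀ ℕ} (h0 : a 0 = b 0) (h1 : a 1 = b 1) : a = b := by
  ext i
  fin_cases i
  · exact h0
  · exact h1

lemma expo_eq_iff {p q : ℕ} {a : Fin 2 →₀ ℕ} : expo p q = a ↔ p = a 0 ∧ q = a 1 :=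
  ⟨fun h => by simp [← h], fun ⟨h0, h1⟩ => ext_two (by simp [h0]) (by simp [h1])⟩

/-- Dehomogenization, `y ↦ 1`. -/
def dehomogenize : MvPolynomial (Fin 2) F →ₐ[F] Polynomial F :=
  aeval ![Polynomial.X, 1]

@[simp] lemma dehomogenize_X_zero :
    dehomogenize (X 0 : MvPolynomial (Fin 2) F) = Polynomial.X := by
  simp [dehomogenize]

@[simp] lemma dehomogenize_X_one : dehomogenize (X 1 : MvPolynomial (Fin 2) F) = 1 := by
  simp [dehomogenize]

lemma dehomogenize_monomial (a : Fin 2 →₀ ℕ) (c : F) :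
    dehomogenize (monomial a c) = Polynomial.monomial (a 0) c := by
  rw [dehomogenize, aeval_monomial, Finsupp.prod_fintype _ _ (by simp)]
  simp [← Polynomial.C_mul_X_pow_eq_monomial]

/-- Homogenization to degree `d` (forgetting the coefficients in degrees above `d`). -/
def homogenizeTo (d : ℕ) : Polynomial F →ₗ[F] MvPolynomial (Fin 2) F :=
  ∑ p ∈ Finset.range (d + 1), monomial (expo p (d - p)) ∘ₗ Polynomial.lcoeff F p

lemma homogenizeTo_apply (d : ℕ) (g : Polynomial F) :
    homogenizeTo d g = ∑ p ∈ Finset.range (d + 1), monomial (expo p (d - p)) (g.coeff p) := by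
  simp [homogenizeTo]

lemma homogenizeTo_mem (d : ℕ) (g : Polynomial F) :
    homogenizeTo d g ∈ homogeneousSubmodule (Fin 2) F d := by
  rw [homogenizeTo_apply]
  refine sum_mem fun p hp => isHomogeneous_monomial _ ?_
  rw [degree_expo]
  have := Finset.mem_range.1 hp
  omega

lemma coeff_homogenizeTo (d : ℕ) (g : Polynomial F) (a : Fin 2 →₀ ℕ) :
    coeff a (homogenizeTo d g) = if a.degree = d then g.coeff (a 0) else 0 := by
  classical
  split_ifs with h
  · rw [degree_eq_add] at h
    rw [homogenizeTo_apply, coeff_sum, Finset.sum_eq_single (a 0)]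
    · rw [coeff_monomial, if_pos]
      rw [expo_eq_iff]
      omega
    · intro p _ hp
      rw [coeff_monomial, if_neg]
      rw [expo_eq_iff]
      exact fun h => hp h.1
    · intro h1
      rw [Finset.mem_range] at h1
      omega
  · by_contra hc
    exact h ((homogenizeTo_mem d g).degree_eq_sum_deg_support (mem_support_iff.2 hc)).symm

lemma homogenizeTo_dehomogenize {d : ℕ} {f : MvPolynomial (Fin 2) F}
    (hf : f ∈ homogeneousSubmodule (Fin 2) F d) : homogenizeTo d (dehomogenize f) = f := by
  conv_rhs => rw [← support_sum_monomial_coeff f]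
  conv_lhs => rw [← support_sum_monomial_coeff f]
  rw [map_sum, map_sum]
  refine Finset.sum_congr rfl fun a ha => ?_
  have had : a.degree = d := ((hf : f.IsHomogeneous d).degree_eq_sum_deg_support ha).symm
  rw [dehomogenize_monomial]
  ext b
  rw [coeff_homogenizeTo, Polynomial.coeff_monomial, coeff_monomial]
  rw [degree_eq_add] at had
  by_cases hab : a = b
  · subst hab
    simp [degree_eq_add, had]
  · rw [if_neg hab]
    split_ifs with h1 h2
    · rw [degree_eq_add] at h1
      exact absurd (ext_two h2 (by omega)) hab
    · rfl
    · rfl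

lemma dehomogenize_homogenizeTo {d : ℕ} {g : Polynomial F} (hg : g.natDegree ≤ d) :
    dehomogenize (homogenizeTo d g) = g := by
  rw [homogenizeTo_apply, map_sum]
  conv_rhs => rw [g.as_sum_range' (d + 1) (Nat.lt_succ_of_le hg)]
  simp [dehomogenize_monomial]

lemma natDegree_dehomogenize_le {d : ℕ} {f : MvPolynomial (Fin 2) F}
    (hf : f ∈ homogeneousSubmodule (Fin 2) F d) : (dehomogenize f).natDegree ≤ d := by
  conv_lhs => rw [← support_sum_monomial_coeff f]
  rw [map_sum]
  refine Polynomial.natDegree_sum_le_of_forall_le _ _ fun a ha => ?_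
  have had : a.degree = d := ((hf : f.IsHomogeneous d).degree_eq_sum_deg_support ha).symm
  rw [dehomogenize_monomial]
  refine (Polynomial.natDegree_monomial_le _).trans ?_
  rw [degree_eq_add] at had
  omega

lemma coeff_dehomogenize {d p : ℕ} {f : MvPolynomial (Fin 2) F}
    (hf : f ∈ homogeneousSubmodule (Fin 2) F d) (hp : p ≤ d) :
    (dehomogenize f).coeff p = coeff (expo p (d - p)) f := by
  conv_rhs => rw [← homogenizeTo_dehomogenize hf]
  rw [coeff_homogenizeTo, if_pos (by rw [degree_expo]; omega), expo_zero]

lemma eq_zero_of_dehomogenize_eq_zero {d : ℕ} {f : MvPolynomial (Fin 2) F}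
    (hf : f ∈ homogeneousSubmodule (Fin 2) F d) (h : dehomogenize f = 0) : f = 0 := by
  rw [← homogenizeTo_dehomogenize hf, h, map_zero]

end Dehomogenization

/-! ### Betti numbers in terms of Hilbert function and growth. -/

section Parts

variable {F : Type*} [Field F] (J : Ideal (MvPolynomial (Fin 2) F))

/-- The dehomogenization of the degree `d` part of an ideal. -/
def dehomPart (d : ℕ) : Submodule F (Polynomial F) :=
  (shiftedPart J 0 d).map dehomogenize.toLinearMap

/-- Multiplication by the variable. -/
def mulX : Polynomial F →ₗ[F] Polynomial F := LinearMap.mulLeft F Polynomial.X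

@[simp] lemma mulX_apply (g : Polynomial F) : mulX g = Polynomial.X * g := rfl

lemma mem_shiftedPart_zero {d : ℕ} {f : MvPolynomial (Fin 2) F} :
    f ∈ shiftedPart J 0 d ↔ f ∈ J ∧ f ∈ homogeneousSubmodule (Fin 2) F d := by
  rw [shiftedPart, if_pos (Nat.zero_le d)]
  rfl

lemma shiftedPart_add (i d : ℕ) : shiftedPart J i (d + i) = shiftedPart J 0 d := by
  rw [shiftedPart, if_pos (Nat.le_add_left i d), shiftedPart, if_pos (Nat.zero_le d),
    Nat.add_sub_cancel, Nat.sub_zero]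

lemma shiftedPart_eq_bot {i d : ℕ} (h : d < i) : shiftedPart J i d = ⊥ :=
  if_neg (not_le.2 h)

lemma dehomPart_le (d : ℕ) : dehomPart J d ≤ Polynomial.degreeLE F d := by
  rintro _ ⟨f, hf, rfl⟩
  rw [Polynomial.mem_degreeLE]
  exact Polynomial.natDegree_le_iff_degree_le.1
    (natDegree_dehomogenize_le ((mem_shiftedPart_zero J).1 hf).2)

lemma finrank_map_of_forall {V W : Type*} [AddCommGroup V] [Module F V] [AddCommGroup W]
    [Module F W] (f : V →ₗ[F] W) (S : Submodule F V) (h : ∀ x ∈ S, f x = 0 → x = 0) :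
    Module.finrank F (S.map f) = Module.finrank F S := by
  have hinj : Function.Injective (f.domRestrict S) := by
    rw [← LinearMap.ker_eq_bot, LinearMap.ker_eq_bot']
    exact fun x hx => Subtype.ext (h x x.2 hx)
  rw [← LinearMap.range_domRestrict]
  exact LinearMap.finrank_range_of_inj hinj

lemma finrank_dehomPart (d : ℕ) : Module.finrank F (dehomPart J d) = hilbertFunction J d :=
  finrank_map_of_forall _ _ fun _ hf h =>
    eq_zero_of_dehomogenize_eq_zero ((mem_shiftedPart_zero J).1 hf).2 h

instance finite_shiftedPart (d : ℕ) : Module.Finite F (shiftedPart J 0 d) := by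
  have h1 : Module.Finite F (Submodule.map (homogenizeTo d) (dehomPart J d)) := by
    have : Module.Finite F (Polynomial.degreeLE F d) := by
      classical
      rw [Polynomial.degreeLE_eq_span_X_pow]
      infer_instance
    have : Module.Finite F (dehomPart J d) := Submodule.finiteDimensional_of_le (dehomPart_le J d)
    infer_instance
  refine Submodule.finiteDimensional_of_le (S₂ := Submodule.map (homogenizeTo d) (dehomPart J d)) ?_
  intro f hf
  exact ⟨_, ⟨f, hf, rfl⟩, homogenizeTo_dehomogenize ((mem_shiftedPart_zero J).1 hf).2⟩

instance finite_dehomPart (d : ℕ) : Module.Finite F (dehomPart J d) :=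
  inferInstanceAs (Module.Finite F ((shiftedPart J 0 d).map dehomogenize.toLinearMap))

lemma X_mul_mem_shiftedPart {d : ℕ} {f : MvPolynomial (Fin 2) F} (hf : f ∈ shiftedPart J 0 d)
    (i : Fin 2) : X i * f ∈ shiftedPart J 0 (d + 1) := by
  rw [mem_shiftedPart_zero] at hf ⊢
  refine ⟨J.mul_mem_left _ hf.1, ?_⟩
  rw [add_comm d 1]
  exact (isHomogeneous_X F i).mul hf.2

lemma map_koszulOne_le (d : ℕ) :
    ((shiftedPart J 0 d).prod (shiftedPart J 0 d)).map koszulOne ≤ shiftedPart J 0 (d + 1) := by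
  rintro _ ⟨⟨a, b⟩, ⟨ha, hb⟩, rfl⟩
  exact add_mem (X_mul_mem_shiftedPart J ha 0) (X_mul_mem_shiftedPart J hb 1)

/-- Under `y ↦ 1` the form `x a + y b` becomes `X a + b`, and dehomogenization is injective in a
fixed degree. -/
lemma finrank_map_koszulOne (d : ℕ) :
    Module.finrank F (((shiftedPart J 0 d).prod (shiftedPart J 0 d)).map koszulOne) =
      Module.finrank F (dehomPart J d ⊔ (dehomPart J d).map mulX : Submodule F _) := by
  rw [← finrank_map_of_forall dehomogenize.toLinearMap]
  · have h : Submodule.map dehomogenize.toLinearMap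
        (((shiftedPart J 0 d).prod (shiftedPart J 0 d)).map koszulOne) =
          dehomPart J d ⊔ (dehomPart J d).map mulX := ?_
    · rw [h]
    apply le_antisymm
    · rintro _ ⟨_, ⟨⟨a, b⟩, ⟨ha, hb⟩, rfl⟩, rfl⟩
      have h : dehomogenize.toLinearMap (koszulOne (a, b)) =
          dehomogenize b + mulX (dehomogenize a) := by
        simp [koszulOne, add_comm]
      rw [h]
      exact Submodule.add_mem_sup ⟨b, hb, rfl⟩ ⟨_, ⟨a, ha, rfl⟩, rfl⟩
    · refine sup_le ?_ ?_
      · rintro _ ⟨b, hb, rfl⟩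
        exact ⟨_, ⟨(0, b), ⟨zero_mem _, hb⟩, rfl⟩, by simp [koszulOne]⟩
      · rintro _ ⟨_, ⟨a, ha, rfl⟩, rfl⟩
        exact ⟨_, ⟨(a, 0), ⟨ha, zero_mem _⟩, rfl⟩, by simp [koszulOne]⟩
  · intro f hf h
    exact eq_zero_of_dehomogenize_eq_zero
      ((mem_shiftedPart_zero J).1 (map_koszulOne_le J d hf)).2 h

lemma finrank_quotient_submoduleOf {V : Type*} [AddCommGroup V] [Module F V]
    {N P : Submodule F V} (h : N ≤ P) [Module.Finite F P] :
    Module.finrank F (P ⧸ N.submoduleOf P) + Module.finrank F N = Module.finrank F P := by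
  rw [← (Submodule.submoduleOfEquivOfLe h).finrank_eq]
  exact Submodule.finrank_quotient_add_finrank _

/-- The dimension of `R₁ I_d`. -/
def growth (d : ℕ) : ℕ :=
  Module.finrank F (dehomPart J d ⊔ (dehomPart J d).map mulX : Submodule F _)

lemma bettiNumber_zero_zero : bettiNumber J 0 0 = hilbertFunction J 0 := by
  have h : Submodule.map koszulOne ((shiftedPart J 1 0).prod (shiftedPart J 1 0)) = ⊥ := by
    rw [shiftedPart_eq_bot J Nat.zero_lt_one, Submodule.prod_bot, Submodule.map_bot]
  have := finrank_quotient_submoduleOf (F := F) (N := ⊥) (P := shiftedPart J 0 0) bot_le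
  rw [finrank_bot, add_zero] at this
  rw [bettiNumber, h, this]
  rfl

lemma bettiNumber_zero_succ (d : ℕ) :
    bettiNumber J 0 (d + 1) + growth J d = hilbertFunction J (d + 1) := by
  have := finrank_quotient_submoduleOf (map_koszulOne_le J d)
  rw [finrank_map_koszulOne] at this
  rw [bettiNumber, shiftedPart_add]
  exact this

lemma bettiNumber_one_zero : bettiNumber J 1 0 = 0 := by
  rw [bettiNumber, shiftedPart_eq_bot J Nat.zero_lt_one, Submodule.prod_bot, bot_inf_eq]
  exact Module.finrank_zero_of_subsingleton

lemma koszulTwo_injective : Function.Injective (koszulTwo (F := F)) := by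
  intro a b h
  have := (Prod.mk.inj h).2
  exact mul_left_cancel₀ (X_ne_zero (R := F) (0 : Fin 2)) this

lemma finite_and_finrank_prod {V W : Type*} [AddCommGroup V] [Module F V] [AddCommGroup W]
    [Module F W] (S : Submodule F V) (T : Submodule F W) [Module.Finite F S] [Module.Finite F T] :
    Module.Finite F (S.prod T) ∧
      Module.finrank F (S.prod T) = Module.finrank F S + Module.finrank F T := by
  have h : S.prod T = LinearMap.range (S.subtype.prodMap T.subtype) := by
    rw [LinearMap.range_prodMap, S.range_subtype, T.range_subtype]
  rw [h]
  refine ⟨inferInstance, ?_⟩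
  rw [LinearMap.finrank_range_of_inj, Module.finrank_prod]
  exact S.subtype_injective.prodMap T.subtype_injective

lemma finrank_map_add_finrank_inf_ker {V W : Type*} [AddCommGroup V] [Module F V]
    [AddCommGroup W] [Module F W] (f : V →ₗ[F] W) (S : Submodule F V) [Module.Finite F S] :
    Module.finrank F (S.map f) + Module.finrank F (S ⊓ LinearMap.ker f : Submodule F V) =
      Module.finrank F S := by
  rw [← LinearMap.finrank_range_add_finrank_ker (f.domRestrict S), LinearMap.range_domRestrict,
    LinearMap.ker_domRestrict, ← Submodule.map_comap_subtype, Submodule.finrank_map_subtype_eq]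

/-- Rank-nullity for the Koszul map on `J_d × J_d`: its image has dimension `growth J d`, and in its
kernel the boundaries are an injective copy of `J_{d-1}`. -/
lemma bettiNumber_one_succ (d : ℕ) :
    bettiNumber J 1 (d + 1) + growth J d + Module.finrank F (shiftedPart J 2 (d + 1)) =
      2 * hilbertFunction J d := by
  have hP := map_koszulOne_le J d
  obtain ⟨hfin, hPrank⟩ := finite_and_finrank_prod (shiftedPart J 0 d) (shiftedPart J 0 d)
  have h1 := finrank_map_add_finrank_inf_ker koszulOne
    ((shiftedPart J 0 d).prod (shiftedPart J 0 d))
  rw [finrank_map_koszulOne, hPrank] at h1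
  have hle : (shiftedPart J 2 (d + 1)).map koszulTwo ≤
      (shiftedPart J 0 d).prod (shiftedPart J 0 d) ⊓ LinearMap.ker koszulOne := by
    rintro _ ⟨c, hc, rfl⟩
    refine ⟨?_, ?_⟩
    · rcases d with _ | d
      · rw [shiftedPart_eq_bot J (by omega)] at hc
        rw [(Submodule.mem_bot F).1 hc, map_zero]
        exact zero_mem _
      · rw [shiftedPart_add J 2 d] at hc
        refine ⟨?_, X_mul_mem_shiftedPart J hc 0⟩
        have := neg_mem (X_mul_mem_shiftedPart J hc 1)
        rwa [← neg_mul] at this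
    · simp [koszulOne, koszulTwo]
      ring
  have hfin' : Module.Finite F ((shiftedPart J 0 d).prod (shiftedPart J 0 d) ⊓
      LinearMap.ker koszulOne : Submodule F _) := Submodule.finiteDimensional_of_le inf_le_left
  have h2 := finrank_quotient_submoduleOf hle
  rw [finrank_map_of_forall koszulTwo _ fun x _ hx =>
    koszulTwo_injective (hx.trans (map_zero _).symm)] at h2
  rw [bettiNumber, shiftedPart_add J 1 d]
  have h3 : Module.finrank F (shiftedPart J 0 d) = hilbertFunction J d := rfl
  change _ + Module.finrank F (dehomPart J d ⊔ (dehomPart J d).map mulX : Submodule F _) + _ = _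
  omega

/-- A nonzero space of polynomials of bounded degree is not stable under multiplication by `X`. -/
lemma hilbertFunction_lt_growth {d : ℕ} (h : hilbertFunction J d ≠ 0) :
    hilbertFunction J d < growth J d := by
  rw [← finrank_dehomPart] at h ⊢
  have hfin : Module.Finite F (dehomPart J d ⊔ (dehomPart J d).map mulX : Submodule F _) :=
    inferInstance
  refine Submodule.finrank_lt_finrank_of_lt (lt_of_le_of_ne le_sup_left fun he => ?_)
  have hX : ∀ g ∈ dehomPart J d, Polynomial.X * g ∈ dehomPart J d := by
    intro g hg
    rw [he]
    exact Submodule.mem_sup_right ⟨g, hg, rfl⟩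
  have hne : dehomPart J d ≠ ⊥ := by
    intro hb
    rw [hb, finrank_bot] at h
    exact h rfl
  obtain ⟨g, hg, hg0⟩ := Submodule.exists_mem_ne_zero_of_ne_bot hne
  have hpow (n : ℕ) : Polynomial.X ^ n * g ∈ dehomPart J d := by
    induction n with
    | zero => simpa using hg
    | succ n ih =>
      rw [pow_succ', mul_assoc]
      exact hX _ ih
  have := dehomPart_le J d (hpow (d + 1))
  rw [Polynomial.mem_degreeLE, ← Polynomial.natDegree_le_iff_degree_le,
    Polynomial.natDegree_X_pow_mul _ hg0] at this
  omega

end Parts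

end GroebnerCell

namespace GroebnerCell

open MvPolynomial

/-! ### Spans of monic polynomials with distinct degrees. -/

section MonicFamily

variable {F : Type*} [Field F]

/-- A sequence of monic polynomials, the `p`-th one of degree `p`. -/
def IsMonicFamily (G : ℕ → Polynomial F) : Prop :=
  ∀ p, (G p).Monic ∧ (G p).natDegree = p

variable {G : ℕ → Polynomial F}

lemma IsMonicFamily.coeff_self (hG : IsMonicFamily G) (p : ℕ) : (G p).coeff p = 1 := by
  have := (hG p).1
  rwa [Polynomial.Monic, Polynomial.leadingCoeff, (hG p).2] at this

lemma IsMonicFamily.coeff_eq_zero (hG : IsMonicFamily G) {p q : ℕ} (h : p < q) :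
    (G p).coeff q = 0 :=
  Polynomial.coeff_eq_zero_of_natDegree_lt (by rwa [(hG p).2])

/-- The family as a sequence of polynomials. -/
def IsMonicFamily.sequence (hG : IsMonicFamily G) : Polynomial.Sequence F where
  elems' := G
  degree_eq' p := by rw [Polynomial.degree_eq_natDegree (hG p).1.ne_zero, (hG p).2]

lemma IsMonicFamily.linearIndependent (hG : IsMonicFamily G) : LinearIndependent F G :=
  hG.sequence.linearIndependent

lemma IsMonicFamily.finrank_span (hG : IsMonicFamily G) (s : Finset ℕ) :
    Module.finrank F (Submodule.span F (G '' s)) = s.card := by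
  have h := finrank_span_eq_card (hG.linearIndependent.comp ((↑) : s → ℕ) Subtype.val_injective)
  rw [Set.range_comp, Subtype.range_coe_subtype] at h
  simpa using h

/-- The degrees are distinct, so the leading term of the largest index in a combination cannot
cancel. -/
lemma IsMonicFamily.natDegree_mem (hG : IsMonicFamily G) {S : Set ℕ} {g : Polynomial F}
    (hg : g ∈ Submodule.span F (G '' S)) (h0 : g ≠ 0) : g.natDegree ∈ S := by
  obtain ⟨l, hl, rfl⟩ := (Finsupp.mem_span_image_iff_linearCombination F).1 hg
  have hne : l.support.Nonempty := by
    rw [Finset.nonempty_iff_ne_empty]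
    intro h
    rw [Finsupp.support_eq_empty.1 h, map_zero] at h0
    exact h0 rfl
  set m := l.support.max' hne
  have hm : m ∈ l.support := Finset.max'_mem _ _
  have hdeg : (Finsupp.linearCombination F G l).natDegree = m := by
    refine Polynomial.natDegree_eq_of_le_of_coeff_ne_zero ?_ ?_
    · rw [Finsupp.linearCombination_apply, Finsupp.sum]
      refine Polynomial.natDegree_sum_le_of_forall_le _ _ fun i hi => ?_
      exact (Polynomial.natDegree_smul_le _ _).trans ((hG i).2.le.trans (Finset.le_max' _ _ hi))
    · rw [Finsupp.linearCombination_apply, Finsupp.sum, Polynomial.finsetSum_coeff,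
        Finset.sum_eq_single m]
      · rw [Polynomial.coeff_smul, hG.coeff_self, smul_eq_mul, mul_one]
        exact Finsupp.mem_support_iff.1 hm
      · intro i hi him
        rw [Polynomial.coeff_smul, hG.coeff_eq_zero (lt_of_le_of_ne (Finset.le_max' _ _ hi) him),
          smul_zero]
      · exact fun h => absurd hm h
  rw [hdeg]
  exact hl hm

/-- Division with remainder: subtracting a multiple of `G m` from an element of degree `m` lowers
the degree and stays in `U`. This is the one-variable form of reduction by a Gröbner basis. -/
lemma IsMonicFamily.eq_span (hG : IsMonicFamily G) {S : Set ℕ} {U : Submodule F (Polynomial F)}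
    (hS : ∀ p ∈ S, G p ∈ U) (hU : ∀ g ∈ U, g ≠ 0 → g.natDegree ∈ S) :
    U = Submodule.span F (G '' S) := by
  apply le_antisymm
  · suffices h : ∀ (n : ℕ) (g : Polynomial F), g.natDegree < n → g ∈ U →
        g ∈ Submodule.span F (G '' S) from fun g hg => h _ g (Nat.lt_succ_self _) hg
    intro n
    induction n with
    | zero => exact fun g hg => absurd hg (Nat.not_lt_zero _)
    | succ n ih =>
      intro g hgn hg
      by_cases h0 : g = 0
      · rw [h0]; exact zero_mem _
      have hmem := hU g hg h0
      set m := g.natDegree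
      have h1 : g - g.leadingCoeff • G m ∈ Submodule.span F (G '' S) := by
        by_cases h2 : g - g.leadingCoeff • G m = 0
        · rw [h2]; exact zero_mem _
        have hlt : (g - g.leadingCoeff • G m).natDegree < m := by
          refine lt_of_le_of_ne ?_ fun he => ?_
          · refine (Polynomial.natDegree_sub_le _ _).trans (max_le le_rfl ?_)
            exact (Polynomial.natDegree_smul_le _ _).trans (hG m).2.le
          · have h3 : (g - g.leadingCoeff • G m).coeff m = 0 := by
              rw [Polynomial.coeff_sub, Polynomial.coeff_smul, hG.coeff_self, smul_eq_mul, mul_one]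
              exact sub_self _
            exact h2 (Polynomial.leadingCoeff_eq_zero.1 (by rwa [Polynomial.leadingCoeff, he]))
        exact ih _ (by omega) (sub_mem hg (U.smul_mem _ (hS m hmem)))
      have := add_mem h1 (Submodule.smul_mem _ g.leadingCoeff
        (Submodule.subset_span (Set.mem_image_of_mem G hmem)))
      rwa [sub_add_cancel] at this
  · rw [Submodule.span_le]
    rintro _ ⟨p, hp, rfl⟩
    exact hS p hp

lemma IsMonicFamily.mem_span_inter (hG : IsMonicFamily G) {S : Set ℕ} {g : Polynomial F} {n : ℕ}
    (hg : g ∈ Submodule.span F (G '' S)) (hn : g.natDegree ≤ n) :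
    g ∈ Submodule.span F (G '' (S ∩ Set.Iic n)) := by
  rw [← hG.eq_span (U := Submodule.span F (G '' S) ⊓ Polynomial.degreeLE F n)]
  · refine ⟨hg, ?_⟩
    rw [SetLike.mem_coe, Polynomial.mem_degreeLE]
    exact Polynomial.natDegree_le_iff_degree_le.1 hn
  · rintro p ⟨hp, hpn⟩
    refine ⟨Submodule.subset_span ⟨p, hp, rfl⟩, ?_⟩
    rw [SetLike.mem_coe, Polynomial.mem_degreeLE, ← Polynomial.natDegree_le_iff_degree_le, (hG p).2]
    exact hpn
  · rintro g ⟨h1, h2⟩ h0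
    rw [SetLike.mem_coe, Polynomial.mem_degreeLE, ← Polynomial.natDegree_le_iff_degree_le] at h2
    exact ⟨hG.natDegree_mem h1 h0, h2⟩

end MonicFamily

/-! ### Staircases of lex-segment ideals and their generators. -/

/-- The boundary `p ↦ μ p` of a lex-segment ideal of finite colength: the monomials of the ideal
are the `x^p y^q` with `μ p ≤ q`. -/
structure Staircase where
  /-- The least exponent `q` with `x^p y^q` in the ideal. -/
  height : ℕ → ℕ
  -- The subtraction is truncated: the heights drop strictly while they are positive and then remain
  -- `0`. This encodes that `x^(p+1) y^(q-1)` is lexicographically larger than `x^p y^q`.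
  height_succ_le : ∀ p, height (p + 1) ≤ height p - 1

namespace Staircase

variable (s : Staircase)

/-- The degree of the generator with `x`-exponent `p`. -/
def deg (p : ℕ) : ℕ := p + s.height p

lemma height_anti : Antitone s.height :=
  antitone_nat_of_succ_le fun p => (s.height_succ_le p).trans (Nat.sub_le _ _)

lemma exists_height_eq_zero : ∃ p, s.height p = 0 := by
  have h (p : ℕ) : s.height p ≤ s.height 0 - p := by
    induction p with
    | zero => simp
    | succ p ih =>
      have := s.height_succ_le p
      omega
  exact ⟨s.height 0, by simpa using h (s.height 0)⟩

open Classical in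
/-- The initial degree of the ideal. -/
def width : ℕ := Nat.find s.exists_height_eq_zero

lemma height_eq_zero_iff {p : ℕ} : s.height p = 0 ↔ s.width ≤ p := by
  classical
  constructor
  · exact fun h => Nat.find_min' _ h
  · intro h
    have h1 : s.height s.width = 0 := Nat.find_spec s.exists_height_eq_zero
    exact Nat.le_zero.1 (h1 ▸ s.height_anti h)

lemma deg_of_width_le {p : ℕ} (h : s.width ≤ p) : s.deg p = p := by
  rw [deg, s.height_eq_zero_iff.2 h, add_zero]

lemma le_deg (p : ℕ) : p ≤ s.deg p := Nat.le_add_right _ _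

lemma deg_succ_le {p : ℕ} (h : p < s.width) : s.deg (p + 1) ≤ s.deg p := by
  have h1 := s.height_succ_le p
  have h2 : s.height p ≠ 0 := fun h0 => absurd (s.height_eq_zero_iff.1 h0) (not_le.2 h)
  rw [deg, deg]
  omega

lemma deg_anti {p q : ℕ} (hpq : p ≤ q) (hq : q ≤ s.width) : s.deg q ≤ s.deg p := by
  induction q, hpq using Nat.le_induction with
  | base => exact le_rfl
  | succ q hpq ih => exact (s.deg_succ_le hq).trans (ih (by omega))

lemma width_le_deg (p : ℕ) : s.width ≤ s.deg p := by
  rcases le_total p s.width with h | h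
  · have := s.deg_anti h le_rfl
    rwa [s.deg_of_width_le le_rfl] at this
  · exact h.trans (s.le_deg p)

/-- The monomial ideal with the given boundary. -/
def ideal (F : Type*) [Field F] : Ideal (MvPolynomial (Fin 2) F) :=
  Ideal.span ((fun a => monomial a (1 : F)) '' {a | s.height (a 0) ≤ a 1})

variable {F : Type*} [Field F]

lemma mem_ideal_iff {f : MvPolynomial (Fin 2) F} :
    f ∈ s.ideal F ↔ ∀ a ∈ f.support, s.height (a 0) ≤ a 1 := by
  rw [ideal, mem_ideal_span_monomial_image]
  refine forall₂_congr fun a _ => ⟨?_, fun h => ⟨a, h, le_rfl⟩⟩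
  rintro ⟨b, hb, hba⟩
  exact (s.height_anti (hba 0)).trans (le_trans hb (hba 1))

lemma monomial_mem_ideal_iff {a : Fin 2 →₀ ℕ} :
    monomial a (1 : F) ∈ s.ideal F ↔ s.height (a 0) ≤ a 1 := by
  classical
  rw [mem_ideal_iff]
  simp [support_monomial]

/-- Strict decrease of the heights makes every column up to the width contribute a generator. -/
lemma isMinGen_iff {a : Fin 2 →₀ ℕ} :
    IsMinGen (s.ideal F) a ↔ a 0 ≤ s.width ∧ a 1 = s.height (a 0) := by
  rw [IsMinGen]
  simp only [monomial_mem_ideal_iff]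
  constructor
  · rintro ⟨h1, h2⟩
    have h3 : a 1 = s.height (a 0) := by
      refine le_antisymm ?_ h1
      have := h2 (y := expo (a 0) (s.height (a 0))) (by simp) (fun i => by fin_cases i <;> simp [h1])
      simpa using this 1
    refine ⟨?_, h3⟩
    by_contra hlt
    rw [not_le] at hlt
    have h4 := s.height_eq_zero_iff.2 hlt.le
    have h5 := s.height_eq_zero_iff.2 le_rfl
    have := h2 (y := expo s.width 0) (by simp [h5])
      (fun i => by fin_cases i <;> simp [hlt.le])
    have h6 := this 0
    rw [expo_zero] at h6
    omega
  · rintro ⟨h1, h2⟩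
    refine ⟨h2.ge, fun b hb hba i => ?_⟩
    have h0 := hba 0
    have h01 := hba 1
    have hb0 : b 0 = a 0 := by
      by_contra hne
      have hlt : b 0 < a 0 := lt_of_le_of_ne h0 hne
      have h3 : s.height (b 0 + 1) ≤ s.height (b 0) - 1 := s.height_succ_le _
      have h4 := s.height_anti (show b 0 + 1 ≤ a 0 from hlt)
      have h5 : s.height (b 0) ≠ 0 := by
        rw [Ne, s.height_eq_zero_iff]
        omega
      omega
    fin_cases i
    · exact hb0.ge
    · change a 1 ≤ b 1
      rw [h2, ← hb0]
      exact hb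

lemma lex_lt_iff {a b : Fin 2 →₀ ℕ} (h : b.degree = a.degree) :
    b ≺[MonomialOrder.lex] a ↔ b 0 < a 0 := by
  rw [MonomialOrder.lex_lt_iff, Finsupp.Lex.lt_iff]
  rw [degree_eq_add, degree_eq_add] at h
  constructor
  · rintro ⟨i, hi, hlt⟩
    fin_cases i
    · exact hlt
    · have h1 : b 0 = a 0 := hi 0 (by decide)
      have h2 : b 1 < a 1 := hlt
      omega
  · exact fun hlt => ⟨0, fun j hj => absurd hj (by simp), hlt⟩

/-- In a fixed degree the order compares `x`-exponents, and a monomial of that degree with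
`x`-exponent `q` is outside the ideal iff the degree is below `s.deg q`. -/
lemma isTail_iff {p : ℕ} {b : Fin 2 →₀ ℕ} :
    IsTail (s.ideal F) (expo p (s.height p)) b ↔
      b 0 < p ∧ b.degree = s.deg p ∧ s.deg p < s.deg (b 0) := by
  rw [IsTail, monomial_mem_ideal_iff, degree_expo]
  change _ ∧ b.degree = s.deg p ∧ _ ↔ _
  constructor
  · rintro ⟨h1, h2, h3⟩
    rw [lex_lt_iff (by rw [h2, degree_expo]; rfl), expo_zero] at h3
    refine ⟨h3, h2, ?_⟩
    rw [← h2, degree_eq_add, deg]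
    omega
  · rintro ⟨h1, h2, h3⟩
    refine ⟨?_, h2, ?_⟩
    · rw [← h2, degree_eq_add, deg] at h3
      omega
    · rwa [lex_lt_iff (by rw [h2, degree_expo]; rfl), expo_zero]

end Staircase

end GroebnerCell

namespace GroebnerCell

open MvPolynomial

/-! ### Coordinates of the cell as families of monic polynomials. -/

namespace Staircase

variable (s : Staircase) {F : Type*} [Field F]

/-- Families of monic polynomials that are dehomogenized reduced Gröbner bases, continued by the
multiples of the generator of the initial degree. -/
structure IsReduced (G : ℕ → Polynomial F) : Prop where
  monic : IsMonicFamily G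
  coeff_eq_zero : ∀ p ≤ s.width, ∀ q < p, s.deg q ≤ s.deg p → (G p).coeff q = 0
  succ : ∀ p, s.width ≤ p → G (p + 1) = Polynomial.X * G p

/-- The span of the members of the family of degree at most `d`. -/
def levelSpan (G : ℕ → Polynomial F) (d : ℕ) : Submodule F (Polynomial F) :=
  Submodule.span F (G '' {p | s.deg p ≤ d})

/-- The syzygy condition, which makes the family a Gröbner basis. -/
def IsSyzygetic (G : ℕ → Polynomial F) : Prop :=
  ∀ p < s.width, Polynomial.X * G p ∈ s.levelSpan G (s.deg p + 1)

/-- The coordinate of the affine space given by the monomials with `x`-exponents `p` and `q`. -/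
def coord (F : Type*) [Field F] {p q : ℕ} (hp : p ≤ s.width) (hq : q < p)
    (hd : s.deg p < s.deg q) : CoordIndex (s.ideal F) :=
  ⟨(expo p (s.height p), expo q (s.deg p - q)), s.isMinGen_iff.2 (by simpa using hp),
    s.isTail_iff.2 (by
      have := s.le_deg p
      rw [expo_zero, degree_expo]
      exact ⟨hq, by omega, hd⟩)⟩

lemma cellGen_mem_homogeneousSubmodule (l : AffSpace (CoordIndex (s.ideal F)) F)
    (a : Fin 2 →₀ ℕ) : cellGen (s.ideal F) l a ∈ homogeneousSubmodule (Fin 2) F a.degree := by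
  rw [mem_homogeneousSubmodule]
  intro b hb
  rw [Pi.one_def, ← Finsupp.degree_eq_weight_one]
  by_cases h : IsMinGen (s.ideal F) a ∧ IsTail (s.ideal F) a b
  · exact h.2.2.1
  · rw [coeff_cellGen_of_not_tail l h, coeff_monomial] at hb
    rw [show a = b by by_contra hab; exact hb (if_neg hab)]

/-- The dehomogenized generators, continued by multiples of the one of the initial degree. -/
def family (l : AffSpace (CoordIndex (s.ideal F)) F) (p : ℕ) : Polynomial F :=
  Polynomial.X ^ (p - s.width) * dehomogenize
    (cellGen (s.ideal F) l (expo (min p s.width) (s.height (min p s.width))))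

variable (l : AffSpace (CoordIndex (s.ideal F)) F)

lemma family_of_le {p : ℕ} (hp : p ≤ s.width) :
    s.family l p = dehomogenize (cellGen (s.ideal F) l (expo p (s.height p))) := by
  rw [family, min_eq_left hp, Nat.sub_eq_zero_of_le hp, pow_zero, one_mul]

lemma family_succ {p : ℕ} (hp : s.width ≤ p) :
    s.family l (p + 1) = Polynomial.X * s.family l p := by
  rw [family, family, min_eq_right hp, min_eq_right (hp.trans (Nat.le_succ p)),
    Nat.succ_sub hp, pow_succ', mul_assoc]

lemma homogenizeTo_family {p : ℕ} (hp : p ≤ s.width) :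
    homogenizeTo (s.deg p) (s.family l p) = cellGen (s.ideal F) l (expo p (s.height p)) := by
  have := s.cellGen_mem_homogeneousSubmodule l (expo p (s.height p))
  rw [degree_expo] at this
  rw [s.family_of_le l hp]
  exact homogenizeTo_dehomogenize this

lemma coeff_family {p q : ℕ} (hp : p ≤ s.width) (hq : q ≤ s.deg p) :
    (s.family l p).coeff q =
      coeff (expo q (s.deg p - q)) (cellGen (s.ideal F) l (expo p (s.height p))) := by
  have := s.cellGen_mem_homogeneousSubmodule l (expo p (s.height p))
  rw [degree_expo] at this
  rw [s.family_of_le l hp]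
  exact coeff_dehomogenize this hq

lemma coeff_family_coord {p q : ℕ} (hp : p ≤ s.width) (hq : q < p) (hd : s.deg p < s.deg q) :
    (s.family l p).coeff q = - l (s.coord F hp hq hd) := by
  rw [s.coeff_family l hp (hq.le.trans (s.le_deg p))]
  exact coeff_cellGen_of_tail l (s.coord F hp hq hd).2

lemma coeff_family_of_not {p q : ℕ} (hp : p ≤ s.width) (h : ¬ (q < p ∧ s.deg p < s.deg q)) :
    (s.family l p).coeff q = if q = p then 1 else 0 := by
  by_cases hq : q ≤ s.deg p
  · rw [s.coeff_family l hp hq, coeff_cellGen_of_not_tail, coeff_monomial]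
    · congr 1
      rw [eq_iff_iff, expo_eq_iff, expo_zero, expo_one, deg]
      omega
    · rintro ⟨-, h2⟩
      rw [isTail_iff, expo_zero] at h2
      exact h ⟨h2.1, h2.2.2⟩
  · have h1 := s.cellGen_mem_homogeneousSubmodule l (expo p (s.height p))
    rw [degree_expo] at h1
    have h2 := natDegree_dehomogenize_le h1
    rw [← s.family_of_le l hp] at h2
    have := s.le_deg p
    rw [if_neg (by omega)]
    exact Polynomial.coeff_eq_zero_of_natDegree_lt (h2.trans_lt (not_le.1 hq))

lemma isReduced_family : s.IsReduced (s.family l) := by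
  refine ⟨fun p => ?_, fun p hp q hq hd => ?_, fun p hp => s.family_succ l hp⟩
  · have hle : ∀ p ≤ s.width, (s.family l p).Monic ∧ (s.family l p).natDegree = p := by
      intro p hp
      have h1 : (s.family l p).coeff p = 1 := by
        rw [s.coeff_family_of_not l hp (by simp), if_pos rfl]
      have h2 : (s.family l p).natDegree = p := by
        refine Polynomial.natDegree_eq_of_le_of_coeff_ne_zero ?_ (by rw [h1]; exact one_ne_zero)
        rw [Polynomial.natDegree_le_iff_coeff_eq_zero]
        intro N hN
        rw [s.coeff_family_of_not l hp (by omega), if_neg (by omega)]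
      exact ⟨by rw [Polynomial.Monic, Polynomial.leadingCoeff, h2, h1], h2⟩
    rcases le_total p s.width with hp | hp
    · exact hle p hp
    · induction p, hp using Nat.le_induction with
      | base => exact hle _ le_rfl
      | succ p hp ih =>
        rw [s.family_succ l hp]
        exact ⟨Polynomial.monic_X.mul ih.1, by rw [Polynomial.natDegree_X_mul ih.1.ne_zero, ih.2]⟩
  · rw [s.coeff_family_of_not l hp (by omega), if_neg (by omega)]

/-- The point of affine space given by the coefficients of a family. -/
def ofFamily (G : ℕ → Polynomial F) : AffSpace (CoordIndex (s.ideal F)) F :=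
  fun c => - (G (c.1.1 0)).coeff (c.1.2 0)

lemma exists_of_isMinGen {a : Fin 2 →₀ ℕ} (ha : IsMinGen (s.ideal F) a) :
    ∃ p ≤ s.width, a = expo p (s.height p) := by
  have ha' := s.isMinGen_iff.1 ha
  exact ⟨a 0, ha'.1, (expo_eq_iff.2 ⟨rfl, ha'.2.symm⟩).symm⟩

lemma exists_coord (c : CoordIndex (s.ideal F)) :
    ∃ (p q : ℕ) (hp : p ≤ s.width) (hq : q < p) (hd : s.deg p < s.deg q),
      c = s.coord F hp hq hd := by
  obtain ⟨⟨a, b⟩, ha, hb⟩ := c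
  obtain ⟨p, hp, rfl⟩ := s.exists_of_isMinGen ha
  have hb' := s.isTail_iff.1 hb
  refine ⟨p, b 0, hp, hb'.1, hb'.2.2, Subtype.ext (Prod.ext rfl ?_)⟩
  · have := hb'.2.1
    rw [degree_eq_add] at this
    change b 0 + b 1 = s.deg p at this
    change b = expo (b 0) (s.deg p - b 0)
    exact (expo_eq_iff.2 ⟨rfl, by omega⟩).symm

lemma ofFamily_coord (G : ℕ → Polynomial F) {p q : ℕ} (hp : p ≤ s.width) (hq : q < p)
    (hd : s.deg p < s.deg q) : s.ofFamily G (s.coord F hp hq hd) = - (G p).coeff q := by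
  simp [ofFamily, coord]

lemma ofFamily_family : s.ofFamily (s.family l) = l := by
  funext c
  obtain ⟨p, q, hp, hq, hd, rfl⟩ := s.exists_coord c
  rw [ofFamily_coord, s.coeff_family_coord l hp hq hd, neg_neg]

variable {s} in
lemma family_ofFamily {G : ℕ → Polynomial F} (hG : s.IsReduced G) :
    s.family (s.ofFamily G) = G := by
  have hle : ∀ p ≤ s.width, s.family (s.ofFamily G) p = G p := by
    intro p hp
    ext q
    by_cases h : q < p ∧ s.deg p < s.deg q
    · rw [s.coeff_family_coord _ hp h.1 h.2, ofFamily_coord, neg_neg]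
    · rw [s.coeff_family_of_not _ hp h]
      split_ifs with hqp
      · rw [hqp, hG.monic.coeff_self]
      · rcases lt_or_gt_of_ne hqp with h1 | h1
        · exact (hG.coeff_eq_zero p hp q h1 (by omega)).symm
        · exact (hG.monic.coeff_eq_zero h1).symm
  funext p
  rcases le_total p s.width with hp | hp
  · exact hle p hp
  · induction p, hp using Nat.le_induction with
    | base => exact hle _ le_rfl
    | succ p hp ih => rw [s.family_succ _ hp, hG.succ p hp, ih]

section LevelSpan

variable {s} {G : ℕ → Polynomial F}

lemma mem_levelSpan {p d : ℕ} (h : s.deg p ≤ d) : G p ∈ s.levelSpan G d :=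
  Submodule.subset_span ⟨p, h, rfl⟩

lemma levelSpan_mono : Monotone (s.levelSpan G) := fun _ _ h =>
  Submodule.span_mono (Set.image_mono fun _ hp => le_trans hp h)

lemma natDegree_le_of_mem_levelSpan (hG : IsMonicFamily G) {d : ℕ} {g : Polynomial F}
    (hg : g ∈ s.levelSpan G d) : g.natDegree ≤ d := by
  by_cases h0 : g = 0
  · simp [h0]
  · exact (s.le_deg _).trans (hG.natDegree_mem hg h0)

/-- Below the width this is the syzygy condition; from the width on, the product is the next member
of the family. -/
lemma X_mul_mem_levelSpan (hG : s.IsReduced G) (hs : s.IsSyzygetic G) {d : ℕ} {g : Polynomial F}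
    (hg : g ∈ s.levelSpan G d) : Polynomial.X * g ∈ s.levelSpan G (d + 1) := by
  suffices h : s.levelSpan G d ≤ (s.levelSpan G (d + 1)).comap mulX from h hg
  rw [levelSpan, Submodule.span_le]
  rintro _ ⟨p, hp, rfl⟩
  rw [Set.mem_ofPred_eq] at hp
  change Polynomial.X * G p ∈ s.levelSpan G (d + 1)
  rcases lt_or_ge p s.width with h | h
  · exact levelSpan_mono (Nat.succ_le_succ hp) (hs p h)
  · rw [← hG.succ p h]
    rw [s.deg_of_width_le h] at hp
    exact mem_levelSpan (by rw [s.deg_of_width_le (by omega)]; omega)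

/-- The homogenization of the level spans. -/
def homSpan (s : Staircase) (G : ℕ → Polynomial F) : Submodule F (MvPolynomial (Fin 2) F) :=
  ⨆ d, (s.levelSpan G d).map (homogenizeTo d)

lemma homogenizeTo_mem_homSpan {d : ℕ} {g : Polynomial F} (hg : g ∈ s.levelSpan G d) :
    homogenizeTo d g ∈ s.homSpan G :=
  Submodule.mem_iSup_of_mem d ⟨g, hg, rfl⟩

lemma X_mul_homogenizeTo {d : ℕ} {g : Polynomial F} (hg : g.natDegree ≤ d) (i : Fin 2) :
    X i * homogenizeTo d g = homogenizeTo (d + 1) (dehomogenize (X i) * g) := by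
  have h : X i * homogenizeTo d g ∈ homogeneousSubmodule (Fin 2) F (d + 1) := by
    rw [add_comm d 1]
    exact (isHomogeneous_X F i).mul (homogenizeTo_mem d g)
  rw [← homogenizeTo_dehomogenize h, map_mul, dehomogenize_homogenizeTo hg]

/-- Thus `homSpan` is stable under the ring: multiplication by `x` is `X_mul_mem_levelSpan`, and
multiplication by `y` is the inclusion of level `d` in level `d + 1`. -/
lemma mul_mem_homSpan (hG : s.IsReduced G) (hs : s.IsSyzygetic G) (f : MvPolynomial (Fin 2) F)
    {n : MvPolynomial (Fin 2) F} (hn : n ∈ s.homSpan G) : f * n ∈ s.homSpan G := by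
  induction f using MvPolynomial.induction_on generalizing n with
  | C c =>
    rw [← smul_eq_C_mul]
    exact Submodule.smul_mem _ _ hn
  | add f g hf hg =>
    rw [add_mul]
    exact add_mem (hf hn) (hg hn)
  | mul_X f i hf =>
    rw [mul_assoc]
    refine hf ?_
    clear hf f
    induction hn using Submodule.iSup_induction' with
    | mem d n hn =>
      obtain ⟨g, hg, rfl⟩ := hn
      rw [X_mul_homogenizeTo (natDegree_le_of_mem_levelSpan hG.monic hg)]
      refine homogenizeTo_mem_homSpan ?_
      fin_cases i
      · change dehomogenize (X 0) * g ∈ _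
        rw [dehomogenize_X_zero]
        exact X_mul_mem_levelSpan hG hs hg
      · change dehomogenize (X 1) * g ∈ _
        rw [dehomogenize_X_one, one_mul]
        exact levelSpan_mono (Nat.le_succ d) hg
    | zero => rw [mul_zero]; exact zero_mem _
    | add a b _ _ ha hb => rw [mul_add]; exact add_mem ha hb

lemma homogeneousComponent_mem_of_mem_homSpan {n : MvPolynomial (Fin 2) F}
    (hn : n ∈ s.homSpan G) (d : ℕ) :
    homogeneousComponent d n ∈ (s.levelSpan G d).map (homogenizeTo d) := by
  suffices h : s.homSpan G ≤ ((s.levelSpan G d).map (homogenizeTo d)).comap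
      (homogeneousComponent d) from h hn
  refine iSup_le fun e => ?_
  rintro _ ⟨g, hg, rfl⟩
  rw [Submodule.mem_comap, homogeneousComponent_of_mem (homogenizeTo_mem e g)]
  split_ifs with h
  · subst h
    exact ⟨g, hg, rfl⟩
  · exact zero_mem _

end LevelSpan

/-! ### Membership in the cell and the syzygy condition. -/

section Cell

variable {s}

/-- Among monomials of equal degree, the lexicographically largest is the one with the largest
`x`-exponent. -/
lemma degree_lex_zero_eq_natDegree {d : ℕ} {f : MvPolynomial (Fin 2) F}
    (hf : f ∈ homogeneousSubmodule (Fin 2) F d) (h0 : f ≠ 0) :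
    MonomialOrder.lex.degree f 0 = (dehomogenize f).natDegree ∧
      (MonomialOrder.lex.degree f).degree = d := by
  have hs := MonomialOrder.degree_mem_support (m := MonomialOrder.lex) h0
  set a := MonomialOrder.lex.degree f
  have had : a.degree = d := ((hf : f.IsHomogeneous d).degree_eq_sum_deg_support hs).symm
  have had' := had
  rw [degree_eq_add] at had'
  refine ⟨Eq.symm (Polynomial.natDegree_eq_of_le_of_coeff_ne_zero ?_ ?_), had⟩
  · rw [Polynomial.natDegree_le_iff_coeff_eq_zero]
    intro N hN
    by_cases hNd : N ≤ d
    · rw [coeff_dehomogenize hf hNd]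
      by_contra hc
      have h1 := MonomialOrder.le_degree (m := MonomialOrder.lex) (mem_support_iff.2 hc)
      refine absurd h1 (not_le.2 ((lex_lt_iff ?_).2 (by rwa [expo_zero])))
      rw [had, degree_expo]
      omega
    · exact Polynomial.coeff_eq_zero_of_natDegree_lt
        ((natDegree_dehomogenize_le hf).trans_lt (not_le.1 hNd))
  · rw [coeff_dehomogenize hf (by omega), (expo_eq_iff (a := a)).2 ⟨rfl, by omega⟩]
    exact mem_support_iff.1 hs

lemma deg_natDegree_le_of_mem_dehomPart {J : Ideal (MvPolynomial (Fin 2) F)}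
    (hJ : leadingIdeal J ≤ s.ideal F) {d : ℕ} {g : Polynomial F} (hg : g ∈ dehomPart J d)
    (h0 : g ≠ 0) : s.deg g.natDegree ≤ d := by
  obtain ⟨f, hf, rfl⟩ := hg
  rw [SetLike.mem_coe, mem_shiftedPart_zero] at hf
  have hf0 : f ≠ 0 := fun h => h0 (by rw [h, map_zero])
  obtain ⟨h1, h2⟩ := degree_lex_zero_eq_natDegree hf.2 hf0
  have h3 := s.monomial_mem_ideal_iff.1 (hJ (monomial_degree_mem_leadingIdeal hf.1 hf0))
  change s.deg (dehomogenize f).natDegree ≤ d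
  rw [degree_eq_add] at h2
  rw [← h1, deg]
  omega

lemma family_mem_dehomPart (l : AffSpace (CoordIndex (s.ideal F)) F) {p d : ℕ}
    (h : s.deg p ≤ d) : s.family l p ∈ dehomPart (cellIdeal (s.ideal F) l) d := by
  set m := min p s.width with hm
  have hmw : m ≤ s.width := min_le_right _ _
  have hle : (p - m) + s.deg m ≤ d := by
    rcases le_total p s.width with hp | hp
    · rw [hm, min_eq_left hp]
      omega
    · rw [hm, min_eq_right hp, s.deg_of_width_le le_rfl]
      rw [s.deg_of_width_le hp] at h
      omega
  have hpm : p - m = p - s.width := by omega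
  set f := cellGen (s.ideal F) l (expo m (s.height m)) with hf
  have h1 := s.cellGen_mem_homogeneousSubmodule l (expo m (s.height m))
  rw [degree_expo] at h1
  -- The power of `x` accounts for indices beyond the width; the power of `y` fills up the degree
  -- and disappears under `y ↦ 1`.
  refine ⟨X 0 ^ (p - m) * X 1 ^ (d - (p - m) - s.deg m) * f, ?_, ?_⟩
  · rw [SetLike.mem_coe, mem_shiftedPart_zero]
    refine ⟨Ideal.mul_mem_left _ _ (Ideal.subset_span ⟨_, ?_, rfl⟩), ?_⟩
    · exact s.isMinGen_iff.2 (by simpa using hmw)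
    · have h2 := ((isHomogeneous_X_pow (R := F) (0 : Fin 2) (p - m)).mul
        (isHomogeneous_X_pow (1 : Fin 2) (d - (p - m) - s.deg m))).mul h1
      have h3 : p - m + (d - (p - m) - s.deg m) + (m + s.height m) = d := by
        change _ + s.deg m = d
        omega
      rwa [h3] at h2
  · change dehomogenize _ = _
    rw [map_mul, map_mul, map_pow, map_pow, dehomogenize_X_zero, dehomogenize_X_one, one_pow,
      mul_one, hpm]
    rfl

/-- The initial ideal bounds the degrees that occur, and the family realizes each of them, so
`IsMonicFamily.eq_span` applies. -/
lemma dehomPart_cellIdeal {l : AffSpace (CoordIndex (s.ideal F)) F}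
    (hl : cellIdeal (s.ideal F) l ∈ cell (s.ideal F)) (d : ℕ) :
    dehomPart (cellIdeal (s.ideal F) l) d = s.levelSpan (s.family l) d :=
  (s.isReduced_family l).monic.eq_span (fun _ hp => family_mem_dehomPart l hp)
    fun _ hg h0 => deg_natDegree_le_of_mem_dehomPart hl.1.le hg h0

lemma isSyzygetic_of_mem_cell {l : AffSpace (CoordIndex (s.ideal F)) F}
    (hl : cellIdeal (s.ideal F) l ∈ cell (s.ideal F)) : s.IsSyzygetic (s.family l) := by
  intro p _
  rw [← dehomPart_cellIdeal hl]
  obtain ⟨f, hf, h⟩ := family_mem_dehomPart l (le_refl (s.deg p))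
  refine ⟨X 0 * f, X_mul_mem_shiftedPart _ hf 0, ?_⟩
  change dehomogenize (X 0 * f) = _
  rw [map_mul, dehomogenize_X_zero]
  exact congrArg _ h

-- This is the Buchberger criterion. The syzygies place the ideal inside `homSpan`, where every
-- homogeneous component is a combination of `G p` with `s.deg p` at most its degree, so no leading
-- monomial falls outside the staircase.
attribute [local instance] MvPolynomial.gradedAlgebra in
lemma mem_cell_of_isSyzygetic {l : AffSpace (CoordIndex (s.ideal F)) F}
    (hs : s.IsSyzygetic (s.family l)) : cellIdeal (s.ideal F) l ∈ cell (s.ideal F) := by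
  have hG := s.isReduced_family l
  have hhom : IsHomogeneousIdeal (cellIdeal (s.ideal F) l) := by
    refine Ideal.homogeneous_span _ _ ?_
    rintro _ ⟨a, -, rfl⟩
    exact ⟨_, s.cellGen_mem_homogeneousSubmodule l a⟩
  refine ⟨le_antisymm ?_ ?_, hhom⟩
  · have hle : ∀ f ∈ cellIdeal (s.ideal F) l, f ∈ s.homSpan (s.family l) := by
      intro f hf
      induction hf using Submodule.span_induction with
      | mem f hf =>
        obtain ⟨a, ha, rfl⟩ := hf
        obtain ⟨p, hp, rfl⟩ := s.exists_of_isMinGen ha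
        rw [← s.homogenizeTo_family l hp]
        exact homogenizeTo_mem_homSpan (mem_levelSpan le_rfl)
      | zero => exact zero_mem _
      | add f g _ _ hf hg => exact add_mem hf hg
      | smul a f _ hf => exact mul_mem_homSpan hG hs a hf
    rw [leadingIdeal, Ideal.span_le]
    rintro _ ⟨f, hf, rfl⟩
    by_cases h0 : f = 0
    · rw [h0, MonomialOrder.leadingTerm_zero]
      exact zero_mem _
    set a := MonomialOrder.lex.degree f with ha
    have hc : coeff a f ≠ 0 :=
      mem_support_iff.1 (MonomialOrder.degree_mem_support (m := MonomialOrder.lex) h0)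
    obtain ⟨g, hg, hgf⟩ := homogeneousComponent_mem_of_mem_homSpan (hle f hf) a.degree
    have hgcoeff (b : Fin 2 →₀ ℕ) (hb : b.degree = a.degree) : g.coeff (b 0) = coeff b f := by
      have := congrArg (coeff b) hgf
      rwa [coeff_homogenizeTo, coeff_homogeneousComponent, if_pos hb, if_pos hb] at this
    have hgdeg := natDegree_le_of_mem_levelSpan hG.monic hg
    have hgn : g.natDegree = a 0 := by
      refine Polynomial.natDegree_eq_of_le_of_coeff_ne_zero ?_ (by rwa [hgcoeff a rfl])
      rw [Polynomial.natDegree_le_iff_coeff_eq_zero]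
      intro N hN
      by_cases hNd : N ≤ a.degree
      · by_contra hc
        have hdeg : (expo N (a.degree - N)).degree = a.degree := by
          rw [degree_expo]
          omega
        have h1 := hgcoeff (expo N (a.degree - N)) hdeg
        rw [expo_zero] at h1
        rw [h1] at hc
        have h2 := MonomialOrder.le_degree (m := MonomialOrder.lex) (mem_support_iff.2 hc)
        exact absurd h2 (not_le.2 ((lex_lt_iff hdeg.symm).2 (by rwa [expo_zero])))
      · exact Polynomial.coeff_eq_zero_of_natDegree_lt (hgdeg.trans_lt (not_le.1 hNd))
    have hg0 : g ≠ 0 := by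
      rintro rfl
      exact hc ((hgcoeff a rfl).symm.trans (Polynomial.coeff_zero _))
    have h3 : s.deg g.natDegree ≤ a.degree := hG.monic.natDegree_mem hg hg0
    rw [hgn, deg, degree_eq_add] at h3
    rw [MonomialOrder.leadingTerm, SetLike.mem_coe, mem_ideal_iff]
    intro b hb
    rw [Finset.mem_singleton.1 (support_monomial_subset hb), ← ha]
    omega
  · refine Ideal.span_le.2 ?_
    rintro _ ⟨c, hc, rfl⟩
    rw [Set.mem_ofPred_eq] at hc
    have hcd : s.deg (c 0) ≤ c.degree := by
      rw [deg, degree_eq_add]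
      omega
    -- Conversely, `G (c 0)` homogenized to the degree of `c` lies in the ideal and has leading
    -- monomial `c`.
    obtain ⟨f, hf, hfc⟩ := family_mem_dehomPart l hcd
    rw [SetLike.mem_coe, mem_shiftedPart_zero] at hf
    have hf0 : f ≠ 0 := by
      rintro rfl
      rw [map_zero] at hfc
      exact (hG.monic (c 0)).1.ne_zero hfc.symm
    have h1 := monomial_degree_mem_leadingIdeal hf.1 hf0
    obtain ⟨h2, h3⟩ := degree_lex_zero_eq_natDegree hf.2 hf0
    have h4 : MonomialOrder.lex.degree f = c := by
      have h5 : (dehomogenize f).natDegree = c 0 :=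
        (congrArg Polynomial.natDegree hfc).trans (hG.monic (c 0)).2
      rw [degree_eq_add, degree_eq_add] at h3
      exact ext_two (h2.trans h5) (by omega)
    rwa [h4] at h1

theorem mem_points_cell_iff {l : AffSpace (CoordIndex (s.ideal F)) F} :
    l ∈ points (s.ideal F) (cell (s.ideal F)) ↔ s.IsSyzygetic (s.family l) :=
  ⟨isSyzygetic_of_mem_cell, mem_cell_of_isSyzygetic⟩

end Cell

end Staircase

end GroebnerCell

namespace GroebnerCell

open MvPolynomial

namespace Staircase

/-! ### The syzygies, and the growth of the ideal as a matrix rank. -/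

section Relations

variable {s : Staircase} {F : Type*} [Field F] {G : ℕ → Polynomial F}

/-- The indices of the members of the family that occur in the `p`-th syzygy. -/
def relIndex (s : Staircase) (p : ℕ) : Finset ℕ :=
  (Finset.range (p + 1)).filter fun q => s.deg q = s.deg p ∨ s.deg q = s.deg p + 1

lemma mem_relIndex {p q : ℕ} :
    q ∈ s.relIndex p ↔ q ≤ p ∧ (s.deg q = s.deg p ∨ s.deg q = s.deg p + 1) := by
  rw [relIndex, Finset.mem_filter, Finset.mem_range, Nat.lt_succ_iff]

/-- The coefficients of the `p`-th syzygy. -/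
def relCoeff (s : Staircase) (G : ℕ → Polynomial F) (p q : ℕ) : F :=
  if s.deg q = s.deg p then (Polynomial.X * G p - G (p + 1)).coeff q else
    (Polynomial.X * G p - G (p + 1) -
      ∑ i ∈ (Finset.range (p + 1)).filter (fun i => s.deg i = s.deg p),
        Polynomial.C ((Polynomial.X * G p - G (p + 1)).coeff i) * G i).coeff q

lemma IsReduced.coeff_eq_ite (hG : s.IsReduced G) {p q : ℕ} (hp : p ≤ s.width)
    (h : s.deg q ≤ s.deg p) : (G p).coeff q = if q = p then 1 else 0 := by
  split_ifs with hqp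
  · rw [hqp, hG.monic.coeff_self]
  · rcases lt_or_gt_of_ne hqp with h1 | h1
    · exact hG.coeff_eq_zero p hp q h1 h
    · exact hG.monic.coeff_eq_zero h1

/-- By reducedness the coefficient of `G k` at `q ≠ k` vanishes if `s.deg q ≤ s.deg k`. So the
coefficients at indices of degree `s.deg p` are read off directly, and those of degree `s.deg p + 1`
after the former terms are subtracted. The syzygy is thus unique and polynomial in the family. -/
lemma relCoeff_eq (hG : s.IsReduced G) {p : ℕ} (hp : p < s.width) {c : ℕ → F}
    (h : Polynomial.X * G p - G (p + 1) = ∑ q ∈ s.relIndex p, c q • G q) {q : ℕ}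
    (hq : q ∈ s.relIndex p) : s.relCoeff G p q = c q := by
  have hlin : ∀ i ∈ s.relIndex p, s.deg i = s.deg p →
      (Polynomial.X * G p - G (p + 1)).coeff i = c i := by
    intro i hi hid
    rw [h, Polynomial.finsetSum_coeff, Finset.sum_eq_single i]
    · rw [Polynomial.coeff_smul, hG.monic.coeff_self, smul_eq_mul, mul_one]
    · intro k hk hki
      rw [mem_relIndex] at hk
      rw [Polynomial.coeff_smul, hG.coeff_eq_ite (by omega) (by omega), if_neg hki.symm, smul_zero]
    · exact fun hn => absurd hi hn
  rw [relCoeff]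
  split_ifs with hqd
  · exact hlin q hq hqd
  · have hfil : (Finset.range (p + 1)).filter (fun i => s.deg i = s.deg p) =
        (s.relIndex p).filter (fun i => s.deg i = s.deg p) := by
      ext i
      simp only [relIndex, Finset.mem_filter, Finset.mem_range]
      tauto
    have hsum : ∑ i ∈ (Finset.range (p + 1)).filter (fun i => s.deg i = s.deg p),
        Polynomial.C ((Polynomial.X * G p - G (p + 1)).coeff i) * G i =
        ∑ i ∈ (s.relIndex p).filter (fun i => s.deg i = s.deg p), c i • G i := by
      rw [hfil]
      refine Finset.sum_congr rfl fun i hi => ?_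
      rw [Finset.mem_filter] at hi
      rw [hlin i hi.1 hi.2, Polynomial.smul_eq_C_mul]
    have hsplit := Finset.sum_filter_add_sum_filter_not (s.relIndex p)
      (fun i => s.deg i = s.deg p) (fun i => c i • G i)
    rw [hsum, h, ← hsplit, add_sub_cancel_left, Polynomial.finsetSum_coeff,
      Finset.sum_eq_single q]
    · rw [Polynomial.coeff_smul, hG.monic.coeff_self, smul_eq_mul, mul_one]
    · intro k hk hkq
      rw [Finset.mem_filter, mem_relIndex] at hk
      rw [mem_relIndex] at hq
      rw [Polynomial.coeff_smul, hG.coeff_eq_ite (by omega) (by omega), if_neg hkq.symm, smul_zero]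
    · exact fun hn => absurd (Finset.mem_filter.2 ⟨hq, hqd⟩) hn

lemma IsMonicFamily_natDegree_sub_le (hG : IsMonicFamily G) (p : ℕ) :
    (Polynomial.X * G p - G (p + 1)).natDegree ≤ p := by
  rw [Polynomial.natDegree_le_iff_coeff_eq_zero]
  intro N hN
  obtain ⟨N, rfl⟩ := Nat.exists_eq_succ_of_ne_zero (by omega : N ≠ 0)
  rw [Polynomial.coeff_sub, Polynomial.coeff_X_mul]
  rcases (Nat.lt_succ_iff.1 hN).eq_or_lt with rfl | h
  · rw [hG.coeff_self, hG.coeff_self, sub_self]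
  · rw [hG.coeff_eq_zero h, hG.coeff_eq_zero (Nat.succ_lt_succ h), sub_zero]

/-- The leading terms cancel, so only `q ≤ p` occur; as degrees decrease along the staircase this
gives `s.deg q ≥ s.deg p`, while the level bounds it by `s.deg p + 1`. -/
lemma exists_relation (hG : s.IsReduced G) (hs : s.IsSyzygetic G) {p : ℕ} (hp : p < s.width) :
    ∃ c : ℕ → F, Polynomial.X * G p - G (p + 1) = ∑ q ∈ s.relIndex p, c q • G q := by
  have h1 : Polynomial.X * G p - G (p + 1) ∈ s.levelSpan G (s.deg p + 1) :=
    sub_mem (hs p hp) (mem_levelSpan ((s.deg_succ_le hp).trans (Nat.le_succ _)))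
  have h2 := hG.monic.mem_span_inter h1 (IsMonicFamily_natDegree_sub_le hG.monic p)
  have h3 : {q | s.deg q ≤ s.deg p + 1} ∩ Set.Iic p = (s.relIndex p : Set ℕ) := by
    ext q
    rw [Finset.mem_coe, mem_relIndex]
    constructor
    · rintro ⟨hq1, hq2⟩
      have := s.deg_anti hq2 hp.le
      rw [Set.mem_ofPred_eq] at hq1
      exact ⟨hq2, by omega⟩
    · rintro ⟨hq1, hq2⟩
      exact ⟨by rw [Set.mem_ofPred_eq]; omega, hq1⟩
  rw [h3, Submodule.mem_span_image_finset_iff_exists_fun] at h2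
  obtain ⟨c, hc⟩ := h2
  refine ⟨fun q => if h : q ∈ s.relIndex p then c ⟨q, h⟩ else 0, ?_⟩
  rw [← hc, ← Finset.sum_coe_sort (s.relIndex p)]
  exact Finset.sum_congr rfl fun q _ => by simp

lemma relation (hG : s.IsReduced G) (hs : s.IsSyzygetic G) {p : ℕ} (hp : p < s.width) :
    Polynomial.X * G p - G (p + 1) = ∑ q ∈ s.relIndex p, s.relCoeff G p q • G q := by
  obtain ⟨c, hc⟩ := exists_relation hG hs hp
  rw [hc]
  exact Finset.sum_congr rfl fun q hq => by rw [relCoeff_eq hG hp hc hq]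

/-- The syzygies of degree `j`. -/
abbrev Rows (s : Staircase) (j : ℕ) : Type := {p : Fin s.width // s.deg p + 1 = j}

/-- The generators of degree `j` other than the one with the largest `x`-exponent. -/
abbrev Cols (s : Staircase) (j : ℕ) : Type := {q : Fin s.width // s.deg q = j}

/-- The part of the syzygy matrix that consists of constants, in degree `j`. -/
def relMatrix (s : Staircase) (G : ℕ → Polynomial F) (j : ℕ) : Matrix (s.Rows j) (s.Cols j) F :=
  Matrix.of fun p q => s.relCoeff G p.1 q.1

lemma sum_cols {M : Type*} [AddCommMonoid M] (j : ℕ) (f : ℕ → M) :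
    ∑ q : s.Cols j, f q.1 = ∑ q ∈ (Finset.range s.width).filter (fun q => s.deg q = j), f q := by
  rw [Finset.sum_filter, ← Fin.sum_univ_eq_sum_range (fun q => if s.deg q = j then f q else 0),
    ← Finset.sum_filter]
  exact (Finset.sum_subtype _ (by simp) fun q : Fin s.width => f q).symm

/-- The combinations of the members of the family of degree `j`. -/
def colMap (s : Staircase) (G : ℕ → Polynomial F) (j : ℕ) : (s.Cols j → F) →ₗ[F] Polynomial F :=
  Fintype.linearCombination F fun q : s.Cols j => G q.1

/-- Modulo the level of `G p`, the product `X * G p` is the combination given by a row of the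
constant matrix. -/
lemma colMap_row (hG : s.IsReduced G) (hs : s.IsSyzygetic G) {j : ℕ} (p : s.Rows j) :
    ∃ g ∈ s.levelSpan G (s.deg p.1),
      Polynomial.X * G p.1 = g + s.colMap G j ((s.relMatrix G j).row p) := by
  obtain ⟨⟨p, hp⟩, rfl⟩ := p
  have h := relation hG hs hp
  rw [← Finset.sum_filter_add_sum_filter_not _ (fun q => s.deg q = s.deg p)] at h
  refine ⟨G (p + 1) + ∑ q ∈ (s.relIndex p).filter (fun q => s.deg q = s.deg p),
    s.relCoeff G p q • G q, add_mem (mem_levelSpan (s.deg_succ_le hp)) ?_, ?_⟩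
  · refine sum_mem fun q hq => Submodule.smul_mem _ _ (mem_levelSpan ?_)
    exact (Finset.mem_filter.1 hq).2.le
  · have h1 : s.colMap G (s.deg p + 1)
        ((s.relMatrix G (s.deg p + 1)).row ⟨⟨p, hp⟩, rfl⟩) =
        ∑ q ∈ (Finset.range s.width).filter (fun q => s.deg q = s.deg p + 1),
          s.relCoeff G p q • G q := by
      rw [← sum_cols]
      rfl
    have h2 : (Finset.range s.width).filter (fun q => s.deg q = s.deg p + 1) =
        (s.relIndex p).filter (fun q => ¬ s.deg q = s.deg p) := by
      ext q
      simp only [Finset.mem_filter, mem_relIndex, Finset.mem_range]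
      constructor
      · rintro ⟨h3, h4⟩
        refine ⟨⟨?_, .inr h4⟩, by omega⟩
        by_contra hlt
        have := s.deg_anti (not_le.1 hlt).le h3.le
        omega
      · rintro ⟨⟨h3, h4⟩, h5⟩
        exact ⟨by omega, by tauto⟩
    change Polynomial.X * G p = _ + s.colMap G (s.deg p + 1) _
    rw [h1, h2, add_assoc, ← h]
    ring

lemma colMap_injective (hG : IsMonicFamily G) (j : ℕ) : Function.Injective (s.colMap G j) :=
  (hG.linearIndependent.comp (fun q : s.Cols j => (q.1 : ℕ))
    (Fin.val_injective.comp Subtype.val_injective)).fintypeLinearCombination_injective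

/-- The indices of the members of the family of degree at most `d`. -/
def levelSet (s : Staircase) (d : ℕ) : Finset ℕ :=
  (Finset.range (d + 1)).filter fun p => s.deg p ≤ d

lemma mem_levelSet {d p : ℕ} : p ∈ s.levelSet d ↔ s.deg p ≤ d := by
  rw [levelSet, Finset.mem_filter, Finset.mem_range]
  have := s.le_deg p
  omega

lemma levelSpan_eq (d : ℕ) : s.levelSpan G d = Submodule.span F (G '' (s.levelSet d)) := by
  rw [levelSpan]
  congr 2
  ext p
  exact mem_levelSet.symm

lemma finrank_levelSpan (hG : IsMonicFamily G) (d : ℕ) :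
    Module.finrank F (s.levelSpan G d) = (s.levelSet d).card := by
  rw [levelSpan_eq, hG.finrank_span]

/-- The members of the family of degree at most `d + 1` that are obtained from `R₁ I_d` without
using the syzygies. -/
def growthSet (s : Staircase) (d : ℕ) : Finset ℕ :=
  s.levelSet d ∪ if s.width ≤ d then {d + 1} else ∅

lemma card_growthSet (d : ℕ) :
    (s.growthSet d).card = (s.levelSet d).card + if s.width ≤ d then 1 else 0 := by
  rw [growthSet, Finset.card_union_of_disjoint]
  · split_ifs <;> rfl
  · split_ifs
    · rw [Finset.disjoint_singleton_right, mem_levelSet]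
      have := s.le_deg (d + 1)
      omega
    · exact Finset.disjoint_empty_right _

/-- Multiplying level `d` by `X` adds only two things: `G (d + 1)` once `d` has reached the width,
and the rows of the constant matrix. -/
lemma levelSpan_sup_eq (hG : s.IsReduced G) (hs : s.IsSyzygetic G) (d : ℕ) :
    s.levelSpan G d ⊔ (s.levelSpan G d).map mulX =
      Submodule.span F (G '' (s.growthSet d)) ⊔
        (Submodule.span F (Set.range (s.relMatrix G (d + 1)).row)).map (s.colMap G (d + 1)) := by
  have hle : s.levelSpan G d ≤ Submodule.span F (G '' (s.growthSet d)) := by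
    rw [levelSpan_eq]
    refine Submodule.span_mono (Set.image_mono ?_)
    exact_mod_cast Finset.subset_union_left
  apply le_antisymm
  · refine sup_le (hle.trans le_sup_left) ?_
    rw [levelSpan, Submodule.map_span_le]
    rintro _ ⟨p, hp, rfl⟩
    rw [Set.mem_ofPred_eq] at hp
    rw [mulX_apply]
    rcases lt_or_ge p s.width with h | h
    · rcases hp.lt_or_eq with hlt | heq
      · exact Submodule.mem_sup_left (hle (levelSpan_mono hlt (hs p h)))
      · obtain ⟨g, hg, hgp⟩ := colMap_row hG hs
          (⟨⟨p, h⟩, congrArg (· + 1) heq⟩ : s.Rows (d + 1))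
        change Polynomial.X * G p = _ at hgp
        rw [hgp]
        exact Submodule.add_mem_sup (hle (levelSpan_mono hp hg))
          (Submodule.mem_map_of_mem (Submodule.subset_span ⟨_, rfl⟩))
    · rw [← hG.succ p h]
      refine Submodule.mem_sup_left (Submodule.subset_span ⟨p + 1, ?_, rfl⟩)
      rw [s.deg_of_width_le h] at hp
      rw [Finset.mem_coe, growthSet, Finset.mem_union, if_pos (h.trans hp), mem_levelSet,
        s.deg_of_width_le (by omega), Finset.mem_singleton]
      omega
  · refine sup_le ?_ ?_
    · rw [Submodule.span_le]
      rintro _ ⟨p, hp, rfl⟩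
      rw [Finset.mem_coe, growthSet, Finset.mem_union] at hp
      rcases hp with hp | hp
      · exact Submodule.mem_sup_left (mem_levelSpan (mem_levelSet.1 hp))
      · split_ifs at hp with hd
        · rw [Finset.mem_singleton] at hp
          rw [hp, hG.succ d hd]
          exact Submodule.mem_sup_right ⟨G d, mem_levelSpan (s.deg_of_width_le hd).le, rfl⟩
        · exact absurd hp (Finset.notMem_empty _)
    · rw [Submodule.map_span_le]
      rintro _ ⟨p, rfl⟩
      obtain ⟨g, hg, hgp⟩ := colMap_row hG hs p
      have hpd : s.deg p.1 = d := Nat.succ_injective p.2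
      rw [hpd] at hg
      rw [← sub_eq_iff_eq_add'] at hgp
      rw [← hgp]
      exact sub_mem (Submodule.mem_sup_right ⟨G p.1, mem_levelSpan hpd.le, rfl⟩)
        (Submodule.mem_sup_left hg)

/-- The two summands use disjoint sets of members of a linearly independent family, so dimensions
add, and the second has the dimension of the row space. -/
lemma finrank_levelSpan_sup (hG : s.IsReduced G) (hs : s.IsSyzygetic G) (d : ℕ) :
    Module.finrank F (s.levelSpan G d ⊔ (s.levelSpan G d).map mulX : Submodule F _) =
      (s.levelSet d).card + (if s.width ≤ d then 1 else 0) + (s.relMatrix G (d + 1)).rank := by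
  have hdisj : Disjoint (Submodule.span F (G '' (s.growthSet d)))
      ((Submodule.span F (Set.range (s.relMatrix G (d + 1)).row)).map (s.colMap G (d + 1))) := by
    have h1 : Disjoint (s.growthSet d : Set ℕ) {q | q < s.width ∧ s.deg q = d + 1} := by
      rw [Set.disjoint_left]
      rintro q hq ⟨hq1, hq2⟩
      rw [Finset.mem_coe, growthSet, Finset.mem_union, mem_levelSet] at hq
      rcases hq with hq | hq
      · omega
      · split_ifs at hq
        · rw [Finset.mem_singleton] at hq
          omega
        · exact Finset.notMem_empty _ hq
    refine (hG.monic.linearIndependent.disjoint_span_image h1).mono_right ?_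
    rintro _ ⟨c, -, rfl⟩
    rw [colMap, Fintype.linearCombination_apply]
    exact sum_mem fun q _ => Submodule.smul_mem _ _
      (Submodule.subset_span ⟨q.1, ⟨q.1.2, q.2⟩, rfl⟩)
  have hfin : Module.Finite F (Submodule.span F (G '' (s.growthSet d))) :=
    Module.Finite.span_of_finite F ((Finset.finite_toSet _).image _)
  have := Submodule.finrank_sup_add_finrank_inf_eq (Submodule.span F (G '' (s.growthSet d)))
    ((Submodule.span F (Set.range (s.relMatrix G (d + 1)).row)).map (s.colMap G (d + 1)))
  rw [hdisj.eq_bot, finrank_bot, add_zero, hG.monic.finrank_span, card_growthSet] at this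
  rw [levelSpan_sup_eq hG hs, this, Matrix.rank_eq_finrank_span_row,
    finrank_map_of_forall _ _ fun x _ hx =>
      colMap_injective hG.monic _ (hx.trans (map_zero _).symm)]

end Relations

/-! ### Betti numbers from the staircase. -/

section Betti

variable (s : Staircase)

/-- The number of generators of degree `j` of the monomial ideal. -/
def numGens (j : ℕ) : ℕ := Fintype.card (s.Cols j) + if s.width = j then 1 else 0

lemma card_cols (j : ℕ) :
    Fintype.card (s.Cols j) = ((Finset.range s.width).filter (fun q => s.deg q = j)).card := by
  rw [Fintype.card_eq_sum_ones, Finset.card_eq_sum_ones]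
  exact sum_cols j fun _ => 1

lemma card_rows_succ (j : ℕ) : Fintype.card (s.Rows (j + 1)) = Fintype.card (s.Cols j) :=
  Fintype.card_congr (Equiv.subtypeEquivRight fun _ => Nat.succ_inj)

instance isEmpty_rows_zero : IsEmpty (s.Rows 0) := ⟨fun p => Nat.succ_ne_zero _ p.2⟩

lemma card_levelSet_succ (d : ℕ) :
    (s.levelSet (d + 1)).card = (s.levelSet d).card + Fintype.card (s.Cols (d + 1)) +
      if s.width ≤ d + 1 then 1 else 0 := by
  have h : s.levelSet (d + 1) = s.levelSet d ∪
      ((Finset.range s.width).filter (fun q => s.deg q = d + 1) ∪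
        if s.width ≤ d + 1 then {d + 1} else ∅) := by
    ext q
    rw [Finset.mem_union, Finset.mem_union, mem_levelSet, mem_levelSet, Finset.mem_filter,
      Finset.mem_range]
    have h1 : (q ∈ if s.width ≤ d + 1 then ({d + 1} : Finset ℕ) else ∅) ↔
        s.width ≤ d + 1 ∧ q = d + 1 := by
      split_ifs with h <;> simp [h]
    rw [h1]
    rcases lt_or_ge q s.width with hq | hq
    · omega
    · rw [s.deg_of_width_le hq]
      omega
  rw [h, Finset.card_union_of_disjoint, Finset.card_union_of_disjoint, card_cols]
  · split_ifs <;> simp [add_assoc]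
  · split_ifs
    · rw [Finset.disjoint_singleton_right, Finset.mem_filter, Finset.mem_range]
      omega
    · exact Finset.disjoint_empty_right _
  · rw [Finset.disjoint_left]
    intro q hq
    rw [mem_levelSet] at hq
    rw [Finset.mem_union, Finset.mem_filter]
    split_ifs
    · rw [Finset.mem_singleton]
      have := s.le_deg q
      omega
    · simp
      omega

lemma card_cols_zero : Fintype.card (s.Cols 0) = 0 := by
  rw [Fintype.card_eq_zero_iff]
  refine ⟨fun q => ?_⟩
  have h1 := s.width_le_deg q.1
  have h2 := q.1.2
  have h3 := q.2
  omega

lemma card_levelSet_zero : (s.levelSet 0).card = if s.width ≤ 0 then 1 else 0 := by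
  have h : s.levelSet 0 = if s.width ≤ 0 then {0} else ∅ := by
    ext q
    rw [mem_levelSet]
    have h1 := s.width_le_deg q
    have h2 := s.le_deg q
    split_ifs with h
    · rw [Finset.mem_singleton]
      rw [s.deg_of_width_le (by omega)]
      omega
    · simp
      omega
  rw [h]
  split_ifs <;> rfl

lemma card_levelSet_ne_zero {d : ℕ} (h : s.width ≤ d) : (s.levelSet d).card ≠ 0 :=
  Finset.card_ne_zero_of_mem (mem_levelSet.2 ((s.deg_of_width_le le_rfl).le.trans h))

variable {s} {F : Type*} [Field F]

/-- The number of generators of an ideal in the cell. -/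
theorem bettiNumber_add_rank {l : AffSpace (CoordIndex (s.ideal F)) F}
    (hl : l ∈ points (s.ideal F) (cell (s.ideal F))) (j : ℕ) :
    bettiNumber (cellIdeal (s.ideal F) l) 0 j + (s.relMatrix (s.family l) j).rank =
      s.numGens j := by
  have hG := s.isReduced_family l
  have hs := isSyzygetic_of_mem_cell hl
  have hhilb (d : ℕ) : hilbertFunction (cellIdeal (s.ideal F) l) d = (s.levelSet d).card := by
    rw [← finrank_dehomPart, dehomPart_cellIdeal hl, finrank_levelSpan hG.monic]
  cases j with
  | zero =>
    have hr : (s.relMatrix (s.family l) 0).rank = 0 :=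
      Nat.le_zero.1 ((Matrix.rank_le_card_height _).trans (Fintype.card_eq_zero).le)
    rw [hr, bettiNumber_zero_zero, hhilb, card_levelSet_zero, numGens, card_cols_zero]
    simp
  | succ d =>
    have h1 := bettiNumber_zero_succ (cellIdeal (s.ideal F) l) d
    rw [hhilb, growth, dehomPart_cellIdeal hl, finrank_levelSpan_sup hG hs,
      card_levelSet_succ] at h1
    rw [numGens]
    split_ifs at h1 ⊢ <;> omega

/-- The lex-segment ideal has the most generators for its Hilbert function, since its growth from
degree `d` is the least possible: `1` as soon as the degree `d` part is nonzero. -/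
lemma bettiNumber_zero_le_numGens {I : Ideal (MvPolynomial (Fin 2) F)}
    (hI : ∀ d, hilbertFunction I d = (s.levelSet d).card) (j : ℕ) :
    bettiNumber I 0 j ≤ s.numGens j := by
  cases j with
  | zero =>
    rw [bettiNumber_zero_zero, hI, card_levelSet_zero, numGens]
    split_ifs <;> omega
  | succ d =>
    have h1 := bettiNumber_zero_succ I d
    rw [hI, card_levelSet_succ] at h1
    have h2 : (s.levelSet d).card ≠ 0 → (s.levelSet d).card < growth I d := by
      rw [← hI]
      exact hilbertFunction_lt_growth I
    have h3 := s.card_levelSet_ne_zero (d := d)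
    rw [numGens]
    split_ifs at h1 ⊢ <;> omega

/-- The difference of the two Betti numbers is determined by the Hilbert function, and the staircase
evaluates it as syzygies minus generators. -/
lemma bettiNumber_one_add {I : Ideal (MvPolynomial (Fin 2) F)}
    (hI : ∀ d, hilbertFunction I d = (s.levelSet d).card) (j : ℕ) :
    bettiNumber I 1 j + s.numGens j = bettiNumber I 0 j + Fintype.card (s.Rows j) := by
  cases j with
  | zero =>
    rw [bettiNumber_one_zero, bettiNumber_zero_zero, hI, card_levelSet_zero, numGens,
      card_cols_zero, Fintype.card_eq_zero]
    simp
  | succ d =>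
    have h1 := bettiNumber_zero_succ I d
    have h2 := bettiNumber_one_succ I d
    rw [hI, card_levelSet_succ] at h1
    rw [hI] at h2
    rw [numGens, card_rows_succ]
    cases d with
    | zero =>
      rw [shiftedPart_eq_bot I (by omega), finrank_bot] at h2
      rw [card_levelSet_zero] at h1 h2
      rw [card_cols_zero]
      split_ifs at h1 h2 ⊢ <;> omega
    | succ d =>
      rw [shiftedPart_add I 2 d] at h2
      have h3 : Module.finrank F (shiftedPart I 0 d) = (s.levelSet d).card := hI d
      rw [h3] at h2
      rw [card_levelSet_succ s d] at h1 h2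
      split_ifs at h1 h2 ⊢ <;> omega

end Betti

end Staircase

end GroebnerCell

namespace GroebnerCell

open MvPolynomial

namespace Staircase

/-! ### The isomorphism of the cell with affine space. -/

section Parametrization

variable (s : Staircase) {F : Type*} [Field F]

/-- The positions of the syzygy matrix whose entries parametrize the cell. -/
def Param (s : Staircase) : Type :=
  -- For `q ≤ p` with `s.deg q ≤ s.deg (p + 1)` the degrees of `p`, `q` and `p + 1` agree, and
  -- reducedness of the member `p + 1` at `q` forces the coefficient.
  {m : ℕ × ℕ // m.1 < s.width ∧ m.2 ≤ m.1 ∧ s.deg (m.1 + 1) < s.deg m.2 ∧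
    s.deg m.2 ≤ s.deg m.1 + 1}

instance finite_param : Finite s.Param := by
  refine Set.Finite.to_subtype (s := {m : ℕ × ℕ | _}) ?_
  refine ((Set.finite_lt_nat s.width).prod (Set.finite_lt_nat s.width)).subset fun m hm => ?_
  exact ⟨hm.1, lt_of_le_of_lt hm.2.1 hm.1⟩

open Classical in
/-- The coefficients of the `p`-th syzygy: the parameters, and the values that make the next
member of the family reduced. -/
def paramCoeff (a : AffSpace s.Param F) (p : ℕ) (g : Polynomial F) (q : ℕ) : F :=
  if h : p < s.width ∧ q ≤ p ∧ s.deg (p + 1) < s.deg q ∧ s.deg q ≤ s.deg p + 1 then a ⟨(p, q), h⟩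
  else if p < s.width ∧ s.deg q = s.deg p then g.coeff q else 0

/-- The family with given parameters. -/
def paramFamily (a : AffSpace s.Param F) : ℕ → Polynomial F
  | 0 => 1
  | p + 1 => Polynomial.X * paramFamily a p - ∑ q : Fin (p + 1),
      s.paramCoeff a p (Polynomial.X * paramFamily a p) q • paramFamily a q
decreasing_by all_goals omega

variable {s} (a : AffSpace s.Param F)

lemma paramFamily_zero : s.paramFamily a 0 = 1 := by
  rw [paramFamily]

lemma paramFamily_succ (p : ℕ) :
    s.paramFamily a (p + 1) = Polynomial.X * s.paramFamily a p -
      ∑ q ∈ Finset.range (p + 1),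
        s.paramCoeff a p (Polynomial.X * s.paramFamily a p) q • s.paramFamily a q := by
  rw [paramFamily, ← Fin.sum_univ_eq_sum_range
    (fun q => s.paramCoeff a p (Polynomial.X * s.paramFamily a p) q • s.paramFamily a q)]

lemma paramCoeff_param (m : s.Param) (g : Polynomial F) :
    s.paramCoeff a m.1.1 g m.1.2 = a m := by
  rw [paramCoeff, dif_pos m.2]
  rfl

lemma paramCoeff_of_width_le {p : ℕ} (hp : s.width ≤ p) (g : Polynomial F) (q : ℕ) :
    s.paramCoeff a p g q = 0 := by
  rw [paramCoeff, dif_neg (by omega), if_neg (by omega)]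

lemma paramCoeff_of_notMem {p q : ℕ} (hq : q ≤ p) (h : q ∉ s.relIndex p) (g : Polynomial F) :
    s.paramCoeff a p g q = 0 := by
  rw [mem_relIndex] at h
  rw [paramCoeff, dif_neg, if_neg (by tauto)]
  rintro ⟨h1, -, h2, h3⟩
  have := s.deg_anti hq h1.le
  omega

lemma paramCoeff_of_deg_eq {p q : ℕ} (hp : p < s.width) (h : s.deg q = s.deg p)
    (h1 : s.deg (p + 1) = s.deg p) (g : Polynomial F) : s.paramCoeff a p g q = g.coeff q := by
  rw [paramCoeff, dif_neg (by omega), if_pos ⟨hp, h⟩]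

lemma paramFamily_succ_of_width_le {p : ℕ} (hp : s.width ≤ p) :
    s.paramFamily a (p + 1) = Polynomial.X * s.paramFamily a p := by
  rw [paramFamily_succ, Finset.sum_eq_zero, sub_zero]
  intro q _
  rw [paramCoeff_of_width_le a hp, zero_smul]

lemma paramFamily_relation (p : ℕ) :
    Polynomial.X * s.paramFamily a p - s.paramFamily a (p + 1) = ∑ q ∈ s.relIndex p,
      s.paramCoeff a p (Polynomial.X * s.paramFamily a p) q • s.paramFamily a q := by
  rw [paramFamily_succ, sub_sub_cancel]
  refine (Finset.sum_subset (Finset.filter_subset _ _) fun q hq h => ?_).symm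
  rw [paramCoeff_of_notMem a (Nat.lt_succ_iff.1 (Finset.mem_range.1 hq)) h, zero_smul]

lemma isMonicFamily_paramFamily : IsMonicFamily (s.paramFamily a) := by
  intro p
  induction p using Nat.strong_induction_on with
  | _ p ih =>
    cases p with
    | zero =>
      rw [paramFamily_zero]
      exact ⟨Polynomial.monic_one, Polynomial.natDegree_one⟩
    | succ p =>
      have h1 := ih p (Nat.lt_succ_self p)
      have h2 : (Polynomial.X * s.paramFamily a p).Monic := Polynomial.monic_X.mul h1.1
      have h3 : (Polynomial.X * s.paramFamily a p).natDegree = p + 1 := by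
        rw [Polynomial.natDegree_X_mul h1.1.ne_zero, h1.2]
      have h4 : (∑ q ∈ Finset.range (p + 1),
          s.paramCoeff a p (Polynomial.X * s.paramFamily a p) q • s.paramFamily a q).degree <
          (Polynomial.X * s.paramFamily a p).degree := by
        rw [Polynomial.degree_eq_natDegree h2.ne_zero, h3]
        refine lt_of_le_of_lt (Polynomial.degree_le_of_natDegree_le (n := p) ?_)
          (by exact_mod_cast Nat.lt_succ_self p)
        refine Polynomial.natDegree_sum_le_of_forall_le _ _ fun q hq => ?_
        rw [Finset.mem_range] at hq
        exact (Polynomial.natDegree_smul_le _ _).trans ((ih q hq).2.le.trans (by omega))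
      rw [paramFamily_succ]
      exact ⟨h2.sub_of_left h4, by rw [Polynomial.natDegree_eq_of_degree_eq
        (Polynomial.degree_sub_eq_left_of_degree_lt h4), h3]⟩

/-- At such a `q` the recursion subtracts the coefficient of `X * G p`. The other `G i` contribute
nothing: for `i < q` by degree, for `i > q` by induction. -/
lemma isReduced_paramFamily : s.IsReduced (s.paramFamily a) := by
  have hm := isMonicFamily_paramFamily a
  refine ⟨hm, ?_, fun p hp => paramFamily_succ_of_width_le a hp⟩
  intro p
  induction p using Nat.strong_induction_on with
  | _ p ih =>
    intro hp q hq hd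
    cases p with
    | zero => omega
    | succ p =>
      have h1 := s.deg_succ_le hp
      have h2 := s.deg_anti (Nat.lt_succ_iff.1 hq) (by omega)
      have h3 := paramFamily_relation a p
      rw [sub_eq_iff_eq_add, ← sub_eq_iff_eq_add'] at h3
      rw [← h3, Polynomial.coeff_sub, Polynomial.finsetSum_coeff, Finset.sum_eq_single q]
      · rw [Polynomial.coeff_smul, hm.coeff_self, smul_eq_mul, mul_one,
          paramCoeff_of_deg_eq a hp (by omega) (by omega), sub_self]
      · intro i hi hiq
        rw [mem_relIndex] at hi
        rw [Polynomial.coeff_smul]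
        rcases lt_or_gt_of_ne hiq with h | h
        · rw [hm.coeff_eq_zero h, smul_zero]
        · rw [ih i (by omega) (by omega) q h (by omega), smul_zero]
      · intro h
        exact absurd (mem_relIndex.2 ⟨Nat.lt_succ_iff.1 hq, .inl (by omega)⟩) h

lemma isSyzygetic_paramFamily : s.IsSyzygetic (s.paramFamily a) := by
  intro p hp
  have h := paramFamily_relation a p
  rw [sub_eq_iff_eq_add] at h
  rw [h]
  refine add_mem (sum_mem fun q hq => Submodule.smul_mem _ _ (mem_levelSpan ?_))
    (mem_levelSpan ((s.deg_succ_le hp).trans (Nat.le_succ _)))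
  rw [mem_relIndex] at hq
  omega

/-- The parameters of a family. -/
def toParam (s : Staircase) (G : ℕ → Polynomial F) : AffSpace s.Param F :=
  fun m => s.relCoeff G m.1.1 m.1.2

lemma mem_relIndex_param (m : s.Param) : m.1.2 ∈ s.relIndex m.1.1 := by
  obtain ⟨h1, h2, h3, h4⟩ := m.2
  have := s.deg_anti h2 h1.le
  exact mem_relIndex.2 ⟨h2, by omega⟩

lemma toParam_paramFamily : s.toParam (s.paramFamily a) = a := by
  funext m
  exact (relCoeff_eq (isReduced_paramFamily a) m.2.1 (paramFamily_relation a m.1.1)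
    (mem_relIndex_param m)).trans (paramCoeff_param a m _)

/-- Both families satisfy the same recursion: a syzygy coefficient is either a parameter or, `G (p +
1)` being reduced at `q`, equal to the coefficient of `X * G p`. -/
lemma paramFamily_toParam {G : ℕ → Polynomial F} (hG : s.IsReduced G) (hs : s.IsSyzygetic G) :
    s.paramFamily (s.toParam G) = G := by
  funext p
  induction p using Nat.strong_induction_on with
  | _ p ih =>
    cases p with
    | zero => rw [paramFamily_zero, ← (hG.monic 0).1.natDegree_eq_zero.1 (hG.monic 0).2]
    | succ p =>
      rcases lt_or_ge p s.width with hp | hp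
      · have h1 := paramFamily_relation (s.toParam G) p
        have h2 := relation hG hs hp
        rw [sub_eq_iff_eq_add, ← sub_eq_iff_eq_add'] at h1 h2
        rw [← h1, ← h2, ih p (Nat.lt_succ_self p)]
        congr 1
        refine Finset.sum_congr rfl fun q hq => ?_
        have hq' := mem_relIndex.1 hq
        rw [ih q (by omega)]
        congr 1
        by_cases h : s.deg (p + 1) < s.deg q
        · exact paramCoeff_param (s.toParam G) ⟨(p, q), hp, hq'.1, h,
            show s.deg q ≤ s.deg p + 1 by omega⟩ _
        · have h3 := s.deg_succ_le hp
          rw [paramCoeff_of_deg_eq _ hp (by omega) (by omega), relCoeff, if_pos (by omega),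
            Polynomial.coeff_sub, hG.coeff_eq_zero (p + 1) hp q (by omega) (by omega), sub_zero]
      · rw [paramFamily_succ_of_width_le _ hp, hG.succ p hp, ih p (Nat.lt_succ_self p)]

/-- The parametrization of the cell. -/
def chart (s : Staircase) (a : AffSpace s.Param F) : AffSpace (CoordIndex (s.ideal F)) F :=
  s.ofFamily (s.paramFamily a)

/-- The inverse of the parametrization. -/
def chartInv (s : Staircase) (l : AffSpace (CoordIndex (s.ideal F)) F) : AffSpace s.Param F :=
  s.toParam (s.family l)

lemma family_chart : s.family (s.chart a) = s.paramFamily a :=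
  family_ofFamily (isReduced_paramFamily a)

lemma chartInv_chart : s.chartInv (s.chart a) = a := by
  rw [chartInv, family_chart, toParam_paramFamily]

lemma chart_mem (a : AffSpace s.Param F) :
    s.chart a ∈ points (s.ideal F) (cell (s.ideal F)) := by
  rw [mem_points_cell_iff, family_chart]
  exact isSyzygetic_paramFamily a

lemma chart_chartInv {l : AffSpace (CoordIndex (s.ideal F)) F}
    (hl : l ∈ points (s.ideal F) (cell (s.ideal F))) : s.chart (s.chartInv l) = l := by
  rw [chart, chartInv, paramFamily_toParam (s.isReduced_family l) (mem_points_cell_iff.1 hl),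
    ofFamily_family]

lemma range_chart : Set.range (s.chart (F := F)) = points (s.ideal F) (cell (s.ideal F)) :=
  Set.Subset.antisymm (Set.range_subset_iff.2 chart_mem) fun _ hl => ⟨_, chart_chartInv hl⟩

lemma coeff_paramFamily_mem (p i : ℕ) :
    (fun a : AffSpace s.Param F => (s.paramFamily a p).coeff i) ∈ polyFun s.Param F := by
  induction p using Nat.strong_induction_on generalizing i with
  | _ p ih =>
    cases p with
    | zero =>
      simp only [paramFamily_zero]
      exact const_mem_polyFun _
    | succ p =>
      have hX (i : ℕ) : (fun a : AffSpace s.Param F =>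
          (Polynomial.X * s.paramFamily a p).coeff i) ∈ polyFun s.Param F := by
        cases i with
        | zero =>
          simp only [Polynomial.coeff_X_mul_zero]
          exact const_mem_polyFun _
        | succ i =>
          simp only [Polynomial.coeff_X_mul]
          exact ih p (Nat.lt_succ_self p) i
      have hc (q : ℕ) : (fun a : AffSpace s.Param F =>
          s.paramCoeff a p (Polynomial.X * s.paramFamily a p) q) ∈ polyFun s.Param F := by
        unfold paramCoeff
        split_ifs
        · exact coord_mem_polyFun _
        · exact hX q
        · exact const_mem_polyFun _
      have h : (fun a : AffSpace s.Param F => (s.paramFamily a (p + 1)).coeff i) =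
          (fun a : AffSpace s.Param F => (Polynomial.X * s.paramFamily a p).coeff i) -
            ∑ q ∈ Finset.range (p + 1),
              (fun a : AffSpace s.Param F =>
                s.paramCoeff a p (Polynomial.X * s.paramFamily a p) q) *
              (fun a : AffSpace s.Param F => (s.paramFamily a q).coeff i) := by
        funext a
        rw [paramFamily_succ, Polynomial.coeff_sub, Polynomial.finsetSum_coeff, Pi.sub_apply,
          Finset.sum_apply]
        rfl
      rw [h]
      exact sub_mem (hX i) (sum_mem fun q hq =>
        mul_mem (hc q) (ih q (Finset.mem_range.1 hq) i))

lemma isRegular_chart : IsRegular (s.chart (F := F)) := fun t =>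
  neg_mem (coeff_paramFamily_mem (t.1.1 0) (t.1.2 0))

lemma coeff_family_mem {p : ℕ} (hp : p ≤ s.width) (i : ℕ) :
    (fun l : AffSpace (CoordIndex (s.ideal F)) F => (s.family l p).coeff i) ∈
      polyFun (CoordIndex (s.ideal F)) F := by
  by_cases h : i < p ∧ s.deg p < s.deg i
  · simp only [s.coeff_family_coord _ hp h.1 h.2]
    exact neg_mem (coord_mem_polyFun _)
  · simp only [s.coeff_family_of_not _ hp h]
    exact const_mem_polyFun _

lemma isRegular_chartInv : IsRegular (s.chartInv (F := F)) := by
  rintro ⟨⟨p, q⟩, hp, -⟩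
  change (fun l => s.relCoeff (s.family l) p q) ∈ polyFun (CoordIndex (s.ideal F)) F
  have h1 (i : ℕ) : (fun l : AffSpace (CoordIndex (s.ideal F)) F =>
      (Polynomial.X * s.family l p - s.family l (p + 1)).coeff i) ∈
        polyFun (CoordIndex (s.ideal F)) F := by
    have h2 : (fun l : AffSpace (CoordIndex (s.ideal F)) F =>
        (Polynomial.X * s.family l p).coeff i) ∈ polyFun (CoordIndex (s.ideal F)) F := by
      cases i with
      | zero =>
        simp only [Polynomial.coeff_X_mul_zero]
        exact const_mem_polyFun _
      | succ i =>
        simp only [Polynomial.coeff_X_mul]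
        exact coeff_family_mem (le_of_lt hp) i
    have h3 := sub_mem h2 (coeff_family_mem (F := F) (show p + 1 ≤ s.width from hp) i)
    refine (congrArg (· ∈ polyFun (CoordIndex (s.ideal F)) F)
      (_root_.funext fun l => ?_)).mp h3
    rw [Polynomial.coeff_sub]
    rfl
  unfold relCoeff
  split_ifs
  · exact h1 q
  · have h : (fun l : AffSpace (CoordIndex (s.ideal F)) F =>
        (Polynomial.X * s.family l p - s.family l (p + 1) -
          ∑ i ∈ (Finset.range (p + 1)).filter (fun i => s.deg i = s.deg p),
            Polynomial.C ((Polynomial.X * s.family l p - s.family l (p + 1)).coeff i) *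
              s.family l i).coeff q) =
        (fun l : AffSpace (CoordIndex (s.ideal F)) F =>
          (Polynomial.X * s.family l p - s.family l (p + 1)).coeff q) -
          ∑ i ∈ (Finset.range (p + 1)).filter (fun i => s.deg i = s.deg p),
            (fun l : AffSpace (CoordIndex (s.ideal F)) F =>
              (Polynomial.X * s.family l p - s.family l (p + 1)).coeff i) *
            (fun l : AffSpace (CoordIndex (s.ideal F)) F => (s.family l i).coeff q) := by
      funext l
      rw [Polynomial.coeff_sub, Polynomial.finsetSum_coeff, Pi.sub_apply, Finset.sum_apply]
      simp only [Polynomial.coeff_C_mul, Pi.mul_apply]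
    rw [h]
    refine sub_mem (h1 q) (sum_mem fun i hi => mul_mem (h1 i) (coeff_family_mem ?_ q))
    have := Finset.mem_range.1 (Finset.mem_filter.1 hi).1
    change p < s.width at hp
    omega

/-- The cell is the fixed locus of the regular map `chart ∘ chartInv`. -/
lemma isClosed_points_cell : IsClosed (points (s.ideal F) (cell (s.ideal F))) := by
  have h : points (s.ideal F) (cell (s.ideal F)) =
      ⋂ t, {l : AffSpace (CoordIndex (s.ideal F)) F | s.chart (s.chartInv l) t - l t = 0} := by
    ext l
    rw [Set.mem_iInter]
    constructor
    · intro hl t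
      rw [Set.mem_ofPred_eq, chart_chartInv hl, sub_self]
    · intro hl
      rw [← show s.chart (s.chartInv l) = l from _root_.funext fun t => sub_eq_zero.1 (hl t)]
      exact chart_mem _
  rw [h]
  exact isClosed_iInter fun t => isClosed_eq_zero
    (sub_mem (isRegular_chartInv.comp_mem (isRegular_chart t)) (coord_mem_polyFun t))

end Parametrization

end Staircase

end GroebnerCell

namespace GroebnerCell

open MvPolynomial

namespace Staircase

/-! ### Betti strata as determinantal loci in the chart. -/

section Strata

variable (s : Staircase) {F : Type*} [Field F]

/-- The entries of the syzygy matrix that are constants, as parameters of the cell. -/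
def entry (s : Staircase) (x : Σ j : Fin (s.deg 0 + 2), s.Rows j × s.Cols j) : s.Param :=
  ⟨(x.2.1.1, x.2.2.1), x.2.1.1.2, by
    obtain ⟨j, ⟨p, hp⟩, ⟨q, hq⟩⟩ := x
    have h1 := s.deg_succ_le p.2
    -- Here `s.deg q = s.deg p + 1`, so `q` precedes `p`; and `s.deg (p + 1) ≤ s.deg p < s.deg q`
    -- makes the entry a free parameter.
    have h2 : (q : ℕ) ≤ p := by
      by_contra h
      have := s.deg_anti (not_le.1 h).le q.2.le
      omega
    change (q : ℕ) ≤ p ∧ s.deg (p + 1) < s.deg q ∧ s.deg q ≤ s.deg p + 1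
    omega⟩

lemma entry_injective : Function.Injective s.entry := by
  rintro ⟨j, ⟨p, hp⟩, ⟨q, hq⟩⟩ ⟨j', ⟨p', hp'⟩, ⟨q', hq'⟩⟩ h
  have h1 := congrArg (fun m : s.Param => m.1) h
  have h2 : p = p' := Fin.ext (congrArg Prod.fst h1)
  have h3 : q = q' := Fin.ext (congrArg Prod.snd h1)
  subst h2 h3
  obtain rfl : j = j' := Fin.ext (hp.symm.trans hp')
  rfl

lemma isEmpty_rows_of_le {j : ℕ} (h : s.deg 0 + 2 ≤ j) : IsEmpty (s.Rows j) := by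
  refine ⟨fun p => ?_⟩
  have h1 := p.2
  have h2 := s.deg_anti (Nat.zero_le p.1) p.1.2.le
  omega

lemma rank_relMatrix_of_isEmpty (G : ℕ → Polynomial F) {j : ℕ} (h : IsEmpty (s.Rows j)) :
    (s.relMatrix G j).rank = 0 :=
  Nat.le_zero.1 ((Matrix.rank_le_card_height _).trans (Fintype.card_eq_zero).le)

/-- From degree `s.deg 0 + 2` on there are no rows, so finitely many matrices suffice. -/
lemma forall_rank_iff (G : ℕ → Polynomial F) (P : ℕ → ℕ → Prop)
    (hP : ∀ j, s.deg 0 + 2 ≤ j → P j 0) :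
    (∀ j : Fin (s.deg 0 + 2), P j (s.relMatrix G j).rank) ↔ ∀ j, P j (s.relMatrix G j).rank := by
  refine ⟨fun h j => ?_, fun h j => h j⟩
  rcases lt_or_ge j (s.deg 0 + 2) with hj | hj
  · exact h ⟨j, hj⟩
  · rw [s.rank_relMatrix_of_isEmpty G (s.isEmpty_rows_of_le hj)]
    exact hP j hj

variable {s} {β : ℕ → ℕ}

lemma chart_image_eq {S : Set (AffSpace s.Param F)}
    {T : Set (AffSpace (CoordIndex (s.ideal F)) F)} (h : ∀ l, l ∈ T ↔
      l ∈ points (s.ideal F) (cell (s.ideal F)) ∧ s.chartInv l ∈ S) : s.chart '' S = T := by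
  ext l
  rw [h]
  constructor
  · rintro ⟨a, ha, rfl⟩
    exact ⟨chart_mem a, by rwa [chartInv_chart]⟩
  · rintro ⟨h1, h2⟩
    exact ⟨_, h2, chart_chartInv h1⟩

lemma mem_points_bettiStratumGE (hβ : ∀ j, β j ≤ s.numGens j)
    (l : AffSpace (CoordIndex (s.ideal F)) F) :
    l ∈ points (s.ideal F) (bettiStratumGE (s.ideal F) β) ↔
      l ∈ points (s.ideal F) (cell (s.ideal F)) ∧
        s.chartInv l ∈ rankLocus F s.entry fun j => s.numGens j - β j := by
  refine and_congr_right fun hl => ?_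
  refine Iff.trans ?_ (s.forall_rank_iff (s.family l) (fun j r => r ≤ s.numGens j - β j)
    fun j _ => Nat.zero_le _).symm
  refine forall_congr' fun j => ?_
  have h1 := bettiNumber_add_rank (s := s) (l := l) hl j
  have h2 := hβ j
  omega

lemma mem_points_bettiStratum (hβ : ∀ j, β j ≤ s.numGens j)
    (hR : ∀ j, s.numGens j ≤ β j + Fintype.card (s.Rows j))
    (l : AffSpace (CoordIndex (s.ideal F)) F) :
    l ∈ points (s.ideal F) (bettiStratum (s.ideal F) β) ↔
      l ∈ points (s.ideal F) (cell (s.ideal F)) ∧ s.chartInv l ∈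
        {a : AffSpace s.Param F | ∀ j, (blockMatrix s.entry a j).rank = s.numGens j - β j} := by
  refine and_congr_right fun hl => ?_
  refine Iff.trans ?_ (s.forall_rank_iff (s.family l) (fun j r => r = s.numGens j - β j) ?_).symm
  · refine forall_congr' fun j => ?_
    have h1 := bettiNumber_add_rank (s := s) (l := l) hl j
    have h2 := hβ j
    omega
  · intro j hj
    have := s.isEmpty_rows_of_le hj
    have h1 := hR j
    rw [Fintype.card_eq_zero] at h1
    omega

variable [Infinite F]

/-- Everything is transported through the chart. Continuity of `chart` puts the locus in the closure
of the stratum; conversely the locus is closed, as the preimage of a rank locus under `chartInv`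
within the closed cell. -/
theorem strata (hβ : ∀ j, β j ≤ s.numGens j)
    (hR : ∀ j, s.numGens j ≤ β j + Fintype.card (s.Rows j))
    (hC : ∀ j, s.numGens j ≤ β j + Fintype.card (s.Cols j)) :
    IsIrreducible (points (s.ideal F) (bettiStratumGE (s.ideal F) β)) ∧
    points (s.ideal F) (bettiStratumGE (s.ideal F) β) =
      closure (points (s.ideal F) (bettiStratum (s.ideal F) β)) ∧
    codim (points (s.ideal F) (cell (s.ideal F)))
        (points (s.ideal F) (bettiStratumGE (s.ideal F) β)) =
      ((∑ j ∈ Finset.range (s.deg 0 + 2), (Fintype.card (s.Rows j) - (s.numGens j - β j)) *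
        (Fintype.card (s.Cols j) - (s.numGens j - β j)) : ℕ) : ℕ∞) := by
  have h1 := chart_image_eq (mem_points_bettiStratumGE (F := F) hβ)
  have h2 := chart_image_eq (mem_points_bettiStratum (F := F) hβ hR)
  have hR' (j : Fin (s.deg 0 + 2)) : s.numGens j - β j ≤ Fintype.card (s.Rows j) :=
    Nat.sub_le_iff_le_add'.2 (hR j)
  have hC' (j : Fin (s.deg 0 + 2)) : s.numGens j - β j ≤ Fintype.card (s.Cols j) :=
    Nat.sub_le_iff_le_add'.2 (hC j)
  refine ⟨?_, ?_, ?_⟩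
  · rw [← h1]
    exact (isIrreducible_rankLocus s.entry_injective).image _ isRegular_chart.continuous.continuousOn
  · apply Set.Subset.antisymm
    · rw [← h1, ← h2, ← closure_rank_eq s.entry_injective hR' hC']
      exact image_closure_subset_closure_image isRegular_chart.continuous
    · refine closure_minimal (fun l hl => ⟨hl.1, fun j => (hl.2 j).ge⟩) ?_
      have h3 : points (s.ideal F) (bettiStratumGE (s.ideal F) β) =
          points (s.ideal F) (cell (s.ideal F)) ∩
            s.chartInv ⁻¹' rankLocus F s.entry fun j => s.numGens j - β j :=
        Set.ext (mem_points_bettiStratumGE hβ)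
      rw [h3]
      exact isClosed_points_cell.inter (isClosed_rankLocus.preimage isRegular_chartInv.continuous)
  · rw [← h1, ← range_chart, codim_image isRegular_chart isRegular_chartInv chartInv_chart,
      height_idealOf_rankLocus s.entry_injective hR' hC',
      ← Fin.sum_univ_eq_sum_range (fun j => (Fintype.card (s.Rows j) - (s.numGens j - β j)) *
        (Fintype.card (s.Cols j) - (s.numGens j - β j)))]

end Strata

end Staircase

end GroebnerCell

namespace GroebnerCell

open MvPolynomial

/-! ### From lex-segment ideals to staircases. -/

section LexSegment

variable {F : Type*} [Field F] {L : Ideal (MvPolynomial (Fin 2) F)}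

lemma monomial_mem_of_le {a b : Fin 2 →₀ ℕ} (hab : a ≤ b) (ha : monomial a (1 : F) ∈ L) :
    monomial b (1 : F) ∈ L := by
  have h : monomial b (1 : F) = monomial (b - a) 1 * monomial a 1 := by
    rw [monomial_mul, one_mul, tsub_add_cancel_of_le hab]
  rw [h]
  exact Ideal.mul_mem_left _ _ ha

lemma IsLexSegment.mem_iff (hL : IsLexSegment L) {f : MvPolynomial (Fin 2) F} :
    f ∈ L ↔ ∀ a ∈ f.support, monomial a (1 : F) ∈ L := by
  obtain ⟨⟨A, hA⟩, -⟩ := hL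
  constructor
  · intro hf a ha
    rw [hA, mem_ideal_span_monomial_image] at hf
    obtain ⟨b, hb, hba⟩ := hf a ha
    exact monomial_mem_of_le hba (hA ▸ Ideal.subset_span ⟨b, hb, rfl⟩)
  · intro h
    rw [f.as_sum]
    refine sum_mem fun a ha => ?_
    rw [← mul_one (coeff a f), ← C_mul_monomial]
    exact Ideal.mul_mem_left _ _ (h a ha)

/-- The class of `y` is integral over the field, so a monic polynomial in `y` lies in the ideal;
being monomial, the ideal contains its top power of `y`. -/
lemma IsLexSegment.exists_pow_mem (hL : IsLexSegment L)
    (hfin : Module.Finite F (MvPolynomial (Fin 2) F ⧸ L)) :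
    ∃ n, monomial (expo 0 n) (1 : F) ∈ L := by
  obtain ⟨P, hP, h0⟩ := (Algebra.IsIntegral.of_finite F (MvPolynomial (Fin 2) F ⧸ L)).isIntegral
    (Ideal.Quotient.mkₐ F L (X 1))
  rw [← Polynomial.aeval_def, Polynomial.aeval_algHom_apply] at h0
  have hmem : Polynomial.aeval (X 1 : MvPolynomial (Fin 2) F) P ∈ L :=
    Ideal.Quotient.eq_zero_iff_mem.1 h0
  refine ⟨P.natDegree, hL.mem_iff.1 hmem _ ?_⟩
  have hX (i : ℕ) : (X 1 : MvPolynomial (Fin 2) F) ^ i = monomial (expo 0 i) 1 := by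
    rw [X_pow_eq_monomial]
    exact congrArg (fun a => monomial a 1) (ext_two (by simp) (by simp))
  rw [mem_support_iff, Polynomial.aeval_eq_sum_range, coeff_sum,
    Finset.sum_eq_single P.natDegree]
  · rw [coeff_smul, hX, coeff_monomial, if_pos rfl, Polynomial.coeff_natDegree, hP.leadingCoeff]
    simp
  · intro i _ hi
    rw [coeff_smul, hX, coeff_monomial, if_neg, smul_zero]
    intro h
    exact hi (by simpa using congrArg (fun a => a 1) h)
  · simp

open Staircase

lemma IsLexSegment.exists_staircase (hL : IsLexSegment L)
    (hfin : Module.Finite F (MvPolynomial (Fin 2) F ⧸ L)) :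
    ∃ s : Staircase, L = s.ideal F := by
  obtain ⟨n, hn⟩ := hL.exists_pow_mem hfin
  have hle {p q p' q' : ℕ} (h1 : p ≤ p') (h2 : q ≤ q') : expo p q ≤ expo p' q' := fun i => by
    fin_cases i <;> simpa
  let S (p : ℕ) : Set ℕ := {q | monomial (expo p q) (1 : F) ∈ L}
  have hS (p : ℕ) : sInf (S p) ∈ S p :=
    Nat.sInf_mem ⟨n, monomial_mem_of_le (hle (Nat.zero_le p) le_rfl) hn⟩
  -- The set of exponents is nonempty by `exists_pow_mem`, so `sInf` is attained. The drop of the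
  -- heights is the lex-segment property applied to `x^p y^q` and `x^(p+1) y^(q-1)`.
  refine ⟨⟨fun p => sInf (S p), fun p => Nat.sInf_le ?_⟩, ?_⟩
  · change monomial (expo (p + 1) (sInf (S p) - 1)) (1 : F) ∈ L
    have h1 : monomial (expo p (sInf (S p))) (1 : F) ∈ L := hS p
    rcases Nat.eq_zero_or_pos (sInf (S p)) with h | h
    · rw [h] at h1 ⊢
      exact monomial_mem_of_le (hle (Nat.le_succ p) le_rfl) h1
    · have hd : (expo p (sInf (S p))).degree = (expo (p + 1) (sInf (S p) - 1)).degree := by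
        rw [degree_expo, degree_expo]
        omega
      refine hL.2 _ _ hd ((lex_lt_iff hd).2 ?_) h1
      rw [expo_zero, expo_zero]
      exact Nat.lt_succ_self p
  · ext f
    rw [hL.mem_iff, Staircase.mem_ideal_iff]
    refine forall₂_congr fun a _ => ⟨fun h => Nat.sInf_le ?_, fun h => ?_⟩
    · change monomial (expo (a 0) (a 1)) (1 : F) ∈ L
      rwa [expo_eq_iff.2 ⟨rfl, rfl⟩]
    · refine monomial_mem_of_le (fun i => ?_) (hS (a 0))
      fin_cases i
      · simp
      · simpa using h

namespace Staircase

variable (s : Staircase)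

lemma map_ideal {K : Type*} [Field K] [Algebra F K] :
    (s.ideal F).map (MvPolynomial.map (algebraMap F K)) = s.ideal K := by
  rw [ideal, ideal, Ideal.map_span, Set.image_image]
  simp only [map_monomial, map_one]

/-- The powers of `X` are the monic family of the monomial ideal itself. -/
lemma hilbertFunction_ideal (d : ℕ) :
    hilbertFunction (s.ideal F) d = (s.levelSet d).card := by
  have hG : IsMonicFamily (fun p => (Polynomial.X : Polynomial F) ^ p) := fun p =>
    ⟨Polynomial.monic_X_pow p, Polynomial.natDegree_X_pow p⟩
  have hlead : leadingIdeal (s.ideal F) ≤ s.ideal F := by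
    refine Ideal.span_le.2 ?_
    rintro _ ⟨f, hf, rfl⟩
    rw [SetLike.mem_coe, mem_ideal_iff] at hf ⊢
    intro a ha
    by_cases h0 : f = 0
    · simp [h0] at ha
    · rw [Finset.mem_singleton.1 (support_monomial_subset ha)]
      exact hf _ (MonomialOrder.degree_mem_support h0)
  have hspan : dehomPart (s.ideal F) d = s.levelSpan (fun p => Polynomial.X ^ p) d := by
    refine hG.eq_span (fun p hp => ?_) fun g hg h0 => deg_natDegree_le_of_mem_dehomPart hlead hg h0
    rw [Set.mem_ofPred_eq] at hp
    have hpd := (s.le_deg p).trans hp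
    refine ⟨monomial (expo p (d - p)) 1, ?_, ?_⟩
    · rw [SetLike.mem_coe, mem_shiftedPart_zero, monomial_mem_ideal_iff]
      refine ⟨?_, isHomogeneous_monomial _ (by rw [degree_expo]; omega)⟩
      rw [expo_zero, expo_one]
      change p + s.height p ≤ d at hp
      omega
    · have h : monomial (expo p (d - p)) (1 : F) = X 0 ^ p * X 1 ^ (d - p) := by
        rw [X_pow_eq_monomial, X_pow_eq_monomial, monomial_mul]
        exact congrArg₂ (fun a => monomial a) (ext_two (by simp) (by simp)) (one_mul 1).symm
      change dehomogenize _ = _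
      rw [h, map_mul, map_pow, map_pow, dehomogenize_X_zero, dehomogenize_X_one, one_pow, mul_one]
  rw [← finrank_dehomPart, hspan, finrank_levelSpan hG]

lemma isEmpty_rows_width : IsEmpty (s.Rows s.width) := by
  refine ⟨fun p => ?_⟩
  have h1 := p.2
  have h2 := s.width_le_deg p.1
  omega

end Staircase

end LexSegment

end GroebnerCell

end

theorem mainTheorem6 {k K : Type*} [Field k] [Field K] [Algebra k K] [Infinite K]
    (L I : Ideal (MvPolynomial (Fin 2) k))
    (hL : GroebnerCell.IsLexSegment L)
    (hfin : Module.Finite k (MvPolynomial (Fin 2) k ⧸ L))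
    (hI : GroebnerCell.IsHomogeneousIdeal I)
    (hIL : ∀ j, GroebnerCell.hilbertFunction I j = GroebnerCell.hilbertFunction L j)
    (β : ℕ → ℕ) (hβ : ∀ j, β j = GroebnerCell.bettiNumber I 0 j)
    (LK : Ideal (MvPolynomial (Fin 2) K))
    (hLK : LK = L.map (MvPolynomial.map (algebraMap k K))) :
    IsIrreducible (GroebnerCell.points LK (GroebnerCell.bettiStratumGE LK β)) ∧
    GroebnerCell.points LK (GroebnerCell.bettiStratumGE LK β) =
      closure (GroebnerCell.points LK (GroebnerCell.bettiStratum LK β)) ∧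
    GroebnerCell.codim (GroebnerCell.points LK (GroebnerCell.cell LK))
        (GroebnerCell.points LK (GroebnerCell.bettiStratumGE LK β)) =
      ((∑ᶠ j, GroebnerCell.bettiNumber I 1 j * GroebnerCell.bettiNumber I 0 j : ℕ) : ℕ∞) := by
  obtain ⟨s, rfl⟩ := hL.exists_staircase hfin
  have hH (d : ℕ) := (hIL d).trans (s.hilbertFunction_ideal d)
  obtain rfl : β = GroebnerCell.bettiNumber I 0 := funext hβ
  rw [s.map_ideal] at hLK
  subst hLK
  have h0 (j : ℕ) := GroebnerCell.Staircase.bettiNumber_zero_le_numGens hH j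
  have h1 (j : ℕ) := GroebnerCell.Staircase.bettiNumber_one_add hH j
  have hw : Fintype.card (s.Rows s.width) = 0 :=
    Fintype.card_eq_zero_iff.2 s.isEmpty_rows_width
  have hC (j : ℕ) : s.numGens j ≤ GroebnerCell.bettiNumber I 0 j + Fintype.card (s.Cols j) := by
    have h2 := h1 j
    -- In degree `s.width` there is one more generator than columns, but there are no rows there, so
    -- the bound still holds.
    rw [GroebnerCell.Staircase.numGens] at h2 ⊢
    split_ifs at h2 ⊢ with h
    · subst h
      omega
    · omega
  have hR (j : ℕ) : s.numGens j ≤ GroebnerCell.bettiNumber I 0 j + Fintype.card (s.Rows j) :=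
    (Nat.le_add_left _ _).trans (h1 j).le
  obtain ⟨hirr, hclosure, hcodim⟩ := GroebnerCell.Staircase.strata (F := K) h0 hR hC
  refine ⟨hirr, hclosure, hcodim.trans (congrArg _ ?_)⟩
  rw [finsum_eq_sum_of_support_subset (s := Finset.range (s.deg 0 + 2))]
  · refine Finset.sum_congr rfl fun j _ => ?_
    have h2 := h1 j
    have h3 := h0 j
    rw [GroebnerCell.Staircase.numGens] at h2 h3 ⊢
    split_ifs at h2 h3 ⊢ with h
    -- In degree `s.width` the second factors differ by one, but both first factors are `0`.
    · subst h
      have h4 : GroebnerCell.bettiNumber I 1 s.width = 0 := by omega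
      rw [hw, h4, Nat.zero_sub, zero_mul, zero_mul]
    · congr 1 <;> omega
  -- Beyond the last degree with rows, the first Betti number vanishes.
  · intro j hj
    rw [Finset.mem_coe, Finset.mem_range]
    by_contra hlt
    have := s.isEmpty_rows_of_le (not_lt.1 hlt)
    have h2 := h1 j
    have h3 := h0 j
    rw [Fintype.card_eq_zero] at h2
    exact hj (mul_eq_zero_of_left (by omega) _)
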